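/- Let $\mathcal C$ be a triangulated category whose Grothendieck group $K(\mathcal C)$ is free of finite rank. Put $\Lambda=K(\mathcal C)$ and fix a norm $\|\cdot\|$ on $\Lambda\otimes\mathbb R$. Let $\mathrm{Slice}(\mathcal C)$ be the space of locally finite slicings $P$ of $\mathcal C$, with the metric $d(P,Q)=\sup_{0\ne c}\max\{|\phi_P^-(c)-\phi_Q^-(c)|,|\phi_P^+(c)-\phi_Q^+(c)|\}$. A lax pre-stability condition is a pair $\sigma=(P,Z)\in\mathrm{Slice}(\mathcal C)\times\mathrm{Hom}(\Lambda,\mathbb C)$ such that $Z(c)=m(c)e^{i\pi\phi}$ with $m(c)\ge 0$ whenever $0\neq c\in P(\phi)$. The mass $m(c)=\sum_i|Z(a_i)|$ of an object $c$ is the sum over its semistable factors $a_i$, and the massless subcategory of $\sigma$ is the full subcategory of the objects of mass $0$. A lax stability condition is a lax pre-stability condition for which there is $K>0$ with $|Z(s)|\ge\|[s]\|/K$ for every stable object $s$ of positive mass, where stable means simple in some slice $P(\phi)$. A (classical) stability condition is a pair such that $m(c)>0$ for every nonzero semistable $c$ and $|Z(c)|\ge\|[c]\|/K$ for all semistable $c$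 and some $K>0$; its heart is the abelian category $P(0,1]$. Let $\mathcal S$ be a connected component of the space $\mathrm{Stab}(\mathcal C)\subset\mathrm{Slice}(\mathcal C)\times\mathrm{Hom}(\Lambda,\mathbb C)$ of stability conditions, and suppose that $\mathcal S$ has finite type, i.e. the heart of each stability condition in $\mathcal S$ is a finite length abelian category with finitely many isomorphism classes of simple objects and with only finitely many torsion pairs. Let $\mathcal N$ be a full subcategory of $\mathcal C$. Then $\mathcal N$ is the massless subcategory of some lax stability condition lying in the closure of $\mathcal S$ in $\mathrm{Slice}(\mathcal C)\times\mathrm{Hom}(\Lambda,\mathbb C)$ if and only if $\mathcal N$ is the triangulated closure (the smallest strictly full triangulated subcategory containing the given objects) of a finite set of simple objects in the heart of some stability condition $\tau\in\mathcal S$. -/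

import Mathlib

open CategoryTheory CategoryTheory.Limits CategoryTheory.Pretriangulated
open scoped TensorProduct ENNReal

universe v u

namespace LaxStab

/-! ### Length categories, simple objects and torsion pairs -/

section Categories

variable {A : Type u} [Category.{v} A] [Preadditive A]

/-- The poset of strict subobjects of `X`: those represented by a kernel. In a quasi-abelian
category the kernels are exactly the strict monomorphisms. -/
def StrictSubobject (X : A) : Type (max u v) :=
  {S : Subobject X // Nonempty (NormalMono S.arrow)}

instance (X : A) : PartialOrder (StrictSubobject X) :=
  inferInstanceAs (PartialOrder {S : Subobject X // Nonempty (NormalMono S.arrow)})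

variable (A) in
/-- The length condition for a quasi-abelian category: each object satisfies the ascending
and the descending chain condition on strict subobjects. -/
def IsLengthQuasiAbelian : Prop :=
  ∀ X : A, WellFoundedLT (StrictSubobject X) ∧ WellFoundedGT (StrictSubobject X)

/-- `X` is nonzero and has no strict subobjects other than `0` and `X`. -/
def IsStrictlySimple (X : A) : Prop :=
  ¬ IsZero X ∧ ∀ (Y : A) (f : Y ⟶ X), Nonempty (NormalMono f) → IsZero Y ∨ IsIso f

variable (A) in
/-- The condition for an abelian category to be of finite length, with finitely many simple
objects up to isomorphism. -/
def IsAlgebraic : Prop :=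
  (∀ X : A, IsArtinianObject X ∧ IsNoetherianObject X) ∧
    ∃ s : Set A, s.Finite ∧ ∀ X : A, Simple X → ∃ Y ∈ s, Nonempty (X ≅ Y)

/-- A torsion pair `(T, F)` of strictly full subcategories of an abelian category. -/
structure IsTorsionPair (T F : ObjectProperty A) : Prop where
  iso_torsion : T.IsClosedUnderIsomorphisms
  iso_free : F.IsClosedUnderIsomorphisms
  hom_eq_zero : ∀ (X Y : A) (f : X ⟶ Y), T X → F Y → f = 0
  exists_shortExact : ∀ X : A, ∃ S : ShortComplex A,
    S.ShortExact ∧ T S.X₁ ∧ Nonempty (S.X₂ ≅ X) ∧ F S.X₃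

variable (A) in
/-- There are only finitely many torsion pairs. -/
def FinitelyManyTorsionPairs : Prop :=
  {p : ObjectProperty A × ObjectProperty A | IsTorsionPair p.1 p.2}.Finite

end Categories

section Triangulated

variable (C : Type u) [Category.{v} C] [HasZeroObject C] [HasShift C ℤ] [Preadditive C]
  [∀ n : ℤ, (shiftFunctor C n).Additive] [Pretriangulated C]

/-! ### The Grothendieck group and charges -/

/-- The relations `[b] = [a] + [c]` for the distinguished triangles `a ⟶ b ⟶ c ⟶ a⟦1⟧`. -/
def K0Relations : AddSubgroup (FreeAbelianGroup C) :=
  AddSubgroup.closure {x | ∃ T ∈ distTriang C, x = FreeAbelianGroup.of T.obj₂ -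
    (FreeAbelianGroup.of T.obj₁ + FreeAbelianGroup.of T.obj₃)}

/-- The Grothendieck group of a triangulated category. -/
def K0 : Type u := FreeAbelianGroup C ⧸ K0Relations C

noncomputable instance : AddCommGroup (K0 C) :=
  inferInstanceAs (AddCommGroup (FreeAbelianGroup C ⧸ K0Relations C))

variable {C} in
/-- The class of an object in the Grothendieck group. -/
def K0.of (c : C) : K0 C := QuotientAddGroup.mk' (K0Relations C) (FreeAbelianGroup.of c)

/-- The group of charges, for the lattice `Λ = K(C)`. -/
abbrev Charge : Type u := K0 C →+ ℂ

/-- The topology of pointwise convergence. When `K(C)` is finitely generated this is the usual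
topology of the finite-dimensional vector space of charges, i.e. that of any operator norm. -/
noncomputable instance : TopologicalSpace (Charge C) :=
  TopologicalSpace.induced (fun Z : Charge C => (Z : K0 C → ℂ)) inferInstance

/-! ### Slicings -/

variable {C} in
/-- A finite filtration `0 = c₀ ⟶ c₁ ⟶ ⋯ ⟶ cₙ = c` whose cones are nonzero objects
`aᵢ ∈ P (φᵢ)`, with `φ₁ > ⋯ > φₙ`. It has length `0` exactly when `c` is zero. -/
structure HNFiltration (P : ℝ → ObjectProperty C) (c : C) where
  n : ℕ
  obj : Fin (n + 1) → C
  factor : Fin n → C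
  phase : Fin n → ℝ
  isZero_obj_zero : IsZero (obj 0)
  obj_last : Nonempty (obj (Fin.last n) ≅ c)
  exists_triangle : ∀ i : Fin n, ∃ (f : obj i.castSucc ⟶ obj i.succ) (g : obj i.succ ⟶ factor i)
    (h : factor i ⟶ (obj i.castSucc)⟦(1 : ℤ)⟧), Triangle.mk f g h ∈ distTriang C
  factor_mem : ∀ i, P (phase i) (factor i)
  factor_ne_zero : ∀ i, ¬ IsZero (factor i)
  phase_strictAnti : StrictAnti phase

/-- A slicing of a triangulated category. -/
structure Slicing where
  /-- the semistable objects of phase `φ` -/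
  P : ℝ → ObjectProperty C
  iso_closed : ∀ φ, (P φ).IsClosedUnderIsomorphisms
  zero_mem : ∀ (φ : ℝ) (X : C), IsZero X → P φ X
  biprod_mem : ∀ (φ : ℝ) (X Y : C), P φ X → P φ Y → P φ (X ⊞ Y)
  shift_iff : ∀ (φ : ℝ) (X : C), P (φ + 1) (X⟦(1 : ℤ)⟧) ↔ P φ X
  hom_eq_zero : ∀ (φ ψ : ℝ) (X Y : C) (f : X ⟶ Y), ψ < φ → P φ X → P ψ Y → f = 0
  exists_HN : ∀ c : C, Nonempty (HNFiltration P c)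

variable {C}

namespace Slicing

/-- A Harder-Narasimhan filtration of `c`; its phases and the isomorphism classes of its factors
do not depend on the choice. -/
noncomputable def hn (P : Slicing C) (c : C) : HNFiltration P.P c :=
  Classical.choice (P.exists_HN c)

/-- The maximal phase `φ⁺(c)` of a nonzero object (and `0` if `c` is zero). -/
noncomputable def phiPlus (P : Slicing C) (c : C) : ℝ :=
  if h : 0 < (P.hn c).n then (P.hn c).phase ⟨0, h⟩ else 0

/-- The minimal phase `φ⁻(c)` of a nonzero object (and `0` if `c` is zero). -/
noncomputable def phiMinus (P : Slicing C) (c : C) : ℝ :=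
  if h : 0 < (P.hn c).n then (P.hn c).phase ⟨(P.hn c).n - 1, Nat.sub_one_lt h.ne'⟩ else 0

/-- The full subcategory `P(I)` on the objects whose semistable factors have phases in `I`. -/
def interval (P : Slicing C) (I : Set ℝ) : ObjectProperty C :=
  fun c => ∃ H : HNFiltration P.P c, ∀ i, H.phase i ∈ I

/-- The heart `P(0,1]`, which is an abelian category. -/
abbrev Heart (P : Slicing C) : Type u := (P.interval (Set.Ioc 0 1)).FullSubcategory

/-- An object is stable if it is simple in some slice `P(φ)`. -/
def IsStable (P : Slicing C) (c : C) : Prop :=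
  ∃ (φ : ℝ) (h : P.P φ c), IsStrictlySimple (⟨c, h⟩ : (P.P φ).FullSubcategory)

/-- `P` is locally finite if for some `ε > 0` each `P(φ-ε,φ+ε)` is a length quasi-abelian
category. With `ε < 1/2` (no restriction, as `ε` may be shrunk) these intervals have length less
than one, so that the categories are automatically quasi-abelian. -/
def IsLocallyFinite (P : Slicing C) : Prop :=
  ∃ ε : ℝ, 0 < ε ∧ ε < 1 / 2 ∧
    ∀ φ : ℝ, IsLengthQuasiAbelian (P.interval (Set.Ioo (φ - ε) (φ + ε))).FullSubcategory

end Slicing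

variable (C) in
/-- The type of locally finite slicings. -/
def LFSlicing : Type _ := {P : Slicing C // P.IsLocallyFinite}

/-- The (possibly infinite) distance between slicings: the supremum over the nonzero objects
of the differences of the minimal and of the maximal phases. -/
noncomputable instance : PseudoEMetricSpace (LFSlicing C) where
  edist P Q := ⨆ c : {c : C // ¬ IsZero c},
    max (edist (P.1.phiMinus c.1) (Q.1.phiMinus c.1)) (edist (P.1.phiPlus c.1) (Q.1.phiPlus c.1))
  edist_self P := by simp
  edist_comm P Q := by simp only [edist_comm]
  edist_triangle P Q R := by
    refine iSup_le fun c => max_le ?_ ?_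
    · refine (edist_triangle _ (Q.1.phiMinus c.1) _).trans (add_le_add ?_ ?_)
      · exact (le_max_left _ _).trans (le_iSup (fun c : {c : C // ¬ IsZero c} =>
          max (edist (P.1.phiMinus c.1) (Q.1.phiMinus c.1))
            (edist (P.1.phiPlus c.1) (Q.1.phiPlus c.1))) c)
      · exact (le_max_left _ _).trans (le_iSup (fun c : {c : C // ¬ IsZero c} =>
          max (edist (Q.1.phiMinus c.1) (R.1.phiMinus c.1))
            (edist (Q.1.phiPlus c.1) (R.1.phiPlus c.1))) c)
    · refine (edist_triangle _ (Q.1.phiPlus c.1) _).trans (add_le_add ?_ ?_)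
      · exact (le_max_right _ _).trans (le_iSup (fun c : {c : C // ¬ IsZero c} =>
          max (edist (P.1.phiMinus c.1) (Q.1.phiMinus c.1))
            (edist (P.1.phiPlus c.1) (Q.1.phiPlus c.1))) c)
      · exact (le_max_right _ _).trans (le_iSup (fun c : {c : C // ¬ IsZero c} =>
          max (edist (Q.1.phiMinus c.1) (R.1.phiMinus c.1))
            (edist (Q.1.phiPlus c.1) (R.1.phiPlus c.1))) c)

/-! ### Stability conditions and lax stability conditions -/

variable (C) in
/-- The space of pairs `(P, Z)` of a locally finite slicing and a charge, with the product
topology. -/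
abbrev SlicingCharge : Type _ := LFSlicing C × Charge C

namespace SlicingCharge

/-- The slicing of a pair `(P, Z)`. -/
abbrev slicing (σ : SlicingCharge C) : Slicing C := σ.1.1

/-- The charge `Z(c)` of an object. -/
noncomputable def Z (σ : SlicingCharge C) (c : C) : ℂ := σ.2 (K0.of c)

/-- The mass `m(c)`: the sum of the `|Z(aᵢ)|` over the semistable factors `aᵢ` of `c`. -/
noncomputable def mass (σ : SlicingCharge C) (c : C) : ℝ :=
  ∑ i, ‖σ.Z ((σ.slicing.hn c).factor i)‖

/-- A (classical) pre-stability condition. -/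
def IsPreStability (σ : SlicingCharge C) : Prop :=
  ∀ (φ : ℝ) (c : C), σ.slicing.P φ c → ¬ IsZero c →
    ∃ m : ℝ, 0 < m ∧ σ.Z c = m * Complex.exp (Complex.I * Real.pi * φ)

/-- A lax pre-stability condition: semistable objects may be massless. -/
def IsLaxPreStability (σ : SlicingCharge C) : Prop :=
  ∀ (φ : ℝ) (c : C), σ.slicing.P φ c → ¬ IsZero c →
    ∃ m : ℝ, 0 ≤ m ∧ σ.Z c = m * Complex.exp (Complex.I * Real.pi * φ)

/-- The massless subcategory: the full subcategory on the objects of mass zero. -/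
def massless (σ : SlicingCharge C) : ObjectProperty C := fun c => σ.mass c = 0

variable (nrm : Seminorm ℝ (ℝ ⊗[ℤ] K0 C))

/-- A stability condition: a pre-stability condition with the support property, relative to a
norm `nrm` on `K(C) ⊗ ℝ`. -/
def IsStability (σ : SlicingCharge C) : Prop :=
  σ.IsPreStability ∧ ∃ K : ℝ, 0 < K ∧ ∀ (φ : ℝ) (c : C), σ.slicing.P φ c →
    1 / K * nrm (1 ⊗ₜ K0.of c) ≤ ‖σ.Z c‖

/-- A lax stability condition: a lax pre-stability condition for which the support condition
holds on the massive stable objects. -/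
def IsLaxStability (σ : SlicingCharge C) : Prop :=
  σ.IsLaxPreStability ∧ ∃ K : ℝ, 0 < K ∧ ∀ s : C, σ.slicing.IsStable s → 0 < σ.mass s →
    1 / K * nrm (1 ⊗ₜ K0.of s) ≤ ‖σ.Z s‖

end SlicingCharge

/-- The space of stability conditions. -/
def Stab (nrm : Seminorm ℝ (ℝ ⊗[ℤ] K0 C)) : Set (SlicingCharge C) := {σ | σ.IsStability nrm}

/-- `S` is a connected component of the space of stability conditions. -/
def IsStabComponent (nrm : Seminorm ℝ (ℝ ⊗[ℤ] K0 C)) (S : Set (SlicingCharge C)) : Prop :=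
  ∃ σ ∈ Stab nrm, S = connectedComponentIn (Stab nrm) σ

/-- The space of lax stability conditions attached to a component `S`: the lax stability
conditions in the closure of `S` in the space of all pairs `(P, Z)`. -/
def LaxStabOf (nrm : Seminorm ℝ (ℝ ⊗[ℤ] K0 C)) (S : Set (SlicingCharge C)) :
    Set (SlicingCharge C) :=
  {σ | σ.IsLaxStability nrm} ∩ closure S

/-- `S` has finite type: each of its members has an algebraic heart with finitely many torsion
pairs. -/
def IsFiniteType (S : Set (SlicingCharge C)) : Prop :=
  ∀ σ ∈ S, IsAlgebraic σ.slicing.Heart ∧ FinitelyManyTorsionPairs σ.slicing.Heart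

/-- The triangulated closure of a class of objects: the smallest strictly full triangulated
subcategory containing it. -/
def triangulatedClosure (G : ObjectProperty C) : ObjectProperty C :=
  fun X => ∀ Q : ObjectProperty C, Q.IsTriangulated → Q.IsClosedUnderIsomorphisms → G ≤ Q → Q X

end Triangulated

end LaxStab

open LaxStab

open scoped ZeroObject

set_option linter.unusedSectionVars false

namespace LaxStab

/-! ### Extensions, Grothendieck classes and iterated filtrations. -/

section Extensions

variable {C : Type u} [Category.{v} C] [HasZeroObject C] [HasShift C ℤ] [Preadditive C]
  [∀ n : ℤ, (shiftFunctor C n).Additive] [Pretriangulated C]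

/-! Both directions reduce to one description of massless objects. Let `σ` be a lax pre-stability
condition and `θ` a cut such that no phase lies in `θ + ℤ` and the heart `P(θ, θ + 1]` has finite
length. After rotation by `-πθ` the charge maps this heart to the open upper half plane together
with `0`. Heights therefore add without cancellation: an object of the heart has zero charge only if
all its composition factors do, and the massless subcategory is generated by the massless simple
objects of the heart (`massless_eq_triangulatedClosure`).

From a lax condition to simple objects: a nearby `τ₀` in `S` has a heart with finitely many torsion
pairs. Cutting that heart at different occurring phases of `σ` gives different torsion pairs
(`finite_phases`), so `σ` has only finitely many phases in a window and there is a cut `θ` with a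
gap `δ` around it (`exists_gap`). A second `τ` in `S`, closer than `δ`, has the same subcategory
`P(θ, θ + 1]` as `σ` (`isHeart_of_near`). This is the heart of a rotation of `τ`, which stays in
`S`, so it is algebraic and the description above applies.

From simple objects to a lax condition: a small rotation moves all phases away from the integers
without changing the heart. The linear maps `x + i y ↦ u x + i y`, with `u` going from `1` to `0`,
carry slicing and charge along and keep the heart, until the heart is the single slice of phase `1 /
2` and the charge is purely imaginary. Since `K(C)` is free on the simple objects (`exists_hom_K0`),
the imaginary part may then be moved linearly, with the slicing fixed, to the function that is `0`
on the chosen simple objects and `1` on the others (`exists_lax_of_simples`). Everything before the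
end point is a stability condition in `S`; the end point is lax and lies in the closure.

The freeness of `K(C)` and the comparison of truncations both come from words in shifted simple
objects. Schur's lemma and the octahedral axiom sort such a word by degree, cancelling adjacent
pairs with an invertible connecting morphism (`sort_word`). -/

lemma exists_lift_of_distTriang {a b c x : C} {f : a ⟶ b} {g : b ⟶ c} {w : c ⟶ a⟦(1 : ℤ)⟧}
    (H : Triangle.mk f g w ∈ distTriang C) (s : x ⟶ b) (hs : s ≫ g = 0) :
    ∃ k : x ⟶ a, s = k ≫ f :=
  Triangle.coyoneda_exact₂ _ H s hs

lemma exists_desc_of_distTriang {a b c x : C} {f : a ⟶ b} {g : b ⟶ c} {w : c ⟶ a⟦(1 : ℤ)⟧}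
    (H : Triangle.mk f g w ∈ distTriang C) (s : b ⟶ x) (hs : f ≫ s = 0) :
    ∃ k : c ⟶ x, s = g ≫ k :=
  Triangle.yoneda_exact₂ _ H s hs

/-- `b` is an extension of `c` by `a`: there is a distinguished triangle `a ⟶ b ⟶ c ⟶ a⟦1⟧`. -/
def IsExt (a b c : C) : Prop :=
  ∃ (f : a ⟶ b) (g : b ⟶ c) (h : c ⟶ a⟦(1 : ℤ)⟧), Triangle.mk f g h ∈ distTriang C

lemma IsExt.of_iso {a b c a' b' c' : C} (h : IsExt a b c) (ea : a ≅ a') (eb : b ≅ b')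
    (ec : c ≅ c') : IsExt a' b' c' := by
  obtain ⟨f, g, h, H⟩ := h
  refine ⟨ea.inv ≫ f ≫ eb.hom, eb.inv ≫ g ≫ ec.hom, ec.inv ≫ h ≫ (ea.hom)⟦(1 : ℤ)⟧', ?_⟩
  refine isomorphic_distinguished _ H _ (Triangle.isoMk _ _ ea.symm eb.symm ec.symm ?_ ?_ ?_)
  · exact (by simp : (ea.inv ≫ f ≫ eb.hom) ≫ eb.inv = ea.inv ≫ f)
  · exact (by simp : (eb.inv ≫ g ≫ ec.hom) ≫ ec.inv = eb.inv ≫ g)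
  · exact (by simp [← Functor.map_comp] :
      (ec.inv ≫ h ≫ (ea.hom)⟦(1 : ℤ)⟧') ≫ (ea.inv)⟦(1 : ℤ)⟧' = ec.inv ≫ h)

lemma IsExt.shift {a b c : C} (h : IsExt a b c) (n : ℤ) : IsExt (a⟦n⟧) (b⟦n⟧) (c⟦n⟧) := by
  obtain ⟨f, g, h, H⟩ := h
  exact ⟨_, _, _, Triangle.shift_distinguished _ H n⟩

lemma IsExt.rotate {a b c : C} (h : IsExt a b c) : IsExt b c (a⟦(1 : ℤ)⟧) := by
  obtain ⟨f, g, h, H⟩ := h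
  exact ⟨_, _, _, rot_of_distTriang _ H⟩

lemma IsExt.invRotate {a b c : C} (h : IsExt a b c) : IsExt (c⟦(-1 : ℤ)⟧) a b := by
  obtain ⟨f, g, h, H⟩ := h
  exact ⟨_, _, _, inv_rot_of_distTriang _ H⟩

lemma isExt_zero_left {z : C} (hz : IsZero z) (b : C) : IsExt z b b :=
  IsExt.of_iso ⟨_, _, _, contractible_distinguished₁ b⟩ (hz.isoZero.symm) (Iso.refl _)
    (Iso.refl _)

lemma isExt_zero_right {z : C} (hz : IsZero z) (b : C) : IsExt b b z :=
  IsExt.of_iso ⟨_, _, _, contractible_distinguished b⟩ (Iso.refl _) (Iso.refl _)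
    (hz.isoZero.symm)

lemma IsExt.iso_of_isZero_left {a b c : C} (h : IsExt a b c) (ha : IsZero a) :
    Nonempty (b ≅ c) := by
  obtain ⟨f, g, h, H⟩ := h
  have : IsIso g := (Triangle.isZero₁_iff_isIso₂ _ H).1 ha
  exact ⟨asIso g⟩

lemma IsExt.iso_of_isZero_right {a b c : C} (h : IsExt a b c) (hc : IsZero c) :
    Nonempty (a ≅ b) := by
  obtain ⟨f, g, h, H⟩ := h
  have : IsIso f := (Triangle.isZero₃_iff_isIso₁ _ H).1 hc
  exact ⟨asIso f⟩

lemma isExt_biprod (a b : C) : IsExt a (a ⊞ b) b :=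
  ⟨_, _, _, binaryBiproductTriangle_distinguished a b⟩

lemma isZero_shift {a : C} (ha : IsZero a) (n : ℤ) : IsZero (a⟦n⟧) :=
  (shiftFunctor C n).map_isZero ha

lemma isZero_of_shift {a : C} {n : ℤ} (ha : IsZero (a⟦n⟧)) : IsZero a :=
  ((shiftFunctor C (-n)).map_isZero ha).of_iso ((shiftShiftNeg a n).symm)

/-- A property containing the outer terms and closed under extensions contains the middle. -/
lemma IsExt.hom_left_eq_zero {a b c y : C} (h : IsExt a b c) (ha : ∀ f : a ⟶ y, f = 0)
    (hc : ∀ f : c ⟶ y, f = 0) (f : b ⟶ y) : f = 0 := by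
  obtain ⟨i, g, w, H⟩ := h
  obtain ⟨k, hk⟩ := Triangle.yoneda_exact₂ _ H f (ha _)
  exact hk.trans ((congrArg (g ≫ ·) (hc k)).trans comp_zero)

lemma IsExt.hom_right_eq_zero {a b c x : C} (h : IsExt a b c) (ha : ∀ f : x ⟶ a, f = 0)
    (hc : ∀ f : x ⟶ c, f = 0) (f : x ⟶ b) : f = 0 := by
  obtain ⟨i, g, w, H⟩ := h
  obtain ⟨k, hk⟩ := Triangle.coyoneda_exact₂ _ H f (hc _)
  exact hk.trans ((congrArg (· ≫ i) (ha k)).trans zero_comp)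

/-- If `a ⟶ b` vanishes because there are no morphisms, and there is no morphism
`a ⟶ c⟦-1⟧`, then `a` is zero. -/
lemma IsExt.isZero_left {a b c : C} (h : IsExt a b c) (hab : ∀ f : a ⟶ b, f = 0)
    (hac : ∀ f : a ⟶ c⟦(-1 : ℤ)⟧, f = 0) : IsZero a := by
  rw [IsZero.iff_id_eq_zero]
  exact h.invRotate.hom_right_eq_zero hac hab _

lemma IsExt.isZero_right {a b c : C} (h : IsExt a b c) (hbc : ∀ f : b ⟶ c, f = 0)
    (hac : ∀ f : a⟦(1 : ℤ)⟧ ⟶ c, f = 0) : IsZero c := by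
  rw [IsZero.iff_id_eq_zero]
  exact h.rotate.hom_left_eq_zero hbc hac _

/-- A zero connecting morphism splits the triangle, and the summands of a biproduct may be listed in
either order. -/
lemma isExt_swap_of_eq_zero {a b c : C} {f : a ⟶ b} {g : b ⟶ c} {w : c ⟶ a⟦(1 : ℤ)⟧}
    (H : Triangle.mk f g w ∈ distTriang C) (hw : w = 0) : IsExt c b a := by
  obtain ⟨e, -, -⟩ := exists_iso_binaryBiproduct_of_distTriang _ H hw
  exact (isExt_biprod c a).of_iso (Iso.refl _) (biprod.braiding c a ≪≫ e.symm) (Iso.refl _)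

lemma IsExt.K0_of {a b c : C} (h : IsExt a b c) : K0.of b = K0.of a + K0.of c := by
  obtain ⟨f, g, w, H⟩ := h
  have : K0.of b - (K0.of a + K0.of c) = 0 := by
    rw [K0.of, K0.of, K0.of]
    erw [← map_add, ← map_sub]
    exact (QuotientAddGroup.eq_zero_iff _).2 (AddSubgroup.subset_closure ⟨_, H, rfl⟩)
  rwa [sub_eq_zero] at this

lemma K0.of_isZero {a : C} (ha : IsZero a) : K0.of a = 0 := by
  have := (isExt_zero_left ha a).K0_of
  simpa using this

lemma K0.of_iso {a b : C} (e : a ≅ b) : K0.of a = K0.of b := by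
  have := ((isExt_zero_left (isZero_zero C) a).of_iso (Iso.refl _) (Iso.refl _) e).K0_of
  rwa [K0.of_isZero (isZero_zero C), zero_add] at this

lemma K0.of_shift_one (a : C) : K0.of (a⟦(1 : ℤ)⟧) = - K0.of a := by
  have h3 := (isExt_zero_right (isZero_zero C) a).rotate.K0_of
  rw [K0.of_isZero (isZero_zero C)] at h3
  rw [eq_comm, add_comm] at h3
  exact eq_neg_of_add_eq_zero_left h3

lemma K0.of_shift (a : C) (n : ℤ) : K0.of (a⟦n⟧) = n.negOnePow • K0.of a := by
  induction n using Int.induction_on with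
  | zero =>
    rw [K0.of_iso ((shiftFunctorZero C ℤ).app a)]
    simp
  | succ n ih =>
    rw [K0.of_iso ((shiftFunctorAdd C (n : ℤ) 1).app a)]
    erw [K0.of_shift_one]
    rw [ih, Int.negOnePow_succ, Units.neg_smul]
  | pred n ih =>
    have h : K0.of (a⟦(-(n : ℤ) - 1)⟧⟦(1 : ℤ)⟧) = (-(n : ℤ)).negOnePow • K0.of a := by
      rw [← ih]
      exact K0.of_iso ((shiftFunctorAdd' C (-(n : ℤ) - 1) 1 (-n) (by omega)).symm.app a)
    rw [K0.of_shift_one] at h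
    rw [← neg_neg (K0.of _), h, Int.negOnePow_sub, Int.negOnePow_one]
    simp

section Octahedral

variable [IsTriangulated C]

/-- The octahedral axiom for `a ⟶ b ⟶ d`, read as rebracketing a three-step filtration. Its
companion `IsExt.assoc'` rebrackets in the other direction. -/
lemma IsExt.assoc {a b c d e : C} (h₁ : IsExt a b c) (h₂ : IsExt b d e) :
    ∃ x, IsExt a d x ∧ IsExt c x e := by
  obtain ⟨f₁, g₁, w₁, H₁⟩ := h₁
  obtain ⟨f₂, g₂, w₂, H₂⟩ := h₂
  obtain ⟨x, g₃, w₃, H₃⟩ := distinguished_cocone_triangle (f₁ ≫ f₂)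
  exact ⟨x, ⟨_, _, _, H₃⟩, ⟨_, _, _, (Triangulated.someOctahedron rfl H₁ H₂ H₃).mem⟩⟩

lemma IsExt.assoc' {a c d e x : C} (h₁ : IsExt a d x) (h₂ : IsExt c x e) :
    ∃ b, IsExt a b c ∧ IsExt b d e := by
  obtain ⟨f₁, g₁, w₁, H₁⟩ := h₁
  obtain ⟨f₂, g₂, w₂, H₂⟩ := h₂
  obtain ⟨b, g₃, w₃, H₃⟩ := distinguished_cocone_triangle₁ (g₁ ≫ g₂)
  exact ⟨b, ⟨_, _, _, (Triangulated.someOctahedron' rfl H₁ H₂ H₃).mem⟩, ⟨_, _, _, H₃⟩⟩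

end Octahedral

/-- `c` has a finite filtration with the given list of cones, listed from the last quotient
to the first. -/
inductive IsFilt : List C → C → Prop
  | nil {c : C} (hc : IsZero c) : IsFilt [] c
  | cons {a b b' : C} {l : List C} (h : IsExt b' b a) (hl : IsFilt l b') : IsFilt (a :: l) b

lemma IsFilt.isZero {c : C} (h : IsFilt [] c) : IsZero c := by cases h; assumption

lemma isFilt_cons_iff {a c : C} {l : List C} :
    IsFilt (a :: l) c ↔ ∃ b, IsExt b c a ∧ IsFilt l b :=
  ⟨fun h => by cases h with | cons h hl => exact ⟨_, h, hl⟩, fun ⟨_, h, hl⟩ => .cons h hl⟩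

lemma IsFilt.of_iso {l : List C} {c c' : C} (h : IsFilt l c) (e : c ≅ c') : IsFilt l c' := by
  cases h with
  | nil hc => exact .nil (hc.of_iso e.symm)
  | cons h hl => exact .cons (h.of_iso (Iso.refl _) e (Iso.refl _)) hl

lemma isFilt_singleton (c : C) : IsFilt [c] c :=
  .cons (isExt_zero_left (isZero_zero C) c) (.nil (isZero_zero C))

lemma IsFilt.iso_of_singleton {a c : C} (h : IsFilt [a] c) : Nonempty (c ≅ a) := by
  obtain ⟨b, hb, hl⟩ := isFilt_cons_iff.1 h
  exact hb.iso_of_isZero_left hl.isZero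

lemma IsFilt.prop {l : List C} {c : C} (h : IsFilt l c) (Q : C → Prop)
    (h0 : ∀ x, IsZero x → Q x) (hext : ∀ a b c, IsExt a b c → Q a → Q c → Q b)
    (hl : ∀ a ∈ l, Q a) : Q c := by
  induction h with
  | nil hc => exact h0 _ hc
  | cons h _ ih =>
    exact hext _ _ _ h (ih fun a ha => hl a (List.mem_cons_of_mem _ ha))
      (hl _ List.mem_cons_self)

lemma IsFilt.shift {l : List C} {c : C} (h : IsFilt l c) (n : ℤ) :
    IsFilt (l.map fun a => a⟦n⟧) (c⟦n⟧) := by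
  induction h with
  | nil hc => exact .nil (isZero_shift hc n)
  | cons h _ ih => exact .cons (h.shift n) ih

lemma IsFilt.K0_of {l : List C} {c : C} (h : IsFilt l c) : K0.of c = (l.map K0.of).sum := by
  induction h with
  | nil hc => simpa using K0.of_isZero hc
  | cons h _ ih => rw [h.K0_of, ih]; simp [add_comm]

lemma IsFilt.map_iso {ι : Type*} {l : List ι} {F G : ι → C} (e : ∀ i ∈ l, Nonempty (F i ≅ G i))
    {c : C} (h : IsFilt (l.map F) c) : IsFilt (l.map G) c := by
  induction l generalizing c with
  | nil => simpa using h
  | cons i l ih =>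
    obtain ⟨b, hb, hl⟩ := isFilt_cons_iff.1 h
    obtain ⟨ei⟩ := e i List.mem_cons_self
    exact .cons (hb.of_iso (Iso.refl _) (Iso.refl _) ei)
      (ih (fun j hj => e j (List.mem_cons_of_mem _ hj)) hl)

section Octahedral

variable [IsTriangulated C]

lemma IsFilt.append {l l' : List C} {a b c : C} (h : IsExt a b c) (hl : IsFilt l c)
    (hl' : IsFilt l' a) : IsFilt (l ++ l') b := by
  induction hl generalizing b with
  | nil hc =>
    obtain ⟨e⟩ := h.iso_of_isZero_right hc
    exact hl'.of_iso e
  | cons hx _ ih =>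
    obtain ⟨y, hy, hy'⟩ := h.assoc' hx
    exact .cons hy' (ih hy)

/-- Converse of `IsFilt.append`. Lists run from the last quotient to the first, so the front part of
the list filters the quotient and the rear part the subobject. -/
lemma IsFilt.split {l l' : List C} {b : C} (h : IsFilt (l ++ l') b) :
    ∃ a c, IsExt a b c ∧ IsFilt l c ∧ IsFilt l' a := by
  induction l generalizing b with
  | nil => exact ⟨b, 0, isExt_zero_right (isZero_zero C) b, .nil (isZero_zero C), h⟩
  | cons x l ih =>
    obtain ⟨b', hb, hl⟩ := isFilt_cons_iff.1 h
    obtain ⟨a, c, hac, hc, ha⟩ := ih hl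
    obtain ⟨y, hy, hy'⟩ := hac.assoc hb
    exact ⟨a, y, hy, .cons hy' hc, ha⟩

end Octahedral

end Extensions

/-! ### Slicings through truncations at upper sets of phases. -/

section Slicings

variable {C : Type u} [Category.{v} C] [HasZeroObject C] [HasShift C ℤ] [Preadditive C]
  [∀ n : ℤ, (shiftFunctor C n).Additive] [Pretriangulated C]

/-- A Harder-Narasimhan filtration in the form of a list of phases and factors, by increasing
phases. -/
structure IsHN (P : ℝ → ObjectProperty C) (l : List (ℝ × C)) (c : C) : Prop where
  filt : IsFilt (l.map Prod.snd) c
  mem : ∀ p ∈ l, P p.1 p.2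
  ne_zero : ∀ p ∈ l, ¬ IsZero p.2
  lt : l.Pairwise fun p q => p.1 < q.1

/-- The list of phases and factors of a filtration. -/
def HNFiltration.list {P : ℝ → ObjectProperty C} {c : C} (H : HNFiltration P c) :
    List (ℝ × C) :=
  (List.ofFn fun i => (H.phase i, H.factor i)).reverse

lemma HNFiltration.mem_list {P : ℝ → ObjectProperty C} {c : C} (H : HNFiltration P c)
    {p : ℝ × C} : p ∈ H.list ↔ ∃ i, p = (H.phase i, H.factor i) := by
  simp [HNFiltration.list, List.mem_ofFn, eq_comm]

lemma HNFiltration.isFilt_take {P : ℝ → ObjectProperty C} {c : C} (H : HNFiltration P c)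
    (k : ℕ) (hk : k ≤ H.n) :
    IsFilt (((List.ofFn H.factor).take k).reverse) (H.obj ⟨k, Nat.lt_succ_of_le hk⟩) := by
  induction k with
  | zero => exact .nil H.isZero_obj_zero
  | succ k ih =>
    have hk' : k < (List.ofFn H.factor).length := by simpa using hk
    rw [← List.take_append_getElem hk', List.reverse_append]
    simp only [List.reverse_cons, List.reverse_nil, List.nil_append, List.getElem_ofFn,
      List.singleton_append]
    exact .cons (H.exists_triangle ⟨k, hk⟩) (ih (Nat.le_of_succ_le hk))

lemma HNFiltration.isHN {P : ℝ → ObjectProperty C} {c : C} (H : HNFiltration P c) :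
    IsHN P H.list c where
  filt := by
    have h := H.isFilt_take H.n le_rfl
    rw [List.take_of_length_le (by simp)] at h
    obtain ⟨e⟩ := H.obj_last
    have h2 := h.of_iso e
    simpa [HNFiltration.list, List.map_reverse, List.map_ofFn, Function.comp_def] using h2
  mem p hp := by
    obtain ⟨i, rfl⟩ := H.mem_list.1 hp
    exact H.factor_mem i
  ne_zero p hp := by
    obtain ⟨i, rfl⟩ := H.mem_list.1 hp
    exact H.factor_ne_zero i
  lt := by
    rw [HNFiltration.list, List.pairwise_reverse, List.pairwise_ofFn]
    exact fun i j hij => H.phase_strictAnti hij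

lemma IsHN.exists_filtration {P : ℝ → ObjectProperty C} {l : List (ℝ × C)} {c : C}
    (h : IsHN P l c) : ∃ H : HNFiltration P c, ∀ i, ∃ p ∈ l, H.phase i = p.1 := by
  induction l generalizing c with
  | nil =>
    exact ⟨{ n := 0, obj := fun _ => c, factor := Fin.elim0, phase := Fin.elim0
             isZero_obj_zero := h.filt.isZero, obj_last := ⟨Iso.refl _⟩
             exists_triangle := fun i => i.elim0, factor_mem := fun i => i.elim0
             factor_ne_zero := fun i => i.elim0
             phase_strictAnti := fun i => i.elim0 }, fun i => i.elim0⟩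
  | cons a l ih =>
    obtain ⟨b, hb, hl⟩ := isFilt_cons_iff.1 h.filt
    obtain ⟨H, hH⟩ := ih ⟨hl, fun p hp => h.mem p (List.mem_cons_of_mem _ hp),
      fun p hp => h.ne_zero p (List.mem_cons_of_mem _ hp), (List.pairwise_cons.1 h.lt).2⟩
    obtain ⟨e⟩ := H.obj_last
    have hlt : ∀ i, a.1 < H.phase i := fun i => by
      obtain ⟨p, hp, hi⟩ := hH i
      rw [hi]
      exact (List.pairwise_cons.1 h.lt).1 p hp
    -- The head of the list is the last quotient, so its data go to the end of the `Fin`-indexed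
    -- families.
    refine ⟨{ n := H.n + 1, obj := Fin.snoc (α := fun _ => C) H.obj c
              factor := Fin.snoc (α := fun _ => C) H.factor a.2
              phase := Fin.snoc (α := fun _ => ℝ) H.phase a.1
              isZero_obj_zero := ?_, obj_last := ?_, exists_triangle := ?_, factor_mem := ?_
              factor_ne_zero := ?_, phase_strictAnti := ?_ }, ?_⟩
    · rw [← Fin.castSucc_zero, Fin.snoc_castSucc]
      exact H.isZero_obj_zero
    · rw [Fin.snoc_last]
      exact ⟨Iso.refl _⟩
    · intro i
      change IsExt _ _ _
      refine Fin.lastCases ?_ (fun j => ?_) i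
      · rw [Fin.succ_last, Fin.snoc_last, Fin.snoc_last, Fin.snoc_castSucc]
        exact hb.of_iso e.symm (Iso.refl _) (Iso.refl _)
      · rw [Fin.snoc_castSucc, Fin.snoc_castSucc, Fin.succ_castSucc, Fin.snoc_castSucc]
        exact H.exists_triangle j
    · intro i
      refine Fin.lastCases ?_ (fun j => ?_) i
      · simpa using h.mem a List.mem_cons_self
      · simpa using H.factor_mem j
    · intro i
      refine Fin.lastCases ?_ (fun j => ?_) i
      · simpa using h.ne_zero a List.mem_cons_self
      · simpa using H.factor_ne_zero j
    · intro i j hij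
      revert hij
      refine Fin.lastCases ?_ (fun j => ?_) j
      · refine Fin.lastCases (fun h => absurd h (lt_irrefl _)) (fun i _ => ?_) i
        simpa using hlt i
      · refine Fin.lastCases (fun h => absurd h (not_lt.2 (Fin.le_last _))) (fun i h => ?_) i
        simpa using H.phase_strictAnti (Fin.castSucc_lt_castSucc_iff.1 h)
    · intro i
      refine Fin.lastCases ?_ (fun j => ?_) i
      · exact ⟨a, List.mem_cons_self, by simp⟩
      · obtain ⟨p, hp, hj⟩ := hH j
        exact ⟨p, List.mem_cons_of_mem _ hp, by simpa using hj⟩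

namespace Slicing

variable (P : Slicing C)

/-- The objects without morphisms to the semistable objects with phase outside of `U`. -/
def up (U : Set ℝ) : ObjectProperty C :=
  fun c => ∀ (ψ : ℝ) (Y : C) (f : c ⟶ Y), ψ ∉ U → P.P ψ Y → f = 0

/-- The objects without morphisms from the semistable objects with phase in `U`. -/
def dn (U : Set ℝ) : ObjectProperty C :=
  fun c => ∀ (ψ : ℝ) (X : C) (f : X ⟶ c), ψ ∈ U → P.P ψ X → f = 0

variable {P}

lemma up_ext {U : Set ℝ} {a b c : C} (h : IsExt a b c) (ha : P.up U a) (hc : P.up U c) :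
    P.up U b :=
  fun ψ Y f hψ hY => h.hom_left_eq_zero (fun f => ha ψ Y f hψ hY) (fun f => hc ψ Y f hψ hY) f

lemma dn_ext {U : Set ℝ} {a b c : C} (h : IsExt a b c) (ha : P.dn U a) (hc : P.dn U c) :
    P.dn U b :=
  fun ψ Y f hψ hY => h.hom_right_eq_zero (fun f => ha ψ Y f hψ hY) (fun f => hc ψ Y f hψ hY) f

lemma up_zero {U : Set ℝ} {c : C} (h : IsZero c) : P.up U c := fun _ _ f _ _ => h.eq_of_src f 0

lemma dn_zero {U : Set ℝ} {c : C} (h : IsZero c) : P.dn U c := fun _ _ f _ _ => h.eq_of_tgt f 0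

lemma up_iso {U : Set ℝ} {c c' : C} (e : c ≅ c') (h : P.up U c) : P.up U c' :=
  fun ψ Y f hψ hY => by
    rw [← cancel_epi e.hom, comp_zero]
    exact h ψ Y _ hψ hY

lemma dn_iso {U : Set ℝ} {c c' : C} (e : c ≅ c') (h : P.dn U c) : P.dn U c' :=
  fun ψ Y f hψ hY => by
    rw [← cancel_mono e.inv, zero_comp]
    exact h ψ Y _ hψ hY

lemma up_mono {U V : Set ℝ} (hUV : U ⊆ V) {c : C} (h : P.up U c) : P.up V c :=
  fun ψ Y f hψ hY => h ψ Y f (fun h => hψ (hUV h)) hY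

lemma dn_anti {U V : Set ℝ} (hUV : U ⊆ V) {c : C} (h : P.dn V c) : P.dn U c :=
  fun ψ Y f hψ hY => h ψ Y f (hUV hψ) hY

lemma up_of_mem {U : Set ℝ} (hU : IsUpperSet U) {φ : ℝ} (hφ : φ ∈ U) {c : C} (h : P.P φ c) :
    P.up U c :=
  fun ψ Y f hψ hY => P.hom_eq_zero φ ψ c Y f
    (lt_of_not_ge fun hle => hψ (hU hle hφ)) h hY

lemma dn_of_notMem {U : Set ℝ} (hU : IsUpperSet U) {φ : ℝ} (hφ : φ ∉ U) {c : C} (h : P.P φ c) :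
    P.dn U c :=
  fun ψ Y f hψ hY => P.hom_eq_zero ψ φ Y c f
    (lt_of_not_ge fun hle => hφ (hU hle hψ)) hY h

lemma exists_isHN (P : Slicing C) (c : C) : ∃ l, IsHN P.P l c :=
  ⟨_, (P.hn c).isHN⟩

lemma prop_shift (φ : ℝ) (n : ℤ) (c : C) : P.P (φ + n) (c⟦n⟧) ↔ P.P φ c := by
  have hi : ∀ ψ, (P.P ψ).IsClosedUnderIsomorphisms := P.iso_closed
  induction n using Int.induction_on with
  | zero =>
    rw [Int.cast_zero, add_zero]
    exact (P.P φ).prop_iff_of_iso ((shiftFunctorZero C ℤ).app c)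
  | succ n ih =>
    refine Iff.trans ?_ ((P.shift_iff (φ + (n : ℤ)) (c⟦(n : ℤ)⟧)).trans ih)
    push_cast
    rw [add_assoc]
    exact (P.P _).prop_iff_of_iso ((shiftFunctorAdd C (n : ℤ) 1).app c)
  | pred n ih =>
    refine Iff.trans ?_ ih
    rw [← P.shift_iff]
    have e := (shiftFunctorAdd' C (-(n : ℤ) - 1) 1 (-n) (by omega)).symm.app c
    rw [show φ + ((-(n : ℤ) - 1 : ℤ) : ℝ) + 1 = φ + ((-(n : ℤ) : ℤ) : ℝ) by push_cast; ring]
    exact (P.P _).prop_iff_of_iso e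

lemma _root_.LaxStab.IsHN.shift {l : List (ℝ × C)} {c : C} (h : IsHN P.P l c) (n : ℤ) :
    IsHN P.P (l.map fun p => (p.1 + n, p.2⟦n⟧)) (c⟦n⟧) where
  filt := by simpa [Function.comp_def] using h.filt.shift n
  mem p hp := by
    obtain ⟨q, hq, rfl⟩ := List.mem_map.1 hp
    exact (prop_shift _ _ _).2 (h.mem q hq)
  ne_zero p hp := by
    obtain ⟨q, hq, rfl⟩ := List.mem_map.1 hp
    exact fun h0 => h.ne_zero q hq (isZero_of_shift h0)
  lt := by
    rw [List.pairwise_map]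
    exact h.lt.imp fun h => by simpa using h

lemma _root_.LaxStab.IsHN.tail {p : ℝ × C} {l : List (ℝ × C)} {c : C}
    (h : IsHN P.P (p :: l) c) : ∃ b, IsExt b c p.2 ∧ IsHN P.P l b := by
  obtain ⟨b, hb, hl⟩ := isFilt_cons_iff.1 h.filt
  exact ⟨b, hb, hl, fun p hp => h.mem p (List.mem_cons_of_mem _ hp),
    fun p hp => h.ne_zero p (List.mem_cons_of_mem _ hp), (List.pairwise_cons.1 h.lt).2⟩

lemma _root_.LaxStab.IsHN.up {l : List (ℝ × C)} {c : C} (h : IsHN P.P l c) {U : Set ℝ}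
    (hU : IsUpperSet U) (hl : ∀ p ∈ l, p.1 ∈ U) : P.up U c :=
  h.filt.prop _ (fun _ => up_zero) (fun _ _ _ => up_ext) fun a ha => by
    obtain ⟨p, hp, rfl⟩ := List.mem_map.1 ha
    exact up_of_mem hU (hl p hp) (h.mem p hp)

lemma _root_.LaxStab.IsHN.dn {l : List (ℝ × C)} {c : C} (h : IsHN P.P l c) {U : Set ℝ}
    (hU : IsUpperSet U) (hl : ∀ p ∈ l, p.1 ∉ U) : P.dn U c :=
  h.filt.prop _ (fun _ => dn_zero) (fun _ _ _ => dn_ext) fun a ha => by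
    obtain ⟨p, hp, rfl⟩ := List.mem_map.1 ha
    exact dn_of_notMem hU (hl p hp) (h.mem p hp)

lemma _root_.LaxStab.IsHN.up_iff {l : List (ℝ × C)} {c : C} (h : IsHN P.P l c) {U : Set ℝ}
    (hU : IsUpperSet U) : P.up U c ↔ ∀ p ∈ l, p.1 ∈ U := by
  refine ⟨fun hc => ?_, h.up hU⟩
  cases l with
  | nil => simp
  | cons a l =>
    obtain ⟨b, hb, hl⟩ := h.tail
    have ha : a.1 ∈ U := by
      by_contra ha
      -- The head is the last quotient and has the smallest phase. If that phase were outside `U`,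
      -- the head would receive only zero morphisms from `c` and from the shift of the remaining
      -- part, and so would vanish.
      refine h.ne_zero a List.mem_cons_self
        (hb.isZero_right (fun f => hc _ _ f ha (h.mem a List.mem_cons_self)) fun f => ?_)
      refine (hl.shift 1).up (U := Set.Ioi a.1) (isUpperSet_Ioi _) (fun p hp => ?_) a.1 _ f
        (lt_irrefl a.1) (h.mem a List.mem_cons_self)
      obtain ⟨q, hq, rfl⟩ := List.mem_map.1 hp
      have := (List.pairwise_cons.1 h.lt).1 q hq
      simp only [Int.cast_one, Set.mem_Ioi]
      linarith
    intro p hp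
    rcases List.mem_cons.1 hp with rfl | hp
    · exact ha
    · exact hU ((List.pairwise_cons.1 h.lt).1 p hp).le ha

lemma hom_up_dn {U : Set ℝ} (hU : IsUpperSet U) {a b : C} (ha : P.up U a) (hb : P.dn U b)
    (f : a ⟶ b) : f = 0 := by
  obtain ⟨l, hl⟩ := P.exists_isHN a
  have hl' := (hl.up_iff hU).1 ha
  refine hl.filt.prop (fun x => ∀ f : x ⟶ b, f = 0) (fun x hx f => hx.eq_of_src f 0)
    (fun _ _ _ h h1 h2 => h.hom_left_eq_zero h1 h2) (fun x hx f => ?_) f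
  obtain ⟨p, hp, rfl⟩ := List.mem_map.1 hx
  exact hb p.1 p.2 f (hl' p hp) (hl.mem p hp)

lemma up_shift {U : Set ℝ} (hU : IsUpperSet U) {c : C} (n : ℤ) :
    P.up U (c⟦n⟧) ↔ P.up {x | x + n ∈ U} c := by
  obtain ⟨l, hl⟩ := P.exists_isHN c
  have hU' : IsUpperSet {x : ℝ | x + n ∈ U} := fun x y hxy hx => hU (by simpa using hxy) hx
  rw [(hl.shift n).up_iff hU, hl.up_iff hU']
  simp only [List.mem_map, forall_exists_index, and_imp, forall_apply_eq_imp_iff₂,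
    Set.mem_ofPred_eq]

lemma isZero_of_up_dn {U : Set ℝ} (hU : IsUpperSet U) {c : C} (h : P.up U c) (h' : P.dn U c) :
    IsZero c := by
  rw [IsZero.iff_id_eq_zero]
  exact hom_up_dn hU h h' _

section Octahedral

variable [IsTriangulated C]

/-- Truncation of a Harder-Narasimhan filtration. -/
lemma _root_.LaxStab.IsHN.exists_trunc {l : List (ℝ × C)} {c : C} (h : IsHN P.P l c)
    {U : Set ℝ} (hU : IsUpperSet U) [DecidablePred (· ∈ U)] :
    ∃ a b, IsExt a c b ∧ IsHN P.P (l.filter (·.1 ∈ U)) a ∧ IsHN P.P (l.filter (·.1 ∉ U)) b := by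
  suffices ∃ a b, IsExt a c b ∧ IsFilt ((l.filter (·.1 ∈ U)).map Prod.snd) a ∧
      IsFilt ((l.filter (·.1 ∉ U)).map Prod.snd) b by
    obtain ⟨a, b, hab, ha, hb⟩ := this
    exact ⟨a, b, hab,
      ⟨ha, fun p hp => h.mem p (List.mem_of_mem_filter hp),
        fun p hp => h.ne_zero p (List.mem_of_mem_filter hp), h.lt.filter _⟩,
      ⟨hb, fun p hp => h.mem p (List.mem_of_mem_filter hp),
        fun p hp => h.ne_zero p (List.mem_of_mem_filter hp), h.lt.filter _⟩⟩
  induction l generalizing c with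
  | nil => exact ⟨c, 0, isExt_zero_right (isZero_zero C) c, h.filt, .nil (isZero_zero C)⟩
  | cons p l ih =>
    by_cases hp : p.1 ∈ U
    · have hall : ∀ q ∈ p :: l, q.1 ∈ U := fun q hq => by
        rcases List.mem_cons.1 hq with rfl | hq
        · exact hp
        · exact hU ((List.pairwise_cons.1 h.lt).1 q hq).le hp
      refine ⟨c, 0, isExt_zero_right (isZero_zero C) c, ?_, ?_⟩
      · rw [List.filter_eq_self.2 (by simpa using hall)]
        exact h.filt
      · rw [List.filter_eq_nil_iff.2 (by simpa using hall)]
        exact .nil (isZero_zero C)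
    · obtain ⟨b', hb, hl⟩ := h.tail
      obtain ⟨a, b, hab, ha, hb'⟩ := ih hl
      obtain ⟨x, hx, hx'⟩ := hab.assoc hb
      refine ⟨a, x, hx, ?_, ?_⟩
      · rwa [List.filter_cons_of_neg (by simpa using hp)]
      · rw [List.filter_cons_of_pos (by simpa using hp)]
        exact .cons hx' hb'

lemma exists_trunc (P : Slicing C) {U : Set ℝ} (hU : IsUpperSet U) (c : C) :
    ∃ a b, IsExt a c b ∧ P.up U a ∧ P.dn U b := by
  classical
  obtain ⟨l, hl⟩ := P.exists_isHN c
  obtain ⟨a, b, hab, ha, hb⟩ := hl.exists_trunc hU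
  exact ⟨a, b, hab, ha.up hU (fun p hp => by simpa using List.of_mem_filter hp),
    hb.dn hU (fun p hp => by simpa using List.of_mem_filter hp)⟩

lemma _root_.LaxStab.IsHN.eq_nil {l : List (ℝ × C)} {c : C} (h : IsHN P.P l c)
    (hc : IsZero c) : l = [] :=
  List.eq_nil_iff_forall_not_mem.2 fun p hp =>
    ((h.up_iff (U := ∅) isUpperSet_empty).1 (up_zero hc) p hp).elim

/-- An upper set of phases is stable under adding `1`, so `a⟦1⟧` stays in the class of `a`. With the
vanishing of `a ⟶ b`, this is what makes truncations functorial. -/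
lemma up_shift_neg_one_of_dn {U : Set ℝ} (hU : IsUpperSet U) {b : C} (hb : P.dn U b)
    {a : C} (ha : P.up U a) (f : a ⟶ b⟦(-1 : ℤ)⟧) : f = 0 := by
  have ha' : P.up U (a⟦(1 : ℤ)⟧) :=
    (up_shift hU 1).2 (up_mono (V := {x | x + ((1 : ℤ) : ℝ) ∈ U}) (fun x hx =>
      (hU (by simp) hx : x + ((1 : ℤ) : ℝ) ∈ U)) ha)
  have h0 := hom_up_dn hU ha' hb (f⟦(1 : ℤ)⟧' ≫ (shiftNegShift b 1).hom)
  have h1 : f⟦(1 : ℤ)⟧' = 0 := by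
    rw [← cancel_mono (shiftNegShift b 1).hom, h0, zero_comp]
  exact (shiftFunctor C (1 : ℤ)).map_injective (by rw [h1, Functor.map_zero])

lemma _root_.LaxStab.IsHN.dn_iff {l : List (ℝ × C)} {c : C} (h : IsHN P.P l c) {U : Set ℝ}
    (hU : IsUpperSet U) : P.dn U c ↔ ∀ p ∈ l, p.1 ∉ U := by
  classical
  refine ⟨fun hc => ?_, h.dn hU⟩
  obtain ⟨a, b, hab, ha, hb⟩ := h.exists_trunc hU
  have ha' := ha.up hU (fun p hp => by simpa using List.of_mem_filter hp)
  have hb' := hb.dn hU (fun p hp => by simpa using List.of_mem_filter hp)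
  -- The truncation of `c` above `U` maps trivially to `c`, hence is zero, and then no factor has
  -- its phase in `U`.
  have h0 : IsZero a := hab.isZero_left (hom_up_dn hU ha' hc)
    (up_shift_neg_one_of_dn hU hb' ha')
  have h1 := ha.eq_nil h0
  rw [List.filter_eq_nil_iff] at h1
  simpa using h1

lemma dn_shift {U : Set ℝ} (hU : IsUpperSet U) {c : C} (n : ℤ) :
    P.dn U (c⟦n⟧) ↔ P.dn {x | x + n ∈ U} c := by
  obtain ⟨l, hl⟩ := P.exists_isHN c
  have hU' : IsUpperSet {x : ℝ | x + n ∈ U} := fun x y hxy hx => hU (by simpa using hxy) hx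
  rw [(hl.shift n).dn_iff hU, hl.dn_iff hU']
  simp only [List.mem_map, forall_exists_index, and_imp, forall_apply_eq_imp_iff₂,
    Set.mem_ofPred_eq]

lemma interval_iff_of_isHN {U V : Set ℝ} (hU : IsUpperSet U) (hV : IsUpperSet V) {c : C}
    {l : List (ℝ × C)} (hl : IsHN P.P l c) :
    P.interval (U \ V) c ↔ ∀ p ∈ l, p.1 ∈ U \ V := by
  constructor
  · rintro ⟨H, hH⟩
    have h1 : P.up U c := H.isHN.up hU fun p hp => by
      obtain ⟨i, rfl⟩ := H.mem_list.1 hp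
      exact (hH i).1
    have h2 : P.dn V c := H.isHN.dn hV fun p hp => by
      obtain ⟨i, rfl⟩ := H.mem_list.1 hp
      exact (hH i).2
    exact fun p hp => ⟨(hl.up_iff hU).1 h1 p hp, (hl.dn_iff hV).1 h2 p hp⟩
  · intro h
    obtain ⟨H, hH⟩ := hl.exists_filtration
    refine ⟨H, fun i => ?_⟩
    obtain ⟨p, hp, hi⟩ := hH i
    rw [hi]
    exact h p hp

lemma interval_iff {U V : Set ℝ} (hU : IsUpperSet U) (hV : IsUpperSet V) {c : C} :
    P.interval (U \ V) c ↔ P.up U c ∧ P.dn V c := by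
  obtain ⟨l, hl⟩ := P.exists_isHN c
  rw [interval_iff_of_isHN hU hV hl, hl.up_iff hU, hl.dn_iff hV]
  simp only [Set.mem_sdiff]
  exact ⟨fun h => ⟨fun p hp => (h p hp).1, fun p hp => (h p hp).2⟩,
    fun h p hp => ⟨h.1 p hp, h.2 p hp⟩⟩

lemma interval_Ioc_iff {a b : ℝ} {c : C} :
    P.interval (Set.Ioc a b) c ↔ P.up (Set.Ioi a) c ∧ P.dn (Set.Ioi b) c := by
  rw [← interval_iff (isUpperSet_Ioi a) (isUpperSet_Ioi b)]
  congr!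
  ext x
  simp

lemma interval_Ioo_iff {a b : ℝ} {c : C} :
    P.interval (Set.Ioo a b) c ↔ P.up (Set.Ioi a) c ∧ P.dn (Set.Ici b) c := by
  rw [← interval_iff (isUpperSet_Ioi a) (isUpperSet_Ici b)]
  congr!
  ext x
  simp

/-- Slices are determined by the classes `up` and `dn`, so slicings can be compared and relabelled
through these alone. For the converse, strictly increasing phases that all equal `φ` leave room for
at most one factor. -/
lemma prop_iff {φ : ℝ} {c : C} : P.P φ c ↔ P.up (Set.Ici φ) c ∧ P.dn (Set.Ioi φ) c := by
  constructor
  · exact fun h => ⟨up_of_mem (isUpperSet_Ici φ) (by simp) h,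
      dn_of_notMem (isUpperSet_Ioi φ) (by simp) h⟩
  · rintro ⟨h1, h2⟩
    obtain ⟨l, hl⟩ := P.exists_isHN c
    rw [hl.up_iff (isUpperSet_Ici φ)] at h1
    rw [hl.dn_iff (isUpperSet_Ioi φ)] at h2
    have h3 : ∀ p ∈ l, p.1 = φ := fun p hp =>
      le_antisymm (by simpa using h2 p hp) (by simpa using h1 p hp)
    have hi : ∀ ψ, (P.P ψ).IsClosedUnderIsomorphisms := P.iso_closed
    match l, hl, h3 with
    | [], hl, _ => exact P.zero_mem φ c hl.filt.isZero
    | [p], hl, h3 =>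
      obtain ⟨e⟩ := hl.filt.iso_of_singleton
      rw [(P.P φ).prop_iff_of_iso e]
      simpa [h3 p (by simp)] using hl.mem p (by simp)
    | p :: q :: l, hl, h3 =>
      have := (List.pairwise_cons.1 hl.lt).1 q (by simp)
      rw [h3 p (by simp), h3 q (by simp)] at this
      exact absurd this (lt_irrefl _)

lemma hn_n_pos (P : Slicing C) {c : C} (h : ¬ IsZero c) : 0 < (P.hn c).n := by
  by_contra h0
  have h1 := (P.hn c).isHN
  have h2 : (P.hn c).list = [] := by
    rw [List.eq_nil_iff_length_eq_zero]
    simp only [HNFiltration.list, List.length_reverse, List.length_ofFn]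
    omega
  rw [h2] at h1
  exact h h1.filt.isZero

lemma up_iff_phiMinus {U : Set ℝ} (hU : IsUpperSet U) {c : C} (h : ¬ IsZero c) :
    P.up U c ↔ P.phiMinus c ∈ U := by
  have h0 := P.hn_n_pos h
  rw [(P.hn c).isHN.up_iff hU, phiMinus, dif_pos h0]
  refine ⟨fun H => H _ ((P.hn c).mem_list.2 ⟨_, rfl⟩), fun H p hp => ?_⟩
  obtain ⟨i, rfl⟩ := (P.hn c).mem_list.1 hp
  exact hU ((P.hn c).phase_strictAnti.antitone (Fin.le_def.2 (Nat.le_sub_one_of_lt i.2))) H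

lemma dn_iff_phiPlus {U : Set ℝ} (hU : IsUpperSet U) {c : C} (h : ¬ IsZero c) :
    P.dn U c ↔ P.phiPlus c ∉ U := by
  have h0 := P.hn_n_pos h
  rw [(P.hn c).isHN.dn_iff hU, phiPlus, dif_pos h0]
  refine ⟨fun H => H _ ((P.hn c).mem_list.2 ⟨_, rfl⟩), fun H p hp => ?_⟩
  obtain ⟨i, rfl⟩ := (P.hn c).mem_list.1 hp
  exact fun hi => H (hU ((P.hn c).phase_strictAnti.antitone (Fin.le_def.2 (Nat.zero_le _))) hi)

/-- Each inclusion lifts through the other. A difference of two lifts factors through the shift by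
`-1` of a `dn` object, which receives no morphism from an `up` object, so the lifts are mutually
inverse. -/
lemma trunc_unique {U : Set ℝ} (hU : IsUpperSet U) {a b a' b' c : C} (h : IsExt a c b)
    (h' : IsExt a' c b') (ha : P.up U a) (hb : P.dn U b) (ha' : P.up U a') (hb' : P.dn U b') :
    Nonempty (a ≅ a') := by
  obtain ⟨f, g, w, H⟩ := h
  obtain ⟨f', g', w', H'⟩ := h'
  obtain ⟨k, hk⟩ := exists_lift_of_distTriang H' f (hom_up_dn hU ha hb' _)
  obtain ⟨k', hk'⟩ := exists_lift_of_distTriang H f' (hom_up_dn hU ha' hb _)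
  have cancel : ∀ {x y z d : C} (p : y ⟶ d) (q : d ⟶ z) (r : z ⟶ y⟦(1 : ℤ)⟧)
      (_ : Triangle.mk p q r ∈ distTriang C) (_ : P.up U x) (_ : P.dn U z) (s : x ⟶ y),
      s ≫ p = 0 → s = 0 := by
    intro x y z d p q r hT hx hz s hs
    obtain ⟨m, hm⟩ := Triangle.coyoneda_exact₂ _ (inv_rot_of_distTriang _ hT) s hs
    rw [hm, show m = 0 from up_shift_neg_one_of_dn hU hz hx m]
    exact zero_comp
  refine ⟨⟨k, k', ?_, ?_⟩⟩
  · rw [← sub_eq_zero]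
    refine cancel _ _ _ H ha hb _ ?_
    rw [Preadditive.sub_comp, Category.assoc, ← hk', ← hk, Category.id_comp, sub_self]
  · rw [← sub_eq_zero]
    refine cancel _ _ _ H' ha' hb' _ ?_
    rw [Preadditive.sub_comp, Category.assoc, ← hk, ← hk', Category.id_comp, sub_self]

end Octahedral

end Slicing

end Slicings

/-! ### The hearts `P(θ, θ + 1]`: abelian structure, simple objects, composition series. -/

section Hearts

variable {C : Type u} [Category.{v} C] [HasZeroObject C] [HasShift C ℤ] [Preadditive C]
  [∀ n : ℤ, (shiftFunctor C n).Additive] [Pretriangulated C]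

namespace Slicing

variable {P : Slicing C}

lemma up_Ioi_shift {a : ℝ} {c : C} (n : ℤ) :
    P.up (Set.Ioi a) (c⟦n⟧) ↔ P.up (Set.Ioi (a - n)) c := by
  rw [up_shift (isUpperSet_Ioi a)]
  congr!
  ext x
  exact (sub_lt_iff_lt_add (α := ℝ)).symm

/-- `H` is the full subcategory `P(θ, θ + 1]`. -/
def IsHeart (P : Slicing C) (θ : ℝ) (H : ObjectProperty C) : Prop :=
  ∀ c, H c ↔ P.up (Set.Ioi θ) c ∧ P.dn (Set.Ioi (θ + 1)) c

variable [IsTriangulated C]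

lemma dn_Ioi_shift {a : ℝ} {c : C} (n : ℤ) :
    P.dn (Set.Ioi a) (c⟦n⟧) ↔ P.dn (Set.Ioi (a - n)) c := by
  rw [dn_shift (isUpperSet_Ioi a)]
  congr!
  ext x
  exact (sub_lt_iff_lt_add (α := ℝ)).symm

lemma isHeart_interval (P : Slicing C) (θ : ℝ) :
    P.IsHeart θ (P.interval (Set.Ioc θ (θ + 1))) :=
  fun _ => interval_Ioc_iff

variable {θ : ℝ} {H : ObjectProperty C}

namespace IsHeart

lemma iso_closed (hH : P.IsHeart θ H) : H.IsClosedUnderIsomorphisms where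
  of_iso e h := (hH _).2 ⟨up_iso e ((hH _).1 h).1, dn_iso e ((hH _).1 h).2⟩

lemma zero (hH : P.IsHeart θ H) {z : C} (hz : IsZero z) : H z :=
  (hH z).2 ⟨up_zero hz, dn_zero hz⟩

lemma ext (hH : P.IsHeart θ H) {a b c : C} (h : IsExt a b c) (ha : H a) (hc : H c) : H b :=
  (hH b).2 ⟨up_ext h ((hH a).1 ha).1 ((hH c).1 hc).1, dn_ext h ((hH a).1 ha).2 ((hH c).1 hc).2⟩

lemma hom_shift_eq_zero (hH : P.IsHeart θ H) {a b : C} (ha : H a) (hb : H b) {n m : ℤ}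
    (hn : m < n) (f : a⟦n⟧ ⟶ b⟦m⟧) : f = 0 := by
  refine hom_up_dn (P := P) (isUpperSet_Ioi (θ + n)) (up_Ioi_shift n |>.2 ?_) (dn_Ioi_shift m |>.2 ?_) f
  · simpa using ((hH a).1 ha).1
  · refine dn_anti (Set.Ioi_subset_Ioi ?_) ((hH b).1 hb).2
    have : (m : ℝ) + 1 ≤ n := by exact_mod_cast hn
    linarith

lemma hom_shift_neg_eq_zero (hH : P.IsHeart θ H) {a b : C} (ha : H a) (hb : H b) {n : ℤ}
    (hn : n < 0) (f : a ⟶ b⟦n⟧) : f = 0 := by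
  have := hH.hom_shift_eq_zero ha hb hn ((shiftFunctorZero C ℤ).hom.app a ≫ f)
  rwa [← cancel_epi ((shiftFunctorZero C ℤ).hom.app a), comp_zero]

lemma hom_shift_pos_eq_zero (hH : P.IsHeart θ H) {a b : C} (ha : H a) (hb : H b) {n : ℤ}
    (hn : 0 < n) (f : a⟦n⟧ ⟶ b) : f = 0 := by
  have := hH.hom_shift_eq_zero ha hb hn (f ≫ (shiftFunctorZero C ℤ).inv.app b)
  rwa [← cancel_mono ((shiftFunctorZero C ℤ).inv.app b), zero_comp]

/-- The cohomology objects of an object with two adjacent nonzero cohomologies. -/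
lemma exists_ext (hH : P.IsHeart θ H) {c : C} (h1 : P.up (Set.Ioi θ) c)
    (h2 : P.dn (Set.Ioi (θ + 2)) c) :
    ∃ K Q : C, H K ∧ H Q ∧ IsExt (K⟦(1 : ℤ)⟧) c Q := by
  obtain ⟨a, b, hab, ha, hb⟩ := P.exists_trunc (isUpperSet_Ioi (θ + 1)) c
  refine ⟨a⟦(-1 : ℤ)⟧, b, (hH _).2 ⟨?_, ?_⟩, (hH _).2 ⟨?_, hb⟩,
    hab.of_iso (shiftNegShift a 1).symm (Iso.refl _) (Iso.refl _)⟩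
  · rw [up_Ioi_shift]
    simpa using ha
  · rw [dn_Ioi_shift]
    refine dn_ext hab.invRotate (dn_Ioi_shift _ |>.2 ?_) ?_
    · exact dn_anti (Set.Ioi_subset_Ioi (by push_cast; linarith)) hb
    · convert h2 using 2
      push_cast; ring
  · refine up_ext hab.rotate h1 (up_Ioi_shift _ |>.2 ?_)
    exact up_mono (Set.Ioi_subset_Ioi (by push_cast; linarith)) ha

/-- The cone of a morphism between objects of the heart lies in `P(θ, θ + 2]`, so truncation at `θ +
1` presents it as an extension of a cokernel by a shifted kernel. This is the criterion for the
heart to be abelian. -/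
lemma admissible (hH : P.IsHeart θ H) :
    Triangulated.AbelianSubcategory.admissibleMorphism H.ι = ⊤ := by
  refine top_unique fun X Y f _ => ?_
  intro Z g w hT
  have hX := (hH _).1 X.property
  have hY := (hH _).1 Y.property
  obtain ⟨K, Q, hK, hQ, a, b, c, hT'⟩ := hH.exists_ext (c := Z)
    (up_ext (IsExt.rotate ⟨_, _, _, hT⟩) hY.1 (up_Ioi_shift _ |>.2
      (up_mono (Set.Ioi_subset_Ioi (by push_cast; linarith)) hX.1)))
    (dn_ext (IsExt.rotate ⟨_, _, _, hT⟩)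
      (dn_anti (Set.Ioi_subset_Ioi (by linarith)) hY.2) (dn_Ioi_shift _ |>.2
      (dn_anti (Set.Ioi_subset_Ioi (by push_cast; linarith)) hX.2)))
  exact ⟨⟨K, hK⟩, ⟨Q, hQ⟩, a, b, c, hT'⟩

lemma hom_neg (hH : P.IsHeart θ H) ⦃X Y : H.FullSubcategory⦄ ⦃n : ℤ⦄
    (f : H.ι.obj X ⟶ (H.ι.obj Y)⟦n⟧) (hn : n < 0) : f = 0 :=
  hH.hom_shift_neg_eq_zero X.property Y.property hn f

lemma hasKernels (hH : P.IsHeart θ H) : HasKernels H.FullSubcategory where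
  has_limit f := Triangulated.AbelianSubcategory.hasKernel_of_admissibleMorphism hH.hom_neg f
    (by simp [hH.admissible])

lemma containsZero (hH : P.IsHeart θ H) : H.ContainsZero where
  exists_zero := ⟨0, isZero_zero C, hH.zero (isZero_zero C)⟩

lemma hasFiniteProducts (hH : P.IsHeart θ H) : HasFiniteProducts H.FullSubcategory := by
  have := hH.containsZero
  have := hH.iso_closed
  have : H.IsClosedUnderBinaryProducts := .mk (by
    rintro X ⟨p⟩
    have e : X ≅ p.diag.obj ⟨.left⟩ ⊞ p.diag.obj ⟨.right⟩ :=
      p.isLimit.conePointUniqueUpToIso (limit.isLimit p.diag) ≪≫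
        HasLimit.isoOfNatIso (diagramIsoPair p.diag) ≪≫ (biprod.isoProd _ _).symm
    exact H.prop_of_iso e.symm
      (hH.ext (isExt_biprod _ _) (p.prop_diag_obj _) (p.prop_diag_obj _)))
  have := ObjectProperty.IsClosedUnderFiniteProducts.mk' (P := H)
  infer_instance

@[reducible]
noncomputable def abelian (hH : P.IsHeart θ H) : Abelian H.FullSubcategory :=
  have := hH.hasFiniteProducts
  Triangulated.AbelianSubcategory.abelian H.ι hH.hom_neg hH.admissible

lemma isZero_mk (h : H X) : IsZero (⟨X, h⟩ : H.FullSubcategory) ↔ IsZero X := by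
  rw [IsZero.iff_id_eq_zero, IsZero.iff_id_eq_zero]
  exact ⟨fun h0 => congrArg (fun f => f.hom) h0, fun h0 => H.hom_ext h0⟩

/-- The cone of a morphism which is a monomorphism in the heart lies in the heart. -/
lemma cone_of_mono (hH : P.IsHeart θ H) {a b c : C} {f : a ⟶ b} {g : b ⟶ c}
    {w : c ⟶ a⟦(1 : ℤ)⟧} (hT : Triangle.mk f g w ∈ distTriang C) (ha : H a) (hb : H b)
    (hf : ∀ (x : C) (_ : H x) (k : x ⟶ a), k ≫ f = 0 → k = 0) : H c := by
  have hX := (hH _).1 ha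
  have hY := (hH _).1 hb
  obtain ⟨K, Q, hK, hQ, hKQ⟩ := hH.exists_ext (c := c)
    (up_ext (IsExt.rotate ⟨_, _, _, hT⟩) hY.1 (up_Ioi_shift _ |>.2
      (up_mono (Set.Ioi_subset_Ioi (by push_cast; linarith)) hX.1)))
    (dn_ext (IsExt.rotate ⟨_, _, _, hT⟩)
      (dn_anti (Set.Ioi_subset_Ioi (by linarith)) hY.2) (dn_Ioi_shift _ |>.2
      (dn_anti (Set.Ioi_subset_Ioi (by push_cast; linarith)) hX.2)))
  -- Composing with the connecting morphism gives the shift of some `K ⟶ a` killed by `f`, hence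
  -- zero. So `u` lifts to `b`, where degrees forbid a nonzero morphism. The shifted kernel part of
  -- the cone is therefore zero.
  have hK1 : ∀ u : K⟦(1 : ℤ)⟧ ⟶ c, u = 0 := by
    intro u
    have h1 : (u ≫ w) ≫ f⟦(1 : ℤ)⟧' = 0 := by
      rw [Category.assoc]
      exact (congrArg (u ≫ ·) (comp_distTriang_mor_zero₃₁ _ hT)).trans comp_zero
    obtain ⟨k, hk⟩ := (shiftFunctor C (1 : ℤ)).map_surjective (u ≫ w)
    have h2 : k = 0 := hf K hK k ((shiftFunctor C (1 : ℤ)).map_injective (by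
      rw [Functor.map_comp, hk, h1, Functor.map_zero]))
    obtain ⟨m, hm⟩ := exists_lift_of_distTriang (rot_of_distTriang _ hT) u (by
      change u ≫ w = 0
      rw [← hk, h2, Functor.map_zero])
    have h3 : m = 0 := hH.hom_shift_pos_eq_zero hK hb one_pos m
    rw [hm, h3]
    exact zero_comp
  have hK2 : IsZero (K⟦(1 : ℤ)⟧) := hKQ.isZero_left hK1 fun f =>
    hH.hom_shift_eq_zero hK hQ (by norm_num) f
  obtain ⟨e⟩ := hKQ.iso_of_isZero_left hK2
  have := hH.iso_closed
  exact H.prop_of_iso e.symm hQ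

/-- A morphism killed by `f` factors through `c⟦-1⟧`, which receives nothing from the heart. -/
lemma mono_of_distTriang (hH : P.IsHeart θ H) {a b c : C} {f : a ⟶ b} {g : b ⟶ c}
    {w : c ⟶ a⟦(1 : ℤ)⟧} (hT : Triangle.mk f g w ∈ distTriang C) (hc : H c)
    (x : C) (hx : H x) (k : x ⟶ a) (hk : k ≫ f = 0) : k = 0 := by
  obtain ⟨m, hm⟩ := exists_lift_of_distTriang (inv_rot_of_distTriang _ hT) k hk
  rw [hm, show m = 0 from hH.hom_shift_neg_eq_zero hx hc (by norm_num) m]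
  exact zero_comp

lemma mono_homMk (a b : H.FullSubcategory) (f : a.obj ⟶ b.obj)
    (hf : ∀ (x : C) (_ : H x) (k : x ⟶ a.obj), k ≫ f = 0 → k = 0) :
    Mono (ObjectProperty.homMk f : a ⟶ b) := by
  rw [Preadditive.mono_iff_cancel_zero]
  intro x k hk
  exact H.hom_ext (hf x.obj x.property k.hom (congrArg (fun f => f.hom) hk))

end IsHeart

/-- `s` is a simple object of the full subcategory of the objects in `H`. -/
def IsSimpleIn (H : ObjectProperty C) (s : C) : Prop :=
  ∃ h : H s, Simple (⟨s, h⟩ : H.FullSubcategory)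

namespace IsHeart

lemma schur (hH : P.IsHeart θ H) {s t : C} (hs : IsSimpleIn H s) (ht : IsSimpleIn H t)
    (f : s ⟶ t) : f = 0 ∨ IsIso f := by
  obtain ⟨hs, hs'⟩ := hs
  obtain ⟨ht, ht'⟩ := ht
  have := hH.hasKernels
  let g : (⟨s, hs⟩ : H.FullSubcategory) ⟶ ⟨t, ht⟩ := ObjectProperty.homMk f
  by_cases h : g = 0
  · exact Or.inl (congrArg (fun f => f.hom) h)
  · exact Or.inr ((H.isIso_hom_iff g).2 (isIso_of_hom_simple h))

lemma _root_.LaxStab.Slicing.IsSimpleIn.not_isZero {s : C} (hs : IsSimpleIn H s) :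
    ¬ IsZero s := by
  obtain ⟨hs, hs'⟩ := hs
  exact fun h => Simple.not_isZero _ ((isZero_mk hs).2 h)

lemma exists_simple_sub (hH : P.IsHeart θ H) (hart : ∀ X : H.FullSubcategory, IsArtinianObject X)
    {X : C} (hX : H X) (h0 : ¬ IsZero X) :
    ∃ t Y : C, IsSimpleIn H t ∧ H Y ∧ IsExt t X Y := by
  have := hH.hasFiniteProducts
  have := hart ⟨X, hX⟩
  have : HasZeroObject H.FullSubcategory := ⟨⟨0, hH.zero (isZero_zero C)⟩,
    (isZero_mk _).2 (isZero_zero C)⟩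
  have h0' : ¬ IsZero (⟨X, hX⟩ : H.FullSubcategory) := fun h => h0 ((isZero_mk hX).1 h)
  obtain ⟨S, hS⟩ := exists_simple_subobject h0'
  obtain ⟨Y, g, w, hT⟩ := distinguished_cocone_triangle S.arrow.hom
  refine ⟨_, Y, ⟨(S : H.FullSubcategory).property, hS⟩,
    hH.cone_of_mono hT (S : H.FullSubcategory).property hX fun x hx k hk => ?_, ⟨_, _, _, hT⟩⟩
  have h1 : (ObjectProperty.homMk k : (⟨x, hx⟩ : H.FullSubcategory) ⟶ _) = 0 :=
    zero_of_comp_mono S.arrow (H.hom_ext hk)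
  exact congrArg (fun f => f.hom) h1

/-- Objects of a finite length heart have a composition series. -/
lemma exists_composition (hH : P.IsHeart θ H)
    (hfin : ∀ X : H.FullSubcategory, IsArtinianObject X ∧ IsNoetherianObject X)
    {X : C} (hX : H X) : ∃ l : List C, (∀ s ∈ l, IsSimpleIn H s) ∧ IsFilt l X := by
  have := (hfin ⟨X, hX⟩).2
  -- Induction from above on the kernel `K` of a quotient `X ⟶ Y`. A simple subobject of a nonzero
  -- `Y` enlarges `K` strictly and is split off; starting from `K = 0` gives the series for `X`.
  suffices ∀ (S : Subobject (⟨X, hX⟩ : H.FullSubcategory)) (K Y : C) (hK : H K) (_ : H Y)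
      (f : K ⟶ X) (g : X ⟶ Y) (w : Y ⟶ K⟦(1 : ℤ)⟧)
      [Mono (ObjectProperty.homMk f : (⟨K, hK⟩ : H.FullSubcategory) ⟶ ⟨X, hX⟩)]
      (_ : Triangle.mk f g w ∈ distTriang C)
      (_ : S = Subobject.mk (ObjectProperty.homMk f : (⟨K, hK⟩ : H.FullSubcategory) ⟶ ⟨X, hX⟩)),
      ∃ l : List C, (∀ s ∈ l, IsSimpleIn H s) ∧ IsFilt l Y by
    have hT := contractible_distinguished₁ X
    have hm : Mono (ObjectProperty.homMk 0 :
      (⟨0, hH.zero (isZero_zero C)⟩ : H.FullSubcategory) ⟶ ⟨X, hX⟩) :=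
      mono_homMk _ _ _ fun x hx k _ => (isZero_zero C).eq_of_tgt _ _
    exact this _ 0 X (hH.zero (isZero_zero C)) hX 0 (𝟙 X) 0 hT rfl
  intro S
  induction S using WellFoundedGT.induction with
  | ind S ih =>
    intro K Y hK hY f g w _ hT hS
    by_cases h0 : IsZero Y
    · exact ⟨[], by simp, .nil h0⟩
    obtain ⟨t, Y', ht, hY', f₂, g₂, w₂, hT₂⟩ :=
      hH.exists_simple_sub (fun X => (hfin X).1) hY h0
    obtain ⟨K', f', w', hT'⟩ := distinguished_cocone_triangle₁ (g ≫ g₂)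
    have O := Triangulated.someOctahedron' rfl hT hT₂ hT'
    have hK' : H K' := hH.ext ⟨_, _, _, O.mem⟩ hK ht.1
    have hm := mono_homMk ⟨K', hK'⟩ ⟨X, hX⟩ f' (hH.mono_of_distTriang hT' hY')
    have hle : S ≤ Subobject.mk
        (ObjectProperty.homMk f' : (⟨K', hK'⟩ : H.FullSubcategory) ⟶ ⟨X, hX⟩) := by
      rw [hS]
      exact Subobject.mk_le_mk_of_comm (ObjectProperty.homMk O.m₁) (H.hom_ext O.comm₁)
    have hlt : S < Subobject.mk
        (ObjectProperty.homMk f' : (⟨K', hK'⟩ : H.FullSubcategory) ⟶ ⟨X, hX⟩) := by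
      refine lt_of_le_of_ne hle fun heq => ?_
      rw [hS] at heq
      let e := Subobject.isoOfMkEqMk _ _ heq
      have he : e.hom = ObjectProperty.homMk O.m₁ := by
        rw [← cancel_mono (ObjectProperty.homMk f' : (⟨K', hK'⟩ : H.FullSubcategory) ⟶ ⟨X, hX⟩)]
        have h1 : e.hom ≫ (ObjectProperty.homMk f' : (⟨K', hK'⟩ : H.FullSubcategory) ⟶ ⟨X, hX⟩)
            = ObjectProperty.homMk f := by simp [e]
        rw [h1]
        exact H.hom_ext O.comm₁.symm
      have : IsIso O.m₁ := by
        have h2 : IsIso (ObjectProperty.homMk O.m₁ : (⟨K, hK⟩ : H.FullSubcategory) ⟶ ⟨K', hK'⟩) := by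
          rw [← he]; infer_instance
        exact (H.isIso_hom_iff _).2 h2
      exact ht.not_isZero ((Triangle.isZero₃_iff_isIso₁ _ O.mem).2 this)
    obtain ⟨l, hl, hl'⟩ := ih _ hlt K' Y' hK' hY' f' _ w' hT' rfl
    refine ⟨l ++ [t], fun s hs => ?_, hl'.append ⟨_, _, _, hT₂⟩ (isFilt_singleton t)⟩
    rcases List.mem_append.1 hs with hs | hs
    · exact hl s hs
    · rwa [List.mem_singleton.1 hs]

end IsHeart

end Slicing

end Hearts

/-! ### Words in shifted simple objects and freeness of the Grothendieck group. -/

section Words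

variable {C : Type u} [Category.{v} C] [HasZeroObject C] [HasShift C ℤ] [Preadditive C]
  [∀ n : ℤ, (shiftFunctor C n).Additive] [Pretriangulated C]

/-- The object attached to a letter: a pair of an integer and an object. -/
def letter (p : ℤ × C) : C := p.2⟦p.1⟧

/-- The alternating sum of the values of a function on the letters of a word. -/
def altSum (f : C → ℝ) (w : List (ℤ × C)) : ℝ :=
  (w.map fun p => (p.1.negOnePow : ℤ) * f p.2).sum

/-- `c` is an iterated extension of the letters of `w`, which are shifts of objects in `G`. -/
structure IsWord (G : ObjectProperty C) (w : List (ℤ × C)) (c : C) : Prop where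
  filt : IsFilt (w.map letter) c
  mem : ∀ p ∈ w, G p.2

lemma IsWord.mono {G G' : ObjectProperty C} (h : ∀ s, G s → G' s) {w : List (ℤ × C)} {c : C}
    (hw : IsWord G w c) : IsWord G' w c := ⟨hw.filt, fun p hp => h _ (hw.mem p hp)⟩

lemma IsWord.shift {G : ObjectProperty C} {w : List (ℤ × C)} {c : C} (h : IsWord G w c) (n : ℤ) :
    IsWord G (w.map fun p => (p.1 + n, p.2)) (c⟦n⟧) where
  filt := by
    have h1 := h.filt.shift n
    rw [List.map_map] at h1 ⊢
    exact IsFilt.map_iso (fun p _ => ⟨((shiftFunctorAdd C p.1 n).app p.2).symm⟩) h1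
  mem p hp := by
    obtain ⟨q, hq, rfl⟩ := List.mem_map.1 hp
    exact h.mem q hq

lemma altSum_shift (f : C → ℝ) (w : List (ℤ × C)) (n : ℤ) :
    altSum f (w.map fun p => (p.1 + n, p.2)) = (n.negOnePow : ℤ) * altSum f w := by
  induction w with
  | nil => simp [altSum]
  | cons p w ih =>
    simp only [altSum, List.map_cons, List.sum_cons] at ih ⊢
    rw [ih, Int.negOnePow_add]
    push_cast
    ring

lemma altSum_append (f : C → ℝ) (w w' : List (ℤ × C)) :
    altSum f (w ++ w') = altSum f w + altSum f w' := by
  simp [altSum]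

lemma altSum_cons (f : C → ℝ) (p : ℤ × C) (w : List (ℤ × C)) :
    altSum f (p :: w) = (p.1.negOnePow : ℤ) * f p.2 + altSum f w := by
  simp [altSum]

lemma isWord_nil {G : ObjectProperty C} {c : C} (hc : IsZero c) : IsWord G [] c :=
  ⟨.nil hc, by simp⟩

variable [IsTriangulated C]

lemma IsWord.append {G : ObjectProperty C} {w w' : List (ℤ × C)} {a b c : C} (h : IsExt a b c)
    (hc : IsWord G w c) (ha : IsWord G w' a) : IsWord G (w ++ w') b where
  filt := by
    rw [List.map_append]
    exact hc.filt.append h ha.filt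
  mem p hp := (List.mem_append.1 hp).elim (hc.mem p) (ha.mem p)

namespace Slicing.IsHeart

variable {P : Slicing C} {θ : ℝ} {H : ObjectProperty C}

/-- The connecting morphism goes from degree `p.1` to degree `q.1 + 1 ≤ p.1`. It vanishes if the
inequality is strict; otherwise Schur's lemma makes it zero or invertible. Zero splits the
extension, and invertible makes the middle term zero. -/
lemma swap_letters (hH : P.IsHeart θ H) {p q : ℤ × C} (hp : IsSimpleIn H p.2)
    (hq : IsSimpleIn H q.2) (hpq : q.1 < p.1) {x : C} (h : IsExt (letter q) x (letter p)) :
    IsExt (letter p) x (letter q) ∨ (IsZero x ∧ p.1 = q.1 + 1 ∧ Nonempty (p.2 ≅ q.2)) := by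
  obtain ⟨k, s⟩ := p
  obtain ⟨m, t⟩ := q
  simp only [letter] at *
  let e : t⟦m + 1⟧ ≅ t⟦m⟧⟦(1 : ℤ)⟧ := (shiftFunctorAdd C m 1).app t
  obtain ⟨g₁, g₂, w, hT⟩ := h
  by_cases h0 : w = 0
  · exact Or.inl (isExt_swap_of_eq_zero hT h0)
  right
  have he : w ≫ e.inv ≠ 0 := fun h => h0 (by rwa [← cancel_mono e.inv, zero_comp])
  obtain rfl : k = m + 1 := by
    by_contra hk
    exact he (hH.hom_shift_eq_zero hp.1 hq.1 (by omega) _)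
  obtain ⟨f, hf⟩ := (shiftFunctor C (m + 1)).map_surjective (w ≫ e.inv)
  have hf' : IsIso f := (hH.schur hp hq f).resolve_left fun h => he (by
    rw [← hf, h, Functor.map_zero])
  have hw : w = f⟦m + 1⟧' ≫ e.hom := by
    rw [hf, Category.assoc, e.inv_hom_id, Category.comp_id]
  refine ⟨(Triangle.isZero₂_iff_isIso₃ _ hT).2 ?_, rfl, ⟨asIso f⟩⟩
  change IsIso w
  rw [hw]
  infer_instance

/-- Insertion of a letter into a sorted word. -/
lemma insert_letter (hH : P.IsHeart θ H) {p : ℤ × C} {w : List (ℤ × C)} {c : C}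
    (h : IsWord (IsSimpleIn H) (p :: w) c) (hw : w.Pairwise fun p q => p.1 ≤ q.1) :
    ∃ w', IsWord (IsSimpleIn H) w' c ∧ (w'.Pairwise fun p q => p.1 ≤ q.1) ∧
      (∀ q ∈ w', q ∈ p :: w) ∧
      ∀ f : C → ℝ, (∀ s t, IsSimpleIn H s → IsSimpleIn H t → Nonempty (s ≅ t) → f s = f t) →
        altSum f w' = altSum f (p :: w) := by
  induction w generalizing p c with
  | nil => exact ⟨[p], h, by simp, fun q hq => hq, fun _ _ => rfl⟩
  | cons q w ih =>
    by_cases hpq : p.1 ≤ q.1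
    · refine ⟨_, h, ?_, fun q hq => hq, fun _ _ => rfl⟩
      refine List.pairwise_cons.2 ⟨fun r hr => ?_, hw⟩
      rcases List.mem_cons.1 hr with rfl | hr
      · exact hpq
      · exact hpq.trans ((List.pairwise_cons.1 hw).1 r hr)
    have hp := h.mem p (by simp)
    have hq := h.mem q (by simp)
    have hw' : ∀ r ∈ w, IsSimpleIn H r.2 := fun r hr => h.mem r (by simp [hr])
    obtain ⟨b, hb, hl⟩ := isFilt_cons_iff.1 h.filt
    obtain ⟨b₁, hb₁, hl₁⟩ := isFilt_cons_iff.1 hl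
    obtain ⟨x, hx, hx'⟩ := hb₁.assoc hb
    -- `x` is the two-letter subquotient formed by the adjacent letters `p` and `q`. After a swap,
    -- `p` continues its way into the shorter word.
    rcases hH.swap_letters hp hq (not_le.1 hpq) hx' with hs | ⟨hz, hk, hst⟩
    · obtain ⟨b₂, hb₂, hb₂'⟩ := hx.assoc' hs
      obtain ⟨w', h1, h2, h3, h4⟩ := ih (p := p) (c := b₂) ⟨.cons hb₂ hl₁, fun r hr => by
        rcases List.mem_cons.1 hr with rfl | hr
        exacts [hp, hw' r hr]⟩ (List.pairwise_cons.1 hw).2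
      refine ⟨q :: w', ⟨.cons hb₂' h1.filt, fun r hr => ?_⟩, ?_, fun r hr => ?_, fun f hf => ?_⟩
      · rcases List.mem_cons.1 hr with rfl | hr
        exacts [hq, h1.mem r hr]
      · refine List.pairwise_cons.2 ⟨fun r hr => ?_, h2⟩
        rcases List.mem_cons.1 (h3 r hr) with rfl | hr
        · exact (not_le.1 hpq).le
        · exact (List.pairwise_cons.1 hw).1 r hr
      · rcases List.mem_cons.1 hr with rfl | hr
        · simp
        · rcases List.mem_cons.1 (h3 r hr) with rfl | hr
          · simp
          · simp [hr]
      · rw [altSum_cons, h4 f hf]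
        simp only [altSum_cons]
        ring
    · obtain ⟨e⟩ := hx.iso_of_isZero_right hz
      refine ⟨w, ⟨hl₁.of_iso e, hw'⟩, (List.pairwise_cons.1 hw).2, fun r hr => by simp [hr],
        fun f hf => ?_⟩
      -- The cancelled letters are isomorphic and one degree apart, so they contribute with opposite
      -- signs.
      rw [altSum_cons, altSum_cons, hf _ _ hp hq hst, hk, Int.negOnePow_succ]
      push_cast
      ring

/-- Every word in the simple objects of a heart can be sorted. -/
lemma sort_word (hH : P.IsHeart θ H) {w : List (ℤ × C)} {c : C}
    (h : IsWord (IsSimpleIn H) w c) :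
    ∃ w', IsWord (IsSimpleIn H) w' c ∧ (w'.Pairwise fun p q => p.1 ≤ q.1) ∧
      (∀ q ∈ w', q ∈ w) ∧
      ∀ f : C → ℝ, (∀ s t, IsSimpleIn H s → IsSimpleIn H t → Nonempty (s ≅ t) → f s = f t) →
        altSum f w' = altSum f w := by
  induction w generalizing c with
  | nil => exact ⟨[], h, by simp, by simp, fun _ _ => rfl⟩
  | cons p w ih =>
    obtain ⟨b, hb, hl⟩ := isFilt_cons_iff.1 h.filt
    obtain ⟨w₁, h1, h2, h3, h4⟩ := ih (c := b) ⟨hl, fun r hr => h.mem r (by simp [hr])⟩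
    obtain ⟨w₂, g1, g2, g3, g4⟩ := hH.insert_letter (p := p) (w := w₁) (c := c)
      ⟨.cons hb h1.filt, fun r hr => by
        rcases List.mem_cons.1 hr with rfl | hr
        exacts [h.mem r (by simp), h1.mem r hr]⟩ h2
    refine ⟨w₂, g1, g2, fun r hr => ?_, fun f hf => ?_⟩
    · rcases List.mem_cons.1 (g3 r hr) with rfl | hr
      · simp
      · simp [h3 r hr]
    · rw [g4 f hf, altSum_cons, altSum_cons, h4 f hf]

lemma letter_up (hH : P.IsHeart θ H) {p : ℤ × C} (hp : H p.2) :
    P.up (Set.Ioi (θ + p.1)) (letter p) := by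
  rw [letter, up_Ioi_shift]
  simpa using ((hH _).1 hp).1

lemma letter_dn (hH : P.IsHeart θ H) {p : ℤ × C} (hp : H p.2) :
    P.dn (Set.Ioi (θ + p.1 + 1)) (letter p) := by
  rw [letter, dn_Ioi_shift]
  convert ((hH _).1 hp).2 using 2
  ring

/-- The first letter of a sorted word has least degree and is the last quotient. If the total object
were zero, this quotient would be the shift of the remaining part, whose degrees are too high to map
to it. -/
lemma eq_nil_of_sorted (hH : P.IsHeart θ H) {w : List (ℤ × C)} {c : C}
    (h : IsWord (IsSimpleIn H) w c) (hw : w.Pairwise fun p q => p.1 ≤ q.1) (hc : IsZero c) :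
    w = [] := by
  cases w with
  | nil => rfl
  | cons p w =>
    exfalso
    obtain ⟨b, hb, hl⟩ := isFilt_cons_iff.1 h.filt
    have hp := h.mem p (by simp)
    refine hp.not_isZero (isZero_of_shift (hb.isZero_right (fun f => hc.eq_of_src _ _) fun f => ?_))
    refine hom_up_dn (isUpperSet_Ioi (θ + p.1 + 1)) ?_ (hH.letter_dn hp.1) f
    rw [up_Ioi_shift]
    refine hl.prop _ (fun _ => up_zero) (fun _ _ _ => up_ext) fun a ha => ?_
    obtain ⟨q, hq, rfl⟩ := List.mem_map.1 ha
    refine up_mono (Set.Ioi_subset_Ioi ?_) (hH.letter_up (h.mem q (by simp [hq])).1)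
    have : (p.1 : ℝ) ≤ q.1 := by exact_mod_cast (List.pairwise_cons.1 hw).1 q hq
    push_cast
    linarith

/-- The zero object is an extension of `c⟦1⟧` by `c`, so one word shifted by `1` followed by the
other is a word for zero. It sorts to the empty word, and its alternating sum is the difference of
the two sums. -/
lemma altSum_unique (hH : P.IsHeart θ H) {w w' : List (ℤ × C)} {c : C}
    (h : IsWord (IsSimpleIn H) w c) (h' : IsWord (IsSimpleIn H) w' c) (f : C → ℝ)
    (hf : ∀ s t, IsSimpleIn H s → IsSimpleIn H t → Nonempty (s ≅ t) → f s = f t) :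
    altSum f w = altSum f w' := by
  have h1 : IsExt c 0 (c⟦(1 : ℤ)⟧) := (isExt_zero_right (isZero_zero C) c).rotate
  obtain ⟨w'', g1, g2, g3, g4⟩ := hH.sort_word ((h.shift 1).append h1 h')
  have h2 := g4 f hf
  rw [hH.eq_nil_of_sorted g1 g2 (isZero_zero C), altSum_append, altSum_shift] at h2
  simp only [altSum, List.map_nil, List.sum_nil, Int.negOnePow_one] at h2 ⊢
  push_cast at h2
  linarith

/-- A semistable object is a shift of an object of the heart. -/
lemma exists_shift_mem (hH : P.IsHeart θ H) {φ : ℝ} {c : C} (hc : P.P φ c) :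
    ∃ k : ℤ, H (c⟦-k⟧) ∧ θ + k < φ ∧ φ ≤ θ + k + 1 := by
  -- The ceiling minus one, rather than the floor, because the intervals `(θ + k, θ + k + 1]` are
  -- closed on the right.
  refine ⟨⌈φ - θ⌉ - 1, ?_, ?_, ?_⟩
  · rw [hH, up_Ioi_shift, dn_Ioi_shift]
    push_cast
    refine ⟨up_of_mem (isUpperSet_Ioi _) ?_ hc, dn_of_notMem (isUpperSet_Ioi _) ?_ hc⟩
    · have := Int.ceil_lt_add_one (φ - θ)
      rw [Set.mem_Ioi]; linarith
    · have := Int.le_ceil (φ - θ)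
      rw [Set.mem_Ioi]; linarith
  · have := Int.ceil_lt_add_one (φ - θ)
    push_cast; linarith
  · have := Int.le_ceil (φ - θ)
    push_cast; linarith

lemma isWord_of_composition {G : ObjectProperty C} {l : List C} {c : C} (hl : ∀ s ∈ l, G s)
    (h : IsFilt l c) : IsWord G (l.map fun s => (0, s)) c where
  filt := by
    rw [List.map_map]
    refine IsFilt.map_iso (F := id) (fun s _ => ⟨((shiftFunctorZero C ℤ).app s).symm⟩) ?_
    simpa using h
  mem p hp := by
    obtain ⟨q, hq, rfl⟩ := List.mem_map.1 hp
    exact hl q hq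

lemma IsWord.of_iso {G : ObjectProperty C} {w : List (ℤ × C)} {c c' : C} (h : IsWord G w c)
    (e : c ≅ c') : IsWord G w c' := ⟨h.filt.of_iso e, h.mem⟩

/-- Every object has a word in the simple objects of the heart. -/
lemma exists_word (hH : P.IsHeart θ H)
    (hfin : ∀ X : H.FullSubcategory, IsArtinianObject X ∧ IsNoetherianObject X) (c : C) :
    ∃ w, IsWord (IsSimpleIn H) w c := by
  obtain ⟨l, hl⟩ := P.exists_isHN c
  refine hl.filt.prop (fun c => ∃ w, IsWord (IsSimpleIn H) w c) (fun x hx => ⟨[], isWord_nil hx⟩)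
    (fun a b c h ⟨w, ha⟩ ⟨w', hc⟩ => ⟨_, hc.append h ha⟩) fun a ha => ?_
  obtain ⟨p, hp, rfl⟩ := List.mem_map.1 ha
  obtain ⟨k, hk, -, -⟩ := hH.exists_shift_mem (hl.mem p hp)
  obtain ⟨l, h1, h2⟩ := hH.exists_composition hfin hk
  exact ⟨_, IsWord.of_iso ((isWord_of_composition h1 h2).shift k) (shiftNegShift p.2 k)⟩

/-- The Grothendieck group is free on the simple objects of a finite length heart: a function
on the simple objects extends to an additive function. -/
lemma exists_hom_K0 (hH : P.IsHeart θ H)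
    (hfin : ∀ X : H.FullSubcategory, IsArtinianObject X ∧ IsNoetherianObject X) (f : C → ℝ)
    (hf : ∀ s t, IsSimpleIn H s → IsSimpleIn H t → Nonempty (s ≅ t) → f s = f t) :
    ∃ ℓ : K0 C →+ ℝ, ∀ s, IsSimpleIn H s → ℓ (K0.of s) = f s := by
  choose w hw using hH.exists_word hfin
  let ℓ₀ : FreeAbelianGroup C →+ ℝ := FreeAbelianGroup.lift fun c => altSum f (w c)
  -- Words for the outer terms of a triangle concatenate to a word for the middle term, and the
  -- alternating sum does not depend on the word.
  have h0 : K0Relations C ≤ ℓ₀.ker := by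
    rw [K0Relations, AddSubgroup.closure_le]
    rintro x ⟨T, hT, rfl⟩
    have h1 := (hw T.obj₃).append ⟨_, _, _, hT⟩ (hw T.obj₁)
    have h2 := hH.altSum_unique (hw T.obj₂) h1 f hf
    rw [altSum_append] at h2
    simp only [SetLike.mem_coe, AddMonoidHom.mem_ker, map_sub, map_add, ℓ₀,
      FreeAbelianGroup.lift_apply_of, h2]
    ring
  refine ⟨QuotientAddGroup.lift (K0Relations C) ℓ₀ h0, fun s hs => ?_⟩
  have h1 : IsWord (IsSimpleIn H) [((0 : ℤ), s)] s :=
    isWord_of_composition (l := [s]) (by simpa using hs) (isFilt_singleton s)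
  have h2 := hH.altSum_unique (hw s) h1 f hf
  have h3 : altSum f [((0 : ℤ), s)] = f s := by simp [altSum]
  rw [h3] at h2
  rw [← h2]
  exact FreeAbelianGroup.lift_apply_of _ _

end Slicing.IsHeart

end Words

/-! ### Real sums over lists, and splitting of sorted lists. -/

lemma list_eq_zero_of_sum_eq_zero {ι : Type*} {l : List ι} {f : ι → ℝ} (h0 : ∀ x ∈ l, 0 ≤ f x)
    (hs : (l.map f).sum = 0) : ∀ x ∈ l, f x = 0 := by
  induction l with
  | nil => simp
  | cons a l ih =>
    simp only [List.map_cons, List.sum_cons] at hs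
    have h1 : 0 ≤ (l.map f).sum := List.sum_nonneg fun y hy => by
      obtain ⟨x, hx, rfl⟩ := List.mem_map.1 hy
      exact h0 x (List.mem_cons_of_mem _ hx)
    have h2 := h0 a List.mem_cons_self
    intro x hx
    rcases List.mem_cons.1 hx with rfl | hx
    · linarith
    · exact ih (fun x hx => h0 x (List.mem_cons_of_mem _ hx)) (by linarith) x hx

lemma list_sum_filter {ι : Type*} (l : List ι) (p : ι → Prop) [DecidablePred p] (f : ι → ℝ) :
    ((l.filter p).map f).sum = (l.map fun x => if p x then f x else 0).sum := by
  induction l with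
  | nil => simp
  | cons a l ih =>
    by_cases h : p a <;> simp [h, ih]

lemma list_sum_sub {ι : Type*} (l : List ι) (f g : ι → ℝ) :
    (l.map fun x => f x - g x).sum = (l.map f).sum - (l.map g).sum := by
  induction l with
  | nil => simp
  | cons a l ih =>
    simp only [List.map_cons, List.sum_cons, ih]
    ring

lemma list_split_lt {ι : Type*} (w : List (ℤ × ι)) (hw : w.Pairwise fun p q => p.1 ≤ q.1)
    (k : ℤ) : ∃ w₁ w₂, w = w₁ ++ w₂ ∧ (∀ p ∈ w₁, p.1 < k) ∧ ∀ p ∈ w₂, k ≤ p.1 := by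
  induction w with
  | nil => exact ⟨[], [], by simp⟩
  | cons a w ih =>
    by_cases h : a.1 < k
    · obtain ⟨w₁, w₂, h1, h2, h3⟩ := ih (List.pairwise_cons.1 hw).2
      refine ⟨a :: w₁, w₂, by simp [h1], fun p hp => ?_, h3⟩
      rcases List.mem_cons.1 hp with rfl | hp
      exacts [h, h2 p hp]
    · refine ⟨[], a :: w, rfl, by simp, fun p hp => ?_⟩
      rcases List.mem_cons.1 hp with rfl | hp
      · exact not_lt.1 h
      · exact (not_lt.1 h).trans ((List.pairwise_cons.1 hw).1 p hp)

/-! ### Heights and the generation of the massless subcategory. -/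

section Massless

variable {C : Type u} [Category.{v} C] [HasZeroObject C] [HasShift C ℤ] [Preadditive C]
  [∀ n : ℤ, (shiftFunctor C n).Additive] [Pretriangulated C]

/-- The imaginary part of a charge rotated by `-πθ`. -/
noncomputable def heightAt (Z : Charge C) (θ : ℝ) : K0 C →+ ℝ :=
  Complex.imAddGroupHom.comp
    ((AddMonoidHom.mulLeft (Complex.exp (-(Complex.I * Real.pi * θ)))).comp Z)

/-- The sign `(-1) ^ k` brings the angle of a phase in `(θ + k, θ + k + 1)` into `(0, π)`, where the
sine is positive. -/
lemma heightAt_of_eq {Z : Charge C} {θ φ m : ℝ} {x : K0 C} (k : ℤ)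
    (h : Z x = m * Complex.exp (Complex.I * Real.pi * φ)) :
    heightAt Z θ x = (-1) ^ k * (m * Real.sin (Real.pi * (φ - θ - k))) := by
  have h1 : heightAt Z θ x = m * Real.sin (Real.pi * (φ - θ)) := by
    change (Complex.exp (-(Complex.I * Real.pi * θ)) * Z x).im = _
    rw [h, mul_left_comm, ← Complex.exp_add,
      show -(Complex.I * Real.pi * θ) + Complex.I * Real.pi * φ
        = ((Real.pi * (φ - θ) : ℝ) : ℂ) * Complex.I by push_cast; ring,
      Complex.im_ofReal_mul, Complex.exp_ofReal_mul_I_im]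
  rw [h1, show Real.pi * (φ - θ - k) = Real.pi * (φ - θ) - k * Real.pi by ring,
    Real.sin_sub_int_mul_pi]
  have : ((-1 : ℝ) ^ k) * (-1) ^ k = 1 := by
    rw [← mul_zpow]; simp
  linear_combination (m * Real.sin (Real.pi * (φ - θ))) * (-this)

/-- Non-negativity of the height of a massive or massless semistable object. -/
lemma heightAt_nonneg {σ : SlicingCharge C} (hσ : σ.IsLaxPreStability) {θ φ : ℝ} {c : C}
    (hc : σ.slicing.P φ c) (h0 : ¬ IsZero c) {k : ℤ} (h1 : θ + k < φ) (h2 : φ < θ + k + 1) :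
    0 ≤ (-1) ^ k * heightAt σ.2 θ (K0.of c) ∧
      ((-1) ^ k * heightAt σ.2 θ (K0.of c) = 0 → σ.Z c = 0) := by
  obtain ⟨m, hm, h⟩ := hσ φ c hc h0
  have hs : 0 < Real.sin (Real.pi * (φ - θ - k)) := by
    apply Real.sin_pos_of_pos_of_lt_pi
    · exact mul_pos Real.pi_pos (by linarith)
    · exact (mul_lt_iff_lt_one_right Real.pi_pos).2 (by linarith)
  have hk : ((-1 : ℝ) ^ k) * (-1) ^ k = 1 := by
    rw [← mul_zpow]; simp
  have h3 : (-1) ^ k * heightAt σ.2 θ (K0.of c) = m * Real.sin (Real.pi * (φ - θ - k)) := by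
    rw [heightAt_of_eq k h, ← mul_assoc, hk, one_mul]
  rw [h3]
  refine ⟨by positivity, fun h4 => ?_⟩
  rcases mul_eq_zero.1 h4 with h5 | h5
  · rw [h, h5]; simp
  · exact absurd h5 hs.ne'

lemma SlicingCharge.massless_iff {σ : SlicingCharge C} {c : C} :
    σ.massless c ↔ ∀ p ∈ (σ.slicing.hn c).list, σ.Z p.2 = 0 := by
  rw [SlicingCharge.massless, SlicingCharge.mass,
    Finset.sum_eq_zero_iff_of_nonneg fun _ _ => norm_nonneg _]
  simp only [HNFiltration.mem_list, Finset.mem_univ, true_imp_iff, norm_eq_zero]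
  exact ⟨fun h p ⟨i, hi⟩ => hi ▸ h i, fun h i => h _ ⟨i, rfl⟩⟩

lemma IsFilt.hom_apply {A : Type*} [AddCommGroup A] (Z : K0 C →+ A) {l : List C} {c : C}
    (h : IsFilt l c) : Z (K0.of c) = (l.map fun a => Z (K0.of a)).sum := by
  rw [h.K0_of, map_list_sum, List.map_map]
  rfl

lemma SlicingCharge.Z_shift_eq_zero {σ : SlicingCharge C} {c : C} (n : ℤ) :
    σ.Z (c⟦n⟧) = 0 ↔ σ.Z c = 0 := by
  rw [SlicingCharge.Z, SlicingCharge.Z, K0.of_shift]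
  rcases Int.even_or_odd n with hn | hn
  · rw [Int.negOnePow_even n hn, one_smul]
  · rw [Int.negOnePow_odd n hn, Units.neg_smul, one_smul, map_neg, neg_eq_zero]

lemma prop_of_isFilt {Q : ObjectProperty C} (hQ : Q.IsTriangulated)
    (hQ' : Q.IsClosedUnderIsomorphisms) {l : List C} {c : C} (h : IsFilt l c)
    (hl : ∀ a ∈ l, Q a) : Q c := by
  refine h.prop Q (fun x hx => Q.prop_of_isZero hx) (fun a b c h ha hc => ?_) hl
  obtain ⟨f, g, w, hT⟩ := h
  have := Q.ext_of_isTriangulatedClosed₂' _ hT ha hc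
  rwa [Q.isoClosure_eq_self] at this

variable [IsTriangulated C]

/-- By minimality, every object of the triangulated closure of `G` is thus an iterated extension of
shifts of objects of `G`. -/
lemma isTriangulated_words (G : ObjectProperty C) :
    ObjectProperty.IsTriangulated (fun c => ∃ w, IsWord G w c : ObjectProperty C) ∧
    ObjectProperty.IsClosedUnderIsomorphisms (fun c => ∃ w, IsWord G w c : ObjectProperty C) := by
  have hi : ObjectProperty.IsClosedUnderIsomorphisms
      (fun c => ∃ w, IsWord G w c : ObjectProperty C) :=
    ⟨fun e ⟨w, hw⟩ => ⟨w, hw.filt.of_iso e, hw.mem⟩⟩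
  refine ⟨{ exists_zero := ⟨0, isZero_zero C, [], isWord_nil (isZero_zero C)⟩
            isStableUnderShiftBy := fun n => ⟨fun c ⟨w, hw⟩ => ⟨_, hw.shift n⟩⟩
            toIsTriangulatedClosed₂ := .mk' fun T hT ⟨w, h1⟩ ⟨w', h3⟩ =>
              ⟨_, h3.append ⟨_, _, _, hT⟩ h1⟩ }, hi⟩

variable {σ : SlicingCharge C} {θ : ℝ} {H : ObjectProperty C}

/-- No nonzero semistable object has a phase in `θ + ℤ`. -/
def Slicing.NoPhaseAt (P : Slicing C) (θ : ℝ) : Prop :=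
  ∀ (φ : ℝ) (c : C), P.P φ c → ¬ IsZero c → ∀ k : ℤ, φ ≠ θ + k

/-- The gap condition excludes the phase `θ + 1`, the only one in the heart at which a massive
object could have height zero. -/
lemma heightAt_nonneg_of_heart (hσ : σ.IsLaxPreStability) (hH : σ.slicing.IsHeart θ H)
    (hθ : σ.slicing.NoPhaseAt θ) {c : C} (hc : H c) :
    0 ≤ heightAt σ.2 θ (K0.of c) ∧ (heightAt σ.2 θ (K0.of c) = 0 → σ.Z c = 0) := by
  obtain ⟨l, hl⟩ := σ.slicing.exists_isHN c
  have h1 := (hl.up_iff (isUpperSet_Ioi _)).1 ((hH c).1 hc).1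
  have h2 := (hl.dn_iff (isUpperSet_Ioi _)).1 ((hH c).1 hc).2
  have h3 : ∀ p ∈ l, 0 ≤ heightAt σ.2 θ (K0.of p.2) ∧
      (heightAt σ.2 θ (K0.of p.2) = 0 → σ.Z p.2 = 0) := fun p hp => by
    have h4 : p.1 < θ + (0 : ℤ) + 1 := by
      refine lt_of_le_of_ne ?_ ?_
      · simpa using h2 p hp
      · simpa using hθ p.1 p.2 (hl.mem p hp) (hl.ne_zero p hp) 1
    simpa using heightAt_nonneg hσ (hl.mem p hp) (hl.ne_zero p hp) (k := 0)
      (by simpa using h1 p hp) h4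
  have h4 := hl.filt.hom_apply (heightAt σ.2 θ)
  rw [List.map_map] at h4
  constructor
  · rw [h4]
    refine List.sum_nonneg fun y hy => ?_
    obtain ⟨p, hp, rfl⟩ := List.mem_map.1 hy
    exact (h3 p hp).1
  · intro h5
    rw [h4] at h5
    have h6 := list_eq_zero_of_sum_eq_zero (fun p hp => (h3 p hp).1) h5
    have h7 := hl.filt.hom_apply σ.2
    rw [SlicingCharge.Z, h7, List.map_map]
    refine List.sum_eq_zero fun y hy => ?_
    obtain ⟨p, hp, rfl⟩ := List.mem_map.1 hy
    exact (h3 p hp).2 (h6 p hp)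

/-- If no semistable object has a phase in `θ + ℤ`, then the massless subcategory is generated
by the massless simple objects of the heart `P(θ, θ + 1]`. -/
lemma massless_eq_triangulatedClosure (hσ : σ.IsLaxPreStability) (hH : σ.slicing.IsHeart θ H)
    (hfin : ∀ X : H.FullSubcategory, IsArtinianObject X ∧ IsNoetherianObject X)
    (hθ : σ.slicing.NoPhaseAt θ) :
    σ.massless = triangulatedClosure fun s => Slicing.IsSimpleIn H s ∧ σ.Z s = 0 := by
  ext c
  constructor
  · intro hc Q hQ hQ' hG
    rw [SlicingCharge.massless_iff] at hc
    have hl := (σ.slicing.hn c).isHN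
    refine prop_of_isFilt hQ hQ' hl.filt fun a ha => ?_
    obtain ⟨p, hp, rfl⟩ := List.mem_map.1 ha
    obtain ⟨k, hk, -, -⟩ := hH.exists_shift_mem (hl.mem p hp)
    obtain ⟨l, h1, h2⟩ := hH.exists_composition hfin hk
    have h3 : σ.Z (p.2⟦-k⟧) = 0 := SlicingCharge.Z_shift_eq_zero _ |>.2 (hc p hp)
    have h4 : heightAt σ.2 θ (K0.of (p.2⟦-k⟧)) = 0 := by
      change (Complex.exp (-(Complex.I * Real.pi * θ)) * σ.Z (p.2⟦-k⟧)).im = 0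
      rw [h3]; simp
    rw [h2.hom_apply] at h4
    -- The composition factors have nonnegative heights with sum zero, so each of them is massless.
    have h5 := list_eq_zero_of_sum_eq_zero
      (fun s hs => (heightAt_nonneg_of_heart hσ hH hθ (h1 s hs).1).1) h4
    have h6 : Q (p.2⟦-k⟧) := prop_of_isFilt hQ hQ' h2 fun s hs => hG _
      ⟨h1 s hs, (heightAt_nonneg_of_heart hσ hH hθ (h1 s hs).1).2 (h5 s hs)⟩
    exact Q.prop_of_iso (shiftNegShift p.2 k) (Q.le_shift k _ h6)
  · intro hc
    obtain ⟨hR, hR'⟩ := isTriangulated_words fun s => Slicing.IsSimpleIn H s ∧ σ.Z s = 0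
    obtain ⟨w, hw⟩ := hc _ hR hR' fun s hs =>
      ⟨_, Slicing.IsHeart.isWord_of_composition (l := [s]) (by simpa using hs) (isFilt_singleton s)⟩
    obtain ⟨w, h1, h2, h3, -⟩ := hH.sort_word (hw.mono fun s hs => hs.1)
    have h4 : ∀ p ∈ w, σ.Z p.2 = 0 := fun p hp => (hw.mem p (h3 p hp)).2
    clear h3 hw
    have hl := (σ.slicing.hn c).isHN
    -- The truncation of `c` above `θ + k` can also be read off the sorted word, as the part with
    -- letters of degree at least `k`. By uniqueness of truncations its charge is a sum of charges
    -- of massless letters.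
    have key : ∀ k : ℤ, ((σ.slicing.hn c).list.map fun p =>
        if p.1 ∈ Set.Ioi (θ + k) then heightAt σ.2 θ (K0.of p.2) else 0).sum = 0 := by
      classical
      intro k
      obtain ⟨a, b, hab, ha, hb⟩ := hl.exists_trunc (isUpperSet_Ioi (θ + k))
      obtain ⟨w₁, w₂, rfl, hw₁, hw₂⟩ := list_split_lt w h2 k
      have h5 := h1.filt
      rw [List.map_append] at h5
      obtain ⟨a', b', hab', hb', ha'⟩ := h5.split
      have g1 := ha'.prop (σ.slicing.up (Set.Ioi (θ + k))) (fun _ => Slicing.up_zero)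
        (fun _ _ _ => Slicing.up_ext) fun x hx => by
          obtain ⟨p, hp, rfl⟩ := List.mem_map.1 hx
          refine Slicing.up_mono (Set.Ioi_subset_Ioi ?_)
            (hH.letter_up (h1.mem p (List.mem_append_right _ hp)).1)
          have : (k : ℝ) ≤ p.1 := by exact_mod_cast hw₂ p hp
          linarith
      have g2 := hb'.prop (σ.slicing.dn (Set.Ioi (θ + k))) (fun _ => Slicing.dn_zero)
        (fun _ _ _ => Slicing.dn_ext) fun x hx => by
          obtain ⟨p, hp, rfl⟩ := List.mem_map.1 hx
          refine Slicing.dn_anti (Set.Ioi_subset_Ioi ?_)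
            (hH.letter_dn (h1.mem p (List.mem_append_left _ hp)).1)
          have : (p.1 : ℝ) + 1 ≤ k := by exact_mod_cast hw₁ p hp
          linarith
      obtain ⟨e⟩ := Slicing.trunc_unique (isUpperSet_Ioi (θ + k)) hab hab'
        (ha.up (isUpperSet_Ioi _) fun p hp => by simpa using List.of_mem_filter hp)
        (hb.dn (isUpperSet_Ioi _) fun p hp => by simpa using List.of_mem_filter hp) g1 g2
      have h6 : σ.2 (K0.of a') = 0 := by
        rw [ha'.hom_apply, List.map_map]
        refine List.sum_eq_zero fun y hy => ?_
        obtain ⟨p, hp, rfl⟩ := List.mem_map.1 hy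
        exact SlicingCharge.Z_shift_eq_zero _ |>.2 (h4 p (List.mem_append_right _ hp))
      have h7 : heightAt σ.2 θ (K0.of a) = 0 := by
        rw [K0.of_iso e]
        change (Complex.exp (-(Complex.I * Real.pi * θ)) * σ.2 (K0.of a')).im = 0
        rw [h6]; simp
      rw [ha.filt.hom_apply, List.map_map] at h7
      rw [← list_sum_filter (p := fun p : ℝ × C => p.1 ∈ Set.Ioi (θ + k))
        (f := fun p : ℝ × C => heightAt σ.2 θ (K0.of p.2))]
      convert h7 <;> rfl
    rw [SlicingCharge.massless_iff]
    intro p hp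
    obtain ⟨k, -, hk1, hk2⟩ := hH.exists_shift_mem (hl.mem p hp)
    have h5 := list_sum_sub (σ.slicing.hn c).list
      (fun p => if p.1 ∈ Set.Ioi (θ + k) then heightAt σ.2 θ (K0.of p.2) else 0)
      (fun p => if p.1 ∈ Set.Ioi (θ + (k + 1 : ℤ)) then heightAt σ.2 θ (K0.of p.2) else 0)
    rw [key, key, sub_zero] at h5
    -- The difference of consecutive truncations isolates the factors with phases in `(θ + k, θ + k
    -- + 1]`. Their heights have one common sign and total zero, so each vanishes.
    have h6 : ((σ.slicing.hn c).list.map fun p => (-1 : ℝ) ^ k *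
        ((if p.1 ∈ Set.Ioi (θ + k) then heightAt σ.2 θ (K0.of p.2) else 0) -
          if p.1 ∈ Set.Ioi (θ + (k + 1 : ℤ)) then heightAt σ.2 θ (K0.of p.2) else 0)).sum = 0 := by
      rw [List.sum_map_mul_left, h5, mul_zero]
    have h7 : ∀ q ∈ (σ.slicing.hn c).list, θ + k < q.1 → ¬ θ + (k + 1 : ℤ) < q.1 →
        0 ≤ (-1) ^ k * heightAt σ.2 θ (K0.of q.2) ∧
        ((-1) ^ k * heightAt σ.2 θ (K0.of q.2) = 0 → σ.Z q.2 = 0) := fun q hq hq1 hq2 => by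
      refine heightAt_nonneg hσ (hl.mem q hq) (hl.ne_zero q hq) hq1 (lt_of_le_of_ne ?_ ?_)
      · push_cast at hq2
        linarith
      · have := hθ q.1 q.2 (hl.mem q hq) (hl.ne_zero q hq) (k + 1)
        push_cast at this
        rwa [← add_assoc] at this
    have h8 := list_eq_zero_of_sum_eq_zero (fun q hq => by
      simp only [Set.mem_Ioi]
      by_cases hq1 : θ + k < q.1
      · by_cases hq2 : θ + (k + 1 : ℤ) < q.1
        · rw [if_pos hq1, if_pos hq2, sub_self, mul_zero]
        · rw [if_pos hq1, if_neg hq2, sub_zero]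
          exact (h7 q hq hq1 hq2).1
      · have hq2 : ¬ θ + (k + 1 : ℤ) < q.1 := by push_cast; linarith
        rw [if_neg hq1, if_neg hq2, sub_zero, mul_zero]) h6 p hp
    have hk3 : ¬ θ + (k + 1 : ℤ) < p.1 := by push_cast; linarith
    simp only [Set.mem_Ioi] at h8
    rw [if_pos hk1, if_neg hk3, sub_zero] at h8
    exact (h7 p hp hk1 hk3).2 h8

end Massless

/-! ### Relabelling the phases of a slicing by a monotone map. -/

section MapSlicing

variable {C : Type u} [Category.{v} C] [HasZeroObject C] [HasShift C ℤ] [Preadditive C]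
  [∀ n : ℤ, (shiftFunctor C n).Additive] [Pretriangulated C] [IsTriangulated C]

namespace Slicing

variable (P : Slicing C) (f : ℝ → ℝ)

/-- The objects whose semistable factors have phases in the fibre of `f` over `φ`. -/
def mapProp (φ : ℝ) : ObjectProperty C :=
  fun c => P.up (f ⁻¹' Set.Ici φ) c ∧ P.dn (f ⁻¹' Set.Ioi φ) c

variable {P f}

lemma mapProp_iff (hf : Monotone f) {l : List (ℝ × C)} {c : C} (h : IsHN P.P l c) {φ : ℝ} :
    P.mapProp f φ c ↔ ∀ p ∈ l, f p.1 = φ := by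
  rw [mapProp, h.up_iff ((isUpperSet_Ici φ).preimage hf),
    h.dn_iff ((isUpperSet_Ioi φ).preimage hf), ← forall₂_and]
  refine forall₂_congr fun p _ => ?_
  simp only [Set.mem_preimage, Set.mem_Ici, Set.mem_Ioi, not_lt]
  exact ⟨fun h => le_antisymm h.2 h.1, fun h => ⟨h.ge, h.le⟩⟩

/-- Merging the Harder-Narasimhan factors whose phases have the same image. -/
lemma _root_.LaxStab.IsHN.map (hf : Monotone f) {l : List (ℝ × C)} {c : C} (h : IsHN P.P l c) :
    ∃ l', IsHN (P.mapProp f) l' c ∧ (∀ q ∈ l', ∃ p ∈ l, q.1 = f p.1) ∧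
      ∀ p ∈ l, ∃ q ∈ l', q.1 = f p.1 := by
  classical
  obtain ⟨n, hn⟩ : ∃ n, l.length ≤ n := ⟨_, le_rfl⟩
  induction n generalizing l c with
  | zero =>
    obtain rfl : l = [] := List.eq_nil_of_length_eq_zero (by omega)
    exact ⟨[], ⟨h.filt, by simp, by simp, by simp⟩, by simp, by simp⟩
  | succ n ih =>
    cases l with
    | nil => exact ⟨[], ⟨h.filt, by simp, by simp, by simp⟩, by simp, by simp⟩
    | cons p l =>
      -- The head has the smallest phase. Cutting strictly above its image merges all factors with
      -- that image into one quotient `b`; the subobject `a` has fewer factors.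
      have hU : IsUpperSet (f ⁻¹' Set.Ioi (f p.1)) := (isUpperSet_Ioi _).preimage hf
      obtain ⟨a, b, hab, ha, hb⟩ := h.exists_trunc hU
      have hlen : ((p :: l).filter (·.1 ∈ f ⁻¹' Set.Ioi (f p.1))).length ≤ n := by
        rw [List.filter_cons_of_neg (by simp)]
        exact (List.length_filter_le _ _).trans (by simpa using hn)
      obtain ⟨l', hl', h1, h2⟩ := ih ha hlen
      have hle : ∀ q ∈ p :: l, f p.1 ≤ f q.1 := fun q hq => by
        rcases List.mem_cons.1 hq with rfl | hq
        · exact le_rfl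
        · exact hf ((List.pairwise_cons.1 h.lt).1 q hq).le
      refine ⟨(f p.1, b) :: l', ⟨.cons hab hl'.filt, ?_, ?_, ?_⟩, ?_, ?_⟩
      · intro q hq
        rcases List.mem_cons.1 hq with rfl | hq
        · refine (mapProp_iff hf hb).2 fun q hq => ?_
          have hq2 := List.of_mem_filter hq
          have := hle q (List.mem_of_mem_filter hq)
          simp only [Set.mem_preimage, Set.mem_Ioi, not_lt, decide_eq_true_eq] at hq2
          exact le_antisymm hq2 this
        · exact hl'.mem q hq
      · intro q hq
        rcases List.mem_cons.1 hq with rfl | hq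
        · intro h0
          have := hb.eq_nil h0
          rw [List.filter_eq_nil_iff] at this
          exact this p List.mem_cons_self (by simp)
        · exact hl'.ne_zero q hq
      · refine List.pairwise_cons.2 ⟨fun q hq => ?_, hl'.lt⟩
        obtain ⟨r, hr, hqr⟩ := h1 q hq
        have := List.of_mem_filter hr
        simp only [Set.mem_preimage, Set.mem_Ioi, decide_eq_true_eq] at this
        rw [hqr]
        exact this
      · intro q hq
        rcases List.mem_cons.1 hq with rfl | hq
        · exact ⟨p, List.mem_cons_self, rfl⟩
        · obtain ⟨r, hr, hqr⟩ := h1 q hq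
          exact ⟨r, List.mem_of_mem_filter hr, hqr⟩
      · intro q hq
        rcases (hle q hq).eq_or_lt with h3 | h3
        · exact ⟨_, List.mem_cons_self, h3⟩
        · obtain ⟨r, hr, hqr⟩ := h2 q (List.mem_filter.2 ⟨hq, by simpa using h3⟩)
          exact ⟨r, List.mem_cons_of_mem _ hr, hqr⟩

/-- The slicing obtained by relabelling the phases by a monotone map which commutes with the
translation by `1`. -/
def map (P : Slicing C) (f : ℝ → ℝ) (hf : Monotone f) (hf1 : ∀ x, f (x + 1) = f x + 1) :
    Slicing C where
  P := P.mapProp f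
  iso_closed φ := ⟨fun e h => ⟨up_iso e h.1, dn_iso e h.2⟩⟩
  zero_mem φ X hX := ⟨up_zero hX, dn_zero hX⟩
  biprod_mem φ X Y hX hY := ⟨up_ext (isExt_biprod X Y) hX.1 hY.1, dn_ext (isExt_biprod X Y) hX.2 hY.2⟩
  shift_iff φ X := by
    have h1 := (up_shift (P := P) ((isUpperSet_Ici (φ + 1)).preimage hf) (c := X) 1)
    have h2 := (dn_shift (P := P) ((isUpperSet_Ioi (φ + 1)).preimage hf) (c := X) 1)
    have e1 : {x : ℝ | x + ((1 : ℤ) : ℝ) ∈ f ⁻¹' Set.Ici (φ + 1)} = f ⁻¹' Set.Ici φ := by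
      ext x; simp [hf1]
    have e2 : {x : ℝ | x + ((1 : ℤ) : ℝ) ∈ f ⁻¹' Set.Ioi (φ + 1)} = f ⁻¹' Set.Ioi φ := by
      ext x; simp [hf1]
    rw [e1] at h1
    rw [e2] at h2
    exact and_congr h1 h2
  hom_eq_zero φ ψ X Y g h hX hY :=
    hom_up_dn ((isUpperSet_Ici φ).preimage hf) hX.1
      (dn_anti (fun x (hx : φ ≤ f x) => (h.trans_le hx : ψ < f x)) hY.2) g
  exists_HN c := by
    obtain ⟨l, hl⟩ := P.exists_isHN c
    obtain ⟨l', hl', -⟩ := hl.map hf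
    obtain ⟨H, -⟩ := hl'.exists_filtration
    exact ⟨H⟩

variable (hf : Monotone f) (hf1 : ∀ x, f (x + 1) = f x + 1)

lemma up_map {U : Set ℝ} (hU : IsUpperSet U) {c : C} :
    (P.map f hf hf1).up U c ↔ P.up (f ⁻¹' U) c := by
  obtain ⟨l, hl⟩ := P.exists_isHN c
  obtain ⟨l', hl', h1, h2⟩ := hl.map hf
  rw [IsHN.up_iff (P := P.map f hf hf1) hl' hU, hl.up_iff (hU.preimage hf)]
  constructor
  · intro h p hp
    obtain ⟨q, hq, e⟩ := h2 p hp
    exact (e ▸ h q hq : f p.1 ∈ U)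
  · intro h q hq
    obtain ⟨p, hp, e⟩ := h1 q hq
    rw [e]
    exact h p hp

lemma dn_map {U : Set ℝ} (hU : IsUpperSet U) {c : C} :
    (P.map f hf hf1).dn U c ↔ P.dn (f ⁻¹' U) c := by
  obtain ⟨l, hl⟩ := P.exists_isHN c
  obtain ⟨l', hl', h1, h2⟩ := hl.map hf
  rw [IsHN.dn_iff (P := P.map f hf hf1) hl' hU, hl.dn_iff (hU.preimage hf)]
  constructor
  · intro h p hp
    obtain ⟨q, hq, e⟩ := h2 p hp
    exact (e ▸ h q hq : f p.1 ∉ U)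
  · intro h q hq
    obtain ⟨p, hp, e⟩ := h1 q hq
    rw [e]
    exact h p hp

lemma phiMinus_map {c : C} (hc : ¬ IsZero c) :
    (P.map f hf hf1).phiMinus c = f (P.phiMinus c) :=
  eq_of_forall_le_iff fun t => by
    have h1 := up_iff_phiMinus (P := P.map f hf hf1) (isUpperSet_Ici t) hc
    have h2 := up_iff_phiMinus (P := P) ((isUpperSet_Ici t).preimage hf) hc
    rw [up_map hf hf1 (isUpperSet_Ici t)] at h1
    exact h1.symm.trans h2

lemma phiPlus_map {c : C} (hc : ¬ IsZero c) :
    (P.map f hf hf1).phiPlus c = f (P.phiPlus c) :=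
  eq_of_forall_ge_iff fun t => by
    have h1 := dn_iff_phiPlus (P := P.map f hf hf1) (isUpperSet_Ioi t) hc
    have h2 := dn_iff_phiPlus (P := P) ((isUpperSet_Ioi t).preimage hf) hc
    rw [dn_map hf hf1 (isUpperSet_Ioi t)] at h1
    simp only [Set.mem_preimage, Set.mem_Ioi, not_lt] at h1 h2
    exact h1.symm.trans h2

lemma ext_prop {Q : Slicing C} (h : ∀ φ c, P.P φ c ↔ Q.P φ c) : P = Q := by
  have h' : P.P = Q.P := by
    funext φ
    ext c
    exact h φ c
  cases P
  cases Q
  obtain rfl := h'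
  rfl

lemma prop_iff_of_isHN {l : List (ℝ × C)} {c : C} (hl : IsHN P.P l c) {φ : ℝ} :
    P.P φ c ↔ ∀ p ∈ l, p.1 = φ :=
  prop_iff.trans (mapProp_iff (f := id) monotone_id hl)

lemma dn_iff_hom {U : Set ℝ} (hU : IsUpperSet U) {c : C} :
    P.dn U c ↔ ∀ x, P.up U x → ∀ f : x ⟶ c, f = 0 :=
  ⟨fun h _ hx f => hom_up_dn hU hx h f,
    fun h _ x f hψ hx => h x (up_of_mem hU hψ hx) f⟩

/-- Only the `up` classes need comparison, since each `dn` class is the right orthogonal of the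
corresponding `up` class. -/
lemma IsHeart.congr_up {Q : Slicing C} {θ θ' : ℝ} {H : ObjectProperty C}
    (h : ∀ (k : ℤ) c, P.up (Set.Ioi (θ + k)) c ↔ Q.up (Set.Ioi (θ' + k)) c)
    (hH : Q.IsHeart θ' H) : P.IsHeart θ H := by
  intro c
  have h0 := h 0
  have h1 := h 1
  simp only [Int.cast_zero, add_zero, Int.cast_one] at h0 h1
  rw [hH, dn_iff_hom (isUpperSet_Ioi _), dn_iff_hom (isUpperSet_Ioi _), h0]
  simp only [h1]

/-- `phiMinus` as an occurring phase. -/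
lemma exists_prop_phiMinus (P : Slicing C) {c : C} (hc : ¬ IsZero c) :
    ∃ s b, P.P (P.phiMinus c) s ∧ ¬ IsZero s ∧ IsExt b c s := by
  obtain ⟨l, hl⟩ := P.exists_isHN c
  cases l with
  | nil => exact absurd hl.filt.isZero hc
  | cons p l =>
    obtain ⟨b, hb, -⟩ := hl.tail
    have : P.phiMinus c = p.1 := eq_of_forall_le_iff fun t => by
      have h1 := up_iff_phiMinus (P := P) (isUpperSet_Ici t) hc
      rw [hl.up_iff (isUpperSet_Ici t)] at h1
      refine Iff.trans h1.symm ⟨fun h => h p List.mem_cons_self, fun h q hq => ?_⟩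
      rcases List.mem_cons.1 hq with rfl | hq
      · exact h
      · exact (h.trans ((List.pairwise_cons.1 hl.lt).1 q hq).le : t ≤ q.1)
    rw [this]
    exact ⟨p.2, b, hl.mem p List.mem_cons_self, hl.ne_zero p List.mem_cons_self, hb⟩

lemma phiMinus_le_phiPlus (P : Slicing C) {c : C} (hc : ¬ IsZero c) :
    P.phiMinus c ≤ P.phiPlus c := by
  by_contra! h
  refine hc (isZero_of_up_dn (P := P) (isUpperSet_Ioi (P.phiPlus c)) ?_ ?_)
  · exact (up_iff_phiMinus (isUpperSet_Ioi _) hc).2 h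
  · exact (dn_iff_phiPlus (isUpperSet_Ioi _) hc).2 (by simp)

lemma phi_of_prop {φ : ℝ} {c : C} (h : P.P φ c) (hc : ¬ IsZero c) :
    P.phiMinus c = φ ∧ P.phiPlus c = φ := by
  rw [prop_iff, up_iff_phiMinus (isUpperSet_Ici _) hc, dn_iff_phiPlus (isUpperSet_Ioi _) hc] at h
  have h1 := P.phiMinus_le_phiPlus hc
  have h2 := h.1
  have h3 := h.2
  simp only [Set.mem_Ici, Set.mem_Ioi, not_lt] at h2 h3
  constructor <;> linarith

end Slicing

end MapSlicing

/-! ### Local finiteness from a rank function on the heart. -/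

section LocallyFinite

variable {C : Type u} [Category.{v} C] [HasZeroObject C] [HasShift C ℤ] [Preadditive C]
  [∀ n : ℤ, (shiftFunctor C n).Additive] [Pretriangulated C] [IsTriangulated C]

namespace Slicing

variable {P : Slicing C} {a b : ℝ}

/-- The cone of a kernel in `P(a, b)` lies in `P(a, b)`. -/
lemma cone_of_kernel (hab : a < b) {S X Y Z : C} (hS : P.interval (Set.Ioo a b) S)
    (hX : P.interval (Set.Ioo a b) X) (hZ : P.interval (Set.Ioo a b) Z) {f : S ⟶ X} {g : X ⟶ Z}
    (hfg : f ≫ g = 0) (hker : ∀ x, P.interval (Set.Ioo a b) x → ∀ k : x ⟶ X, k ≫ g = 0 →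
      ∃ m : x ⟶ S, m ≫ f = k)
    (hmono : ∀ x, P.interval (Set.Ioo a b) x → ∀ k : x ⟶ S, k ≫ f = 0 → k = 0)
    {y : X ⟶ Y} {w : Y ⟶ S⟦(1 : ℤ)⟧} (hT : Triangle.mk f y w ∈ distTriang C) :
    P.interval (Set.Ioo a b) Y := by
  have hab' : Set.Ici b ⊆ Set.Ioi a := fun x hx => hab.trans_le hx
  have hX' := interval_Ioo_iff.1 hX
  have hS' := interval_Ioo_iff.1 hS
  have hZ' := interval_Ioo_iff.1 hZ
  have hY : P.up (Set.Ioi a) Y := up_ext (IsExt.rotate ⟨_, _, _, hT⟩) hX'.1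
    (up_Ioi_shift _ |>.2 (up_mono (Set.Ioi_subset_Ioi (by push_cast; linarith)) hS'.1))
  -- The part `T` of the cone with phases at least `b` has to vanish. The fibre `X'` of `X ⟶ F`
  -- introduced below is an extension of `T` by `S` and still lies in `P(a, b)`.
  obtain ⟨T, F, ⟨t, q, w₂, hT₂⟩, hTu, hFd⟩ := P.exists_trunc (isUpperSet_Ici b) Y
  have hF : P.interval (Set.Ioo a b) F := interval_Ioo_iff.2
    ⟨up_ext (IsExt.rotate ⟨_, _, _, hT₂⟩) hY (up_Ioi_shift _ |>.2
      (up_mono (fun x (hx : b ≤ x) => (by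
        rw [Set.mem_Ioi]; push_cast; linarith : x ∈ Set.Ioi (a - (1 : ℤ)))) hTu)), hFd⟩
  obtain ⟨X', j, w₃, hT₃⟩ := distinguished_cocone_triangle₁ (y ≫ q)
  have O := Triangulated.someOctahedron' rfl hT hT₂ hT₃
  have hX'u : P.up (Set.Ioi a) X' := up_ext ⟨_, _, _, O.mem⟩ hS'.1 (up_mono hab' hTu)
  have hX'd : P.dn (Set.Ici b) X' := dn_ext (IsExt.invRotate ⟨_, _, _, hT₃⟩)
    ((dn_shift (isUpperSet_Ici b) (-1)).2 (dn_anti (fun x (hx : b ≤ x + (-1 : ℤ)) => (by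
      rw [Set.mem_Ici]; push_cast at hx; linarith : x ∈ Set.Ici b)) hFd)) hX'.2
  obtain ⟨g', hg'⟩ := exists_desc_of_distTriang hT g hfg
  have hjq : (j ≫ y) ≫ q = 0 := by
    rw [Category.assoc]
    exact comp_distTriang_mor_zero₁₂ _ hT₃
  obtain ⟨m, hm⟩ := exists_lift_of_distTriang hT₂ (j ≫ y) hjq
  have hjg : j ≫ g = 0 := by
    rw [hg', ← Category.assoc, hm, Category.assoc,
      hom_up_dn (isUpperSet_Ici b) hTu hZ'.2 (t ≫ g'), comp_zero]
  -- `X' ⟶ X` is killed by `g` because `T` has no morphisms to `Z`. The kernel property then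
  -- retracts `X'` onto `S`, so `T` is a summand of `X'`; phases force it to be zero.
  obtain ⟨r, hr⟩ := hker X' (interval_Ioo_iff.2 ⟨hX'u, hX'd⟩) j hjg
  have hir : O.m₁ ≫ r = 𝟙 S := by
    rw [← sub_eq_zero]
    refine hmono S hS _ ?_
    rw [Preadditive.sub_comp, Category.assoc, hr, O.comm₁, Category.id_comp, sub_self]
  have hT0 : IsZero T := by
    rw [IsZero.iff_id_eq_zero]
    have h1 : (t ≫ w) ≫ O.m₁⟦(1 : ℤ)⟧' = 0 := comp_distTriang_mor_zero₃₁ _ O.mem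
    have h2 : t ≫ w = 0 := by
      have h3 : (O.m₁ ≫ r)⟦(1 : ℤ)⟧' = 𝟙 (S⟦(1 : ℤ)⟧) := by rw [hir]; exact CategoryTheory.Functor.map_id _ _
      have h4 : (t ≫ w) ≫ (O.m₁ ≫ r)⟦(1 : ℤ)⟧' = 0 := by
        rw [Functor.map_comp, ← Category.assoc, h1, zero_comp]
      rwa [h3, Category.comp_id] at h4
    obtain ⟨s, hs⟩ := exists_lift_of_distTriang (rot_of_distTriang _ O.mem) (𝟙 T)
      (by rw [Category.id_comp]; exact h2 : 𝟙 T ≫ t ≫ w = 0)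
    rw [hs, hom_up_dn (isUpperSet_Ici b) hTu hX'd s]
    exact zero_comp
  obtain ⟨e⟩ := IsExt.iso_of_isZero_left ⟨_, _, _, hT₂⟩ hT0
  rw [interval_Ioo_iff] at hF ⊢
  exact ⟨up_iso e.symm hF.1, dn_iso e.symm hF.2⟩

/-- A bounded additive rank makes `P(a, b)` a length category. -/
lemma isLength_of_rank (hab : a < b) (ℓ : K0 C →+ ℝ)
    (hℓ : ∀ c, P.interval (Set.Ioo a b) c →
      ∃ n : ℕ, ℓ (K0.of c) = n ∧ (n = 0 → IsZero c)) :
    IsLengthQuasiAbelian (P.interval (Set.Ioo a b)).FullSubcategory := by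
  choose! rk hrk hrk0 using hℓ
  have key : ∀ {S X : (P.interval (Set.Ioo a b)).FullSubcategory} (f : S ⟶ X),
      NormalMono f → rk S.obj ≤ rk X.obj ∧ (rk S.obj = rk X.obj → IsIso f) := by
    intro S X f hf
    obtain ⟨Y, y, w, hT⟩ := distinguished_cocone_triangle f.hom
    have hY : P.interval (Set.Ioo a b) Y := by
      have hm : Mono f := mono_of_isLimit_fork hf.isLimit
      refine cone_of_kernel hab S.property X.property hf.Z.property (f := f.hom) (g := hf.g.hom)
        (congrArg (fun f => f.hom) hf.w) (fun x hx k hk => ?_) (fun x hx k hk => ?_) hT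
      · obtain ⟨l, hl⟩ := KernelFork.IsLimit.lift' hf.isLimit
          (ObjectProperty.homMk k : (⟨x, hx⟩ : (P.interval (Set.Ioo a b)).FullSubcategory) ⟶ X)
          (ObjectProperty.hom_ext _ hk)
        exact ⟨l.hom, congrArg (fun f => f.hom) hl⟩
      · have h1 : (ObjectProperty.homMk k :
            (⟨x, hx⟩ : (P.interval (Set.Ioo a b)).FullSubcategory) ⟶ S) = 0 :=
          zero_of_comp_mono f (ObjectProperty.hom_ext _ hk)
        exact congrArg (fun f => f.hom) h1
    have h1 : rk X.obj = rk S.obj + rk Y := by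
      have h2 := congrArg ℓ (IsExt.K0_of ⟨_, _, _, hT⟩)
      rw [map_add, hrk _ X.property, hrk _ S.property, hrk _ hY] at h2
      exact_mod_cast h2
    refine ⟨by omega, fun h2 => ?_⟩
    have h3 : IsIso f.hom := (Triangle.isZero₃_iff_isIso₁ _ hT).1 (hrk0 Y hY (by omega))
    exact (P.interval (Set.Ioo a b)).isIso_hom_iff f |>.1 h3
  intro X
  let ρ : StrictSubobject X → ℕ := fun S => rk (S.1 : (P.interval (Set.Ioo a b)).FullSubcategory).obj
  have hρ : StrictMono ρ := by
    intro S S' hSS'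
    have hle : S.1 ≤ S'.1 := hSS'.le
    obtain ⟨hS⟩ := S.2
    -- The inclusion of `S` in `S'` is again a kernel, namely of the restriction to `S'` of the
    -- morphism defining `S`.
    have h1 : NormalMono (S.1.ofLE S'.1 hle) :=
      { Z := hS.Z
        g := S'.1.arrow ≫ hS.g
        w := by rw [← Category.assoc, Subobject.ofLE_arrow]; exact hS.w
        isLimit := KernelFork.IsLimit.ofι' _ _ fun {A} k hk =>
          let l := KernelFork.IsLimit.lift' hS.isLimit (k ≫ S'.1.arrow)
            (by rw [Category.assoc]; exact hk)
          ⟨l.1, by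
            rw [← cancel_mono S'.1.arrow, Category.assoc, Subobject.ofLE_arrow]
            exact l.2⟩ }
    obtain ⟨h2, h3⟩ := key _ h1
    refine lt_of_le_of_ne h2 fun h4 => ?_
    have := h3 h4
    refine hSS'.not_ge (?_ : S'.1 ≤ S.1)
    exact Subobject.le_of_comm (inv (S.1.ofLE S'.1 hle)) (by simp)
  have hb : ∀ S, ρ S ≤ rk X.obj := fun S => by
    obtain ⟨hS⟩ := S.2
    exact (key _ hS).1
  refine ⟨⟨hρ.wellFoundedLT.wf⟩, ?_⟩
  have h5 : StrictAnti fun S => rk X.obj - ρ S := fun S S' h => by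
    have h6 := hρ h
    have h7 := hb S'
    change rk X.obj - ρ S' < rk X.obj - ρ S
    omega
  exact h5.wellFoundedGT

/-- The rank is the length of a composition series, extended to `K(C)` by freeness on the simple
objects. -/
lemma exists_rank_heart {θ : ℝ} {H : ObjectProperty C} (hH : P.IsHeart θ H)
    (hfin : ∀ X : H.FullSubcategory, IsArtinianObject X ∧ IsNoetherianObject X) :
    ∃ ℓ : K0 C →+ ℝ, ∀ c, H c → ∃ n : ℕ, ℓ (K0.of c) = n ∧ (n = 0 → IsZero c) := by
  obtain ⟨ℓ, hℓ⟩ := hH.exists_hom_K0 hfin (fun _ => 1) (fun _ _ _ _ _ => rfl)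
  refine ⟨ℓ, fun c hc => ?_⟩
  obtain ⟨l, hl, hlc⟩ := hH.exists_composition hfin hc
  refine ⟨l.length, ?_, fun h => ?_⟩
  · rw [hlc.hom_apply, List.map_congr_left fun s hs => hℓ s (hl s hs)]
    simp
  · rw [List.eq_nil_of_length_eq_zero h] at hlc
    exact hlc.isZero

/-- A slicing with a finite length heart and no phases near the ends of the heart is locally
finite. -/
lemma isLocallyFinite_of_gap {θ δ : ℝ} {H : ObjectProperty C} (hH : P.IsHeart θ H)
    (hfin : ∀ X : H.FullSubcategory, IsArtinianObject X ∧ IsNoetherianObject X) (hδ : 0 < δ)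
    (hgap : ∀ φ c, P.P φ c → ¬ IsZero c → ∀ k : ℤ, δ ≤ |φ - (θ + k)|) :
    P.IsLocallyFinite := by
  obtain ⟨ℓ, hℓ⟩ := exists_rank_heart hH hfin
  refine ⟨min δ (1 / 2) / 2, by positivity, ?_, fun φ => ?_⟩
  · have := min_le_right δ (1 / 2)
    linarith
  set ε := min δ (1 / 2) / 2 with hε
  have hε0 : 0 < ε := by positivity
  have h1 : 2 * ε ≤ δ := by have := min_le_left δ (1 / 2); linarith
  have hab : φ - ε < φ + ε := by linarith
  -- The window has width `2ε ≤ δ`. If it meets `θ + ℤ` it contains no phases and the category is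
  -- zero; otherwise it sits inside a shift of the heart, with rank `± ℓ`.
  by_cases hk : ∃ k : ℤ, θ + k ∈ Set.Ioo (φ - ε) (φ + ε)
  · obtain ⟨k, hk1, hk2⟩ := hk
    refine isLength_of_rank hab ℓ fun c hc => ?_
    have h0 : IsZero c := by
      by_contra h0
      obtain ⟨s, b, hs, hs0, -⟩ := P.exists_prop_phiMinus h0
      have h2 := hgap _ s hs hs0 k
      have h3 := interval_Ioo_iff.1 hc
      rw [up_iff_phiMinus (isUpperSet_Ioi _) h0, dn_iff_phiPlus (isUpperSet_Ici _) h0] at h3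
      have h4 := P.phiMinus_le_phiPlus h0
      have h5 := h3.1
      have h6 := h3.2
      simp only [Set.mem_Ioi, Set.mem_Ici, not_le] at h5 h6
      have h7 : |P.phiMinus c - (θ + k)| < δ := by
        rw [abs_lt]; constructor <;> linarith
      linarith
    exact ⟨0, by rw [K0.of_isZero h0, map_zero, Nat.cast_zero], fun _ => h0⟩
  · set k := ⌊φ - ε - θ⌋ with hkdef
    have hk1 : θ + k ≤ φ - ε := by
      have := Int.floor_le (φ - ε - θ)
      linarith
    have hk2 : φ + ε ≤ θ + k + 1 := by
      by_contra! h
      refine hk ⟨k + 1, ?_, ?_⟩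
      · have := Int.lt_floor_add_one (φ - ε - θ)
        push_cast; linarith
      · push_cast; linarith
    refine isLength_of_rank hab (((k.negOnePow : ℤ) : ℤ) • ℓ) fun c hc => ?_
    have h3 := interval_Ioo_iff.1 hc
    have h4 : H (c⟦-k⟧) := by
      rw [hH, up_Ioi_shift, dn_Ioi_shift]
      push_cast
      refine ⟨up_mono (Set.Ioi_subset_Ioi (by linarith)) h3.1,
        dn_anti (fun x (hx : _ < x) => (by rw [Set.mem_Ici]; linarith : x ∈ Set.Ici (φ + ε))) h3.2⟩
    obtain ⟨n, hn, hn0⟩ := hℓ _ h4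
    refine ⟨n, ?_, fun h => isZero_of_shift (hn0 h)⟩
    rw [← hn, K0.of_shift, Int.negOnePow_neg, Units.smul_def, map_zsmul, AddMonoidHom.smul_apply]

end Slicing

end LocallyFinite

/-! ### Paths in a component of the space of stability conditions, and rotation. -/

section Deformation

variable {C : Type u} [Category.{v} C] [HasZeroObject C] [HasShift C ℤ] [Preadditive C]
  [∀ n : ℤ, (shiftFunctor C n).Additive] [Pretriangulated C]

namespace LFSlicing

lemma edist_le {P Q : LFSlicing C} {r : ℝ≥0∞}
    (h : ∀ c, ¬ IsZero c → edist (P.1.phiMinus c) (Q.1.phiMinus c) ≤ r ∧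
      edist (P.1.phiPlus c) (Q.1.phiPlus c) ≤ r) : edist P Q ≤ r :=
  iSup_le fun c => max_le (h c.1 c.2).1 (h c.1 c.2).2

lemma edist_phi_le (P Q : LFSlicing C) {c : C} (hc : ¬ IsZero c) :
    edist (P.1.phiMinus c) (Q.1.phiMinus c) ≤ edist P Q ∧
      edist (P.1.phiPlus c) (Q.1.phiPlus c) ≤ edist P Q := by
  have h := le_iSup (fun c : {c : C // ¬ IsZero c} =>
    max (edist (P.1.phiMinus c.1) (Q.1.phiMinus c.1))
      (edist (P.1.phiPlus c.1) (Q.1.phiPlus c.1))) ⟨c, hc⟩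
  exact ⟨(le_max_left _ _).trans h, (le_max_right _ _).trans h⟩

lemma abs_phi_sub_lt {P Q : LFSlicing C} {r : ℝ} (h : edist P Q < ENNReal.ofReal r) {c : C}
    (hc : ¬ IsZero c) : |P.1.phiMinus c - Q.1.phiMinus c| < r ∧
      |P.1.phiPlus c - Q.1.phiPlus c| < r := by
  obtain ⟨h1, h2⟩ := edist_phi_le P Q hc
  have h3 := h1.trans_lt h
  have h4 := h2.trans_lt h
  rw [edist_dist, ENNReal.ofReal_lt_ofReal_iff_of_nonneg dist_nonneg, Real.dist_eq] at h3 h4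
  exact ⟨h3, h4⟩

lemma continuous_of_lipschitz {T : Type*} [PseudoEMetricSpace T] {γ : T → LFSlicing C}
    (K : NNReal) (h : ∀ s t c, ¬ IsZero c →
      edist ((γ s).1.phiMinus c) ((γ t).1.phiMinus c) ≤ K * edist s t ∧
      edist ((γ s).1.phiPlus c) ((γ t).1.phiPlus c) ≤ K * edist s t) : Continuous γ :=
  LipschitzWith.continuous (K := K) fun s t => edist_le fun c hc => h s t c hc

end LFSlicing

lemma continuous_charge {T : Type*} [TopologicalSpace T] {γ : T → Charge C}
    (h : ∀ x, Continuous fun t => γ t x) : Continuous γ :=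
  continuous_induced_rng.2 (continuous_pi h)

/-- Every deformation below, whether rotating, squeezing or moving the heights, is shown to stay in
`S` in this way. -/
lemma IsStabComponent.mem_of_continuous {nrm : Seminorm ℝ (ℝ ⊗[ℤ] K0 C)}
    {S : Set (SlicingCharge C)} (hS : IsStabComponent nrm S) {T : Type*} [TopologicalSpace T]
    [PreconnectedSpace T] {γ : T → SlicingCharge C} (hγ : Continuous γ)
    (hmem : ∀ t, (γ t).IsStability nrm) {t₀ : T} (h₀ : γ t₀ ∈ S) (t : T) : γ t ∈ S := by
  obtain ⟨σ, -, rfl⟩ := hS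
  rw [connectedComponentIn_eq h₀]
  exact (isPreconnected_range hγ).subset_connectedComponentIn (Set.mem_range_self t₀)
    (Set.range_subset_iff.2 hmem) (Set.mem_range_self t)

lemma IsStabComponent.isStability {nrm : Seminorm ℝ (ℝ ⊗[ℤ] K0 C)}
    {S : Set (SlicingCharge C)} (hS : IsStabComponent nrm S) {τ : SlicingCharge C}
    (hτ : τ ∈ S) : τ.IsStability nrm := by
  obtain ⟨σ, -, rfl⟩ := hS
  exact (connectedComponentIn_subset (Stab nrm) σ hτ : τ ∈ Stab nrm)

variable [IsTriangulated C]

namespace Slicing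

lemma monotone_sub_const (θ : ℝ) : Monotone fun x : ℝ => x - θ :=
  fun _ _ h => sub_le_sub_right h θ

lemma add_one_sub_const (θ x : ℝ) : x + 1 - θ = x - θ + 1 := by ring

/-- Rotation of the phases. -/
def rotate (P : Slicing C) (θ : ℝ) : Slicing C :=
  P.map (fun x => x - θ) (monotone_sub_const θ) (add_one_sub_const θ)

variable {P : Slicing C} {θ : ℝ}

lemma up_rotate {a : ℝ} {c : C} : (P.rotate θ).up (Set.Ioi a) c ↔ P.up (Set.Ioi (a + θ)) c := by
  rw [rotate, up_map _ _ (isUpperSet_Ioi a), Set.preimage_sub_const_Ioi]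

lemma dn_rotate {a : ℝ} {c : C} : (P.rotate θ).dn (Set.Ioi a) c ↔ P.dn (Set.Ioi (a + θ)) c := by
  rw [rotate, dn_map _ _ (isUpperSet_Ioi a), Set.preimage_sub_const_Ioi]

lemma prop_rotate {φ : ℝ} {c : C} : (P.rotate θ).P φ c ↔ P.P (φ + θ) c := by
  rw [prop_iff, prop_iff, dn_rotate, rotate, up_map _ _ (isUpperSet_Ici _),
    Set.preimage_sub_const_Ici]

lemma isHeart_rotate {a : ℝ} {H : ObjectProperty C} :
    (P.rotate θ).IsHeart a H ↔ P.IsHeart (a + θ) H := by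
  simp only [IsHeart, up_rotate, dn_rotate, add_right_comm]

lemma interval_rotate {a b : ℝ} :
    (P.rotate θ).interval (Set.Ioo a b) = P.interval (Set.Ioo (a + θ) (b + θ)) := by
  ext c
  rw [interval_Ioo_iff, interval_Ioo_iff, up_rotate, rotate, dn_map _ _ (isUpperSet_Ici b),
    Set.preimage_sub_const_Ici]

lemma IsLocallyFinite.rotate (h : P.IsLocallyFinite) (θ : ℝ) : (P.rotate θ).IsLocallyFinite := by
  obtain ⟨ε, h1, h2, h3⟩ := h
  refine ⟨ε, h1, h2, fun φ => ?_⟩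
  have h4 := h3 (φ + θ)
  have e : P.interval (Set.Ioo (φ + θ - ε) (φ + θ + ε)) =
      (P.rotate θ).interval (Set.Ioo (φ - ε) (φ + ε)) := by
    rw [interval_rotate]
    congr 2 <;> ring
  rwa [e] at h4

end Slicing

namespace SlicingCharge

/-- Rotation of a pair of a slicing and a charge. -/
noncomputable def rotate (τ : SlicingCharge C) (θ : ℝ) : SlicingCharge C :=
  (⟨τ.slicing.rotate θ, τ.1.2.rotate θ⟩,
    (AddMonoidHom.mulLeft (Complex.exp (-(Complex.I * Real.pi * θ)))).comp τ.2)

lemma rotate_Z (τ : SlicingCharge C) (θ : ℝ) (c : C) :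
    (τ.rotate θ).Z c = Complex.exp (-(Complex.I * Real.pi * θ)) * τ.Z c := rfl

lemma rotate_zero_mem {S : Set (SlicingCharge C)} {τ : SlicingCharge C} (hτ : τ ∈ S) :
    τ.rotate 0 ∈ S := by
  convert hτ
  refine Prod.ext (Subtype.ext ?_) ?_
  · exact Slicing.ext_prop fun φ c => by
      refine Slicing.prop_rotate.trans ?_
      rw [add_zero]
  · ext x
    simp [rotate]

lemma IsStability.rotate {nrm : Seminorm ℝ (ℝ ⊗[ℤ] K0 C)} {τ : SlicingCharge C}
    (hτ : τ.IsStability nrm) (θ : ℝ) : (τ.rotate θ).IsStability nrm := by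
  obtain ⟨h1, K, hK, h2⟩ := hτ
  refine ⟨fun φ c hc h0 => ?_, K, hK, fun φ c hc => ?_⟩
  · obtain ⟨m, hm, hZ⟩ := h1 _ c (Slicing.prop_rotate.1 hc) h0
    refine ⟨m, hm, ?_⟩
    rw [rotate_Z, hZ, mul_left_comm, ← Complex.exp_add]
    congr 2
    push_cast
    ring
  · refine (h2 _ c (Slicing.prop_rotate.1 hc)).trans (le_of_eq ?_)
    rw [rotate_Z, norm_mul]
    have : ‖Complex.exp (-(Complex.I * Real.pi * θ))‖ = 1 := by
      rw [show -(Complex.I * Real.pi * θ) = ((-(Real.pi * θ) : ℝ) : ℂ) * Complex.I by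
        push_cast; ring]
      exact Complex.norm_exp_ofReal_mul_I _
    rw [this, one_mul]

lemma continuous_rotate (τ : SlicingCharge C) : Continuous τ.rotate := by
  refine Continuous.prodMk (LFSlicing.continuous_of_lipschitz 1 fun s t c hc => ?_)
    (continuous_charge fun x => ?_)
  · change edist ((τ.slicing.rotate s).phiMinus c) ((τ.slicing.rotate t).phiMinus c) ≤ _ ∧
      edist ((τ.slicing.rotate s).phiPlus c) ((τ.slicing.rotate t).phiPlus c) ≤ _
    rw [Slicing.rotate, Slicing.rotate, Slicing.phiMinus_map _ _ hc, Slicing.phiMinus_map _ _ hc,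
      Slicing.phiPlus_map _ _ hc, Slicing.phiPlus_map _ _ hc]
    simp only [edist_dist, dist_sub_left, ENNReal.coe_one, one_mul, le_refl, and_self]
  · change Continuous fun t : ℝ => Complex.exp (-(Complex.I * Real.pi * t)) * τ.2 x
    fun_prop

end SlicingCharge

/-- Consequently every `P(θ, θ + 1]` of a member of `S` is the heart of a member of `S`, and the
finite type condition applies to it. -/
lemma IsStabComponent.rotate_mem {nrm : Seminorm ℝ (ℝ ⊗[ℤ] K0 C)}
    {S : Set (SlicingCharge C)} (hS : IsStabComponent nrm S) {τ : SlicingCharge C}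
    (hτ : τ ∈ S) (θ : ℝ) : τ.rotate θ ∈ S :=
  hS.mem_of_continuous τ.continuous_rotate (fun _ => (hS.isStability hτ).rotate _)
    (SlicingCharge.rotate_zero_mem hτ) θ

end Deformation

/-! ### From a lax stability condition to simple objects of a heart. -/

section Forward

variable {C : Type u} [Category.{v} C] [HasZeroObject C] [HasShift C ℤ] [Preadditive C]
  [∀ n : ℤ, (shiftFunctor C n).Additive] [Pretriangulated C]

lemma triangulatedClosure_congr {G G' : ObjectProperty C}
    (h : ∀ x, G x → ∃ y, G' y ∧ Nonempty (x ≅ y)) (h' : ∀ x, G' x → G x) :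
    triangulatedClosure G = triangulatedClosure G' := by
  ext c
  refine ⟨fun hc Q hQ hQ' hG => hc Q hQ hQ' fun x hx => ?_,
    fun hc Q hQ hQ' hG => hc Q hQ hQ' fun x hx => hG _ (h' x hx)⟩
  obtain ⟨y, hy, ⟨e⟩⟩ := h x hx
  exact Q.prop_of_iso e.symm (hG _ hy)

lemma exists_edist_lt_of_mem_closure {S : Set (SlicingCharge C)} {σ : SlicingCharge C}
    (h : σ ∈ closure S) {ε : ℝ} (hε : 0 < ε) :
    ∃ τ ∈ S, edist σ.1 τ.1 < ENNReal.ofReal ε := by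
  have h1 : {τ : SlicingCharge C | edist τ.1 σ.1 < ENNReal.ofReal ε} ∈ nhds σ :=
    continuous_fst.continuousAt.preimage_mem_nhds
      (Metric.eball_mem_nhds σ.1 (ENNReal.ofReal_pos.2 hε))
  obtain ⟨τ, h2, h3⟩ := mem_closure_iff_nhds.1 h _ h1
  exact ⟨τ, h3, by rw [edist_comm]; exact h2⟩

variable [IsTriangulated C]

namespace Slicing

variable {P : Slicing C}

lemma IsHeart.exists_shortExact {θ : ℝ} {H : ObjectProperty C} (hH : P.IsHeart θ H) {a b c : C}
    (ha : H a) (hb : H b) (hc : H c) (h : IsExt a b c) :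
    ∃ S : ShortComplex H.FullSubcategory, S.ShortExact ∧ S.X₁ = ⟨a, ha⟩ ∧ S.X₂ = ⟨b, hb⟩ ∧
      S.X₃ = ⟨c, hc⟩ := by
  obtain ⟨f, g, w, hT⟩ := h
  let _ := hH.abelian
  have := hH.hasFiniteProducts
  let f' : (⟨a, ha⟩ : H.FullSubcategory) ⟶ ⟨b, hb⟩ := ObjectProperty.homMk f
  let g' : (⟨b, hb⟩ : H.FullSubcategory) ⟶ ⟨c, hc⟩ := ObjectProperty.homMk g
  have hk := Triangulated.AbelianSubcategory.isLimitKernelForkOfDistTriang hH.hom_neg f' g' w hT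
  have hk' := Triangulated.AbelianSubcategory.isColimitCokernelCoforkOfDistTriang hH.hom_neg
    f' g' w hT
  have h0 : f' ≫ g' = 0 := H.hom_ext (comp_distTriang_mor_zero₁₂ _ hT)
  refine ⟨ShortComplex.mk f' g' h0, ShortComplex.ShortExact.mk' ?_ (mono_of_isLimit_fork hk)
    (epi_of_isColimit_cofork hk'), rfl, rfl, rfl⟩
  exact ShortComplex.exact_of_f_is_kernel _ hk

/-- The torsion pair of a heart cut out by another slicing. -/
lemma isTorsionPair_of_near {Q : Slicing C} {a ψ : ℝ} {H : ObjectProperty C} (hH : Q.IsHeart a H)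
    (hup : ∀ c, P.up (Set.Ioi ψ) c → Q.up (Set.Ioi a) c)
    (hdn : ∀ c, P.dn (Set.Ioi ψ) c → Q.dn (Set.Ioi (a + 1)) c) :
    IsTorsionPair (fun X : H.FullSubcategory => P.up (Set.Ioi ψ) X.obj)
      (fun X : H.FullSubcategory => P.dn (Set.Ioi ψ) X.obj) where
  iso_torsion := ⟨fun e h => up_iso (H.ι.mapIso e) h⟩
  iso_free := ⟨fun e h => dn_iso (H.ι.mapIso e) h⟩
  hom_eq_zero X Y f hX hY := H.hom_ext (hom_up_dn (isUpperSet_Ioi ψ) hX hY f.hom)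
  exists_shortExact X := by
    obtain ⟨T, F, hTF, hT, hF⟩ := P.exists_trunc (isUpperSet_Ioi ψ) X.obj
    have hX := (hH _).1 X.property
    have hT' : H T := (hH T).2 ⟨hup T hT, dn_ext hTF.invRotate (dn_Ioi_shift _ |>.2
      (dn_anti (Set.Ioi_subset_Ioi (by push_cast; linarith)) (hdn F hF))) hX.2⟩
    have hF' : H F := (hH F).2 ⟨up_ext hTF.rotate hX.1 (up_Ioi_shift _ |>.2
      (up_mono (Set.Ioi_subset_Ioi (by push_cast; linarith)) (hup T hT))), hdn F hF⟩
    obtain ⟨S, hS, h1, h2, h3⟩ := hH.exists_shortExact hT' X.property hF' hTF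
    exact ⟨S, hS, by rw [h1]; exact hT, ⟨eqToIso h2⟩, by rw [h3]; exact hF⟩

/-- Slicings near to a slicing whose heart has finitely many torsion pairs have finitely many
phases. -/
lemma finite_phases {P Q : LFSlicing C} {ε : ℝ} (hε' : ε ≤ 1 / 4)
    (h : edist P Q < ENNReal.ofReal ε) {H : ObjectProperty C} (hH : Q.1.IsHeart (-ε) H)
    (hfin : FinitelyManyTorsionPairs H.FullSubcategory) :
    {φ : ℝ | φ ∈ Set.Ioc 0 (1 / 2) ∧ ∃ c, P.1.P φ c ∧ ¬ IsZero c}.Finite := by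
  let F : ℝ → ObjectProperty H.FullSubcategory × ObjectProperty H.FullSubcategory := fun ψ =>
    (fun X => P.1.up (Set.Ioi ψ) X.obj, fun X => P.1.dn (Set.Ioi ψ) X.obj)
  have hup : ∀ a b c, a + ε ≤ b → P.1.up (Set.Ioi b) c → Q.1.up (Set.Ioi a) c := by
    intro a b c hab hc
    by_cases h0 : IsZero c
    · exact up_zero h0
    have h1 := abs_lt.1 (LFSlicing.abs_phi_sub_lt h h0).1
    rw [up_iff_phiMinus (isUpperSet_Ioi _) h0, Set.mem_Ioi] at hc ⊢
    linarith
  have hdn : ∀ a b c, b + ε ≤ a → P.1.dn (Set.Ioi b) c → Q.1.dn (Set.Ioi a) c := by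
    intro a b c hab hc
    by_cases h0 : IsZero c
    · exact dn_zero h0
    have h1 := abs_lt.1 (LFSlicing.abs_phi_sub_lt h h0).2
    rw [dn_iff_phiPlus (isUpperSet_Ioi _) h0, Set.mem_Ioi] at hc ⊢
    linarith
  -- The torsion pair at `φ` lives in the heart `(-ε, 1 - ε]` of `Q`. For `0 < φ ≤ 1 / 2` this needs
  -- `1 / 2 + ε ≤ 1 - ε`, whence `ε ≤ 1 / 4`.
  refine Set.Finite.of_finite_image (f := F) (hfin.subset ?_) ?_
  · rintro _ ⟨φ, ⟨⟨h1, h2⟩, -⟩, rfl⟩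
    exact isTorsionPair_of_near hH (fun c => hup _ _ c (by linarith))
      (fun c => hdn _ _ c (by linarith))
  -- An object semistable of phase `ψ` for `P` lies in `H`; it is torsion for the pair at `φ` but
  -- not for the pair at `ψ`.
  · have key : ∀ φ ψ : ℝ, 0 < φ → φ < ψ → ψ ≤ 1 / 2 → (∃ c, P.1.P ψ c ∧ ¬ IsZero c) →
        F φ ≠ F ψ := by
      rintro φ ψ h1 h2 h3 ⟨c, hc, h0⟩ heq
      have h4 := abs_lt.1 (LFSlicing.abs_phi_sub_lt h h0).1
      have h5 := abs_lt.1 (LFSlicing.abs_phi_sub_lt h h0).2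
      rw [(phi_of_prop hc h0).1] at h4
      rw [(phi_of_prop hc h0).2] at h5
      have hcH : H c := by
        rw [hH, up_iff_phiMinus (isUpperSet_Ioi _) h0, dn_iff_phiPlus (isUpperSet_Ioi _) h0,
          Set.mem_Ioi, Set.mem_Ioi]
        constructor <;> linarith
      have h6 : (F φ).1 ⟨c, hcH⟩ := up_of_mem (isUpperSet_Ioi φ) h2 hc
      rw [heq] at h6
      have h7 := (up_iff_phiMinus (isUpperSet_Ioi ψ) h0).1 h6
      rw [(phi_of_prop hc h0).1] at h7
      exact lt_irrefl ψ h7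
    rintro φ ⟨⟨h1, h2⟩, h3⟩ ψ ⟨⟨g1, g2⟩, g3⟩ heq
    rcases lt_trichotomy φ ψ with hlt | rfl | hlt
    · exact absurd heq (key φ ψ h1 hlt g2 g3)
    · rfl
    · exact absurd heq.symm (key ψ φ g1 hlt h2 h3)

/-- A point of `(0, 1 / 2)` outside a finite set has a ball around it inside the same interval that
avoids the set. Shifting objects spreads the gap to all integer translates. -/
lemma exists_gap {P : Slicing C}
    (h : {φ : ℝ | φ ∈ Set.Ioc 0 (1 / 2) ∧ ∃ c, P.P φ c ∧ ¬ IsZero c}.Finite) :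
    ∃ θ δ : ℝ, 0 < δ ∧ ∀ φ c, P.P φ c → ¬ IsZero c → ∀ k : ℤ, δ ≤ |φ - (θ + k)| := by
  have h1 : (Set.Ioo (0 : ℝ) (1 / 2) \ {φ : ℝ | φ ∈ Set.Ioc 0 (1 / 2) ∧
      ∃ c, P.P φ c ∧ ¬ IsZero c}).Nonempty :=
    ((Set.Ioo_infinite (by norm_num)).sdiff h).nonempty
  obtain ⟨θ, hθ⟩ := h1
  obtain ⟨δ, hδ, hball⟩ := Metric.isOpen_iff.1 (isOpen_Ioo.sdiff h.isClosed) θ hθ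
  refine ⟨θ, δ, hδ, fun φ c hc h0 k => ?_⟩
  by_contra! hlt
  have h2 : φ - k ∈ Metric.ball θ δ := by
    rw [Metric.mem_ball, Real.dist_eq]
    rwa [show φ - k - θ = φ - (θ + k) by ring]
  have h3 := hball h2
  refine h3.2 ⟨⟨h3.1.1, h3.1.2.le⟩, c⟦-k⟧, ?_, fun h => h0 (isZero_of_shift h)⟩
  have := (prop_shift (P := P) φ (-k) c).2 hc
  push_cast at this
  exact this

/-- Passing to `Q` moves extremal phases by less than `δ`, so none of them crosses a point of `θ +
ℤ`. -/
lemma isHeart_of_near {P Q : LFSlicing C} {θ δ : ℝ}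
    (hgap : ∀ φ c, P.1.P φ c → ¬ IsZero c → ∀ k : ℤ, δ ≤ |φ - (θ + k)|)
    (h : edist P Q < ENNReal.ofReal δ) {H : ObjectProperty C} (hH : Q.1.IsHeart θ H) :
    P.1.IsHeart θ H := by
  have hup : ∀ (k : ℤ) c, P.1.up (Set.Ioi (θ + k)) c ↔ Q.1.up (Set.Ioi (θ + k)) c := by
    intro k c
    by_cases h0 : IsZero c
    · exact ⟨fun _ => up_zero h0, fun _ => up_zero h0⟩
    obtain ⟨s, -, hs, hs0, -⟩ := P.1.exists_prop_phiMinus h0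
    have h1 := hgap _ s hs hs0 k
    have h2 := abs_lt.1 (LFSlicing.abs_phi_sub_lt h h0).1
    rw [up_iff_phiMinus (isUpperSet_Ioi _) h0, up_iff_phiMinus (isUpperSet_Ioi _) h0,
      Set.mem_Ioi, Set.mem_Ioi]
    rcases le_abs'.1 h1 with h3 | h3
    · constructor <;> intro h4 <;> linarith
    · constructor <;> intro h4 <;> linarith
  exact IsHeart.congr_up hup hH

end Slicing

variable {nrm : Seminorm ℝ (ℝ ⊗[ℤ] K0 C)} {S : Set (SlicingCharge C)}

lemma exists_simples_of_massless (hS : IsStabComponent nrm S) (hfin : IsFiniteType S)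
    {σ : SlicingCharge C} (hσ : σ.IsLaxPreStability) (hcl : σ ∈ closure S) :
    ∃ τ ∈ S, ∃ I : Set τ.slicing.Heart, I.Finite ∧ (∀ s ∈ I, Simple s) ∧
      σ.massless = triangulatedClosure (fun X => ∃ s ∈ I, s.obj = X) := by
  -- Two approximations are needed: `τ₀` at the fixed distance `1 / 4` produces the gap, and `τ` is
  -- then chosen closer than its width, so that the hearts agree.
  obtain ⟨τ₀, hτ₀, h₀⟩ := exists_edist_lt_of_mem_closure hcl (ε := 1 / 4) (by norm_num)
  have hτ₁ := hS.rotate_mem hτ₀ (-(1 / 4))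
  have hH₁ : τ₀.slicing.IsHeart (-(1 / 4)) ((τ₀.rotate (-(1 / 4))).slicing.interval (Set.Ioc 0 1)) := by
    have h1 := (τ₀.rotate (-(1 / 4))).slicing.isHeart_interval 0
    rw [zero_add] at h1
    simpa using Slicing.isHeart_rotate.1 h1
  obtain ⟨θ, δ, hδ, hgap⟩ := Slicing.exists_gap
    (Slicing.finite_phases le_rfl h₀ hH₁ (hfin _ hτ₁).2)
  obtain ⟨τ, hτ, h⟩ := exists_edist_lt_of_mem_closure hcl hδ
  have hτθ := hS.rotate_mem hτ θ
  have hH : σ.slicing.IsHeart θ ((τ.rotate θ).slicing.interval (Set.Ioc 0 1)) := by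
    refine Slicing.isHeart_of_near hgap h ?_
    have h1 := (τ.rotate θ).slicing.isHeart_interval 0
    rw [zero_add] at h1
    simpa using Slicing.isHeart_rotate.1 h1
  have hθ : σ.slicing.NoPhaseAt θ := by
    rintro φ c hc h0 k rfl
    have := hgap _ c hc h0 k
    rw [sub_self, abs_zero] at this
    linarith
  obtain ⟨hlen, R, hR, hRs⟩ := (hfin _ hτθ).1
  -- Passing to the representatives in `R` makes the set of massless simple objects finite without
  -- changing the closure.
  refine ⟨_, hτθ, {Y ∈ R | Simple Y ∧ σ.Z Y.obj = 0}, hR.subset (Set.sep_subset _ _),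
    fun s hs => hs.2.1, ?_⟩
  rw [massless_eq_triangulatedClosure hσ hH hlen hθ]
  refine triangulatedClosure_congr ?_ ?_
  · rintro x ⟨⟨hx, hx'⟩, hZ⟩
    obtain ⟨Y, hY, ⟨e⟩⟩ := hRs _ hx'
    refine ⟨Y.obj, ⟨Y, ⟨hY, Simple.of_iso e.symm, ?_⟩, rfl⟩, ⟨(ObjectProperty.ι _).mapIso e⟩⟩
    have h1 : K0.of x = K0.of Y.obj := K0.of_iso ((ObjectProperty.ι _).mapIso e)
    rw [SlicingCharge.Z, ← h1]
    exact hZ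
  · rintro x ⟨Y, ⟨hY, hY', hZ⟩, rfl⟩
    exact ⟨⟨Y.property, hY'⟩, hZ⟩

end Forward

/-! ### The effect of `x + i y ↦ u x + i y` on phases. -/

section Squeeze

open Real

/-- The map on phases induced by the linear map `x + i y ↦ u x + i y` of the plane, cut off near
the integers. -/
noncomputable def squeeze (B u x : ℝ) : ℝ :=
  ⌊x⌋ + (1 / 2 - arctan (u * tan (max (-B) (min B (π * (1 / 2 - Int.fract x))))) / π)

variable {B : ℝ}

lemma squeeze_add_one (u x : ℝ) : squeeze B u (x + 1) = squeeze B u x + 1 := by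
  simp only [squeeze, Int.floor_add_one, Int.fract_add_one]
  push_cast
  ring

lemma abs_max_neg_min_le (hB : 0 < B) (y : ℝ) : |max (-B) (min B y)| ≤ B :=
  abs_le.2 ⟨le_max_left _ _, max_le (by linarith) (min_le_left _ _)⟩

lemma abs_tan_le (hB' : B < π / 2) {β : ℝ} (h : |β| ≤ B) : |tan β| ≤ tan B := by
  have h1 := abs_le.1 h
  have h2 : ∀ {x y : ℝ}, -B ≤ x → x ≤ y → y ≤ B → tan x ≤ tan y := fun hx hxy hy =>
    strictMonoOn_tan.monotoneOn ⟨by linarith, by linarith⟩ ⟨by linarith, by linarith⟩ hxy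
  have h3 : tan (-B) ≤ tan β := h2 le_rfl h1.1 h1.2
  rw [tan_neg] at h3
  exact abs_le.2 ⟨h3, h2 h1.1 h1.2 le_rfl⟩

lemma abs_arctan_mul_tan_le (hB : 0 < B) (hB' : B < π / 2) {u : ℝ} (hu : u ∈ Set.Icc (0 : ℝ) 1)
    {β : ℝ} (h : |β| ≤ B) : |arctan (u * tan β)| ≤ B := by
  have h1 : |u * tan β| ≤ tan B := by
    rw [abs_mul, abs_of_nonneg hu.1]
    exact (mul_le_of_le_one_left (abs_nonneg _) hu.2).trans (abs_tan_le hB' h)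
  have h2 := abs_le.1 h1
  have h3 : arctan (tan B) = B := arctan_tan (by linarith) hB'
  refine abs_le.2 ⟨?_, ?_⟩
  · rw [← h3, ← arctan_neg]
    exact arctan_mono h2.1
  · rw [← h3]
    exact arctan_mono h2.2

/-- Since `B / π < 1 / 2`, squeezing keeps each phase strictly inside its unit interval. This gives
monotonicity across integers and the invariance of the heart. -/
lemma abs_squeeze_sub_le (hB : 0 < B) (hB' : B < π / 2) {u : ℝ} (hu : u ∈ Set.Icc (0 : ℝ) 1)
    (x : ℝ) : |squeeze B u x - (⌊x⌋ + 1 / 2)| ≤ B / π := by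
  rw [squeeze, show ∀ a b c : ℝ, a + (b - c) - (a + b) = -c by intros; ring, abs_neg, abs_div,
    abs_of_pos pi_pos]
  exact div_le_div_of_nonneg_right
    (abs_arctan_mul_tan_le hB hB' hu (abs_max_neg_min_le hB _)) pi_pos.le

lemma monotone_squeeze (hB : 0 < B) (hB' : B < π / 2) {u : ℝ} (hu : u ∈ Set.Icc (0 : ℝ) 1) :
    Monotone (squeeze B u) := by
  intro x y hxy
  rcases (Int.floor_mono hxy).eq_or_lt with h | h
  · have h1 : Int.fract x ≤ Int.fract y := by
      rw [Int.fract, Int.fract, h]; linarith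
    simp only [squeeze, h]
    have h2 : π * (1 / 2 - Int.fract y) ≤ π * (1 / 2 - Int.fract x) :=
      mul_le_mul_of_nonneg_left (by linarith) pi_pos.le
    have h3 := max_le_max_left (-B) (min_le_min_left B h2)
    have g1 := abs_le.1 (abs_max_neg_min_le hB (π * (1 / 2 - Int.fract y)))
    have g2 := abs_le.1 (abs_max_neg_min_le hB (π * (1 / 2 - Int.fract x)))
    have h4 := strictMonoOn_tan.monotoneOn ⟨by linarith, by linarith⟩
      ⟨by linarith, by linarith⟩ h3
    have h5 := div_le_div_of_nonneg_right (arctan_mono (mul_le_mul_of_nonneg_left h4 hu.1))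
      pi_pos.le
    linarith
  · have h1 := abs_le.1 (abs_squeeze_sub_le hB hB' hu x)
    have h2 := abs_le.1 (abs_squeeze_sub_le hB hB' hu y)
    have h3 : (⌊x⌋ : ℝ) + 1 ≤ ⌊y⌋ := by exact_mod_cast h
    have h4 : B / π < 1 / 2 := by
      rw [div_lt_iff₀ pi_pos]; linarith
    linarith

lemma abs_arctan_sub_le (x y : ℝ) : |arctan x - arctan y| ≤ |x - y| := by
  have h : ∀ z : ℝ, ‖deriv arctan z‖₊ ≤ 1 := fun z => by
    rw [← NNReal.coe_le_coe, coe_nnnorm, Real.deriv_arctan, norm_eq_abs, NNReal.coe_one,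
      abs_of_nonneg (by positivity), div_le_one (by positivity)]
    nlinarith [sq_nonneg z]
  have := (lipschitzWith_of_nnnorm_deriv_le differentiable_arctan h).dist_le_mul x y
  simpa [dist_eq] using this

/-- `arctan` is `1`-Lipschitz and the cut-off bounds the tangent by `tan B`, so the estimate is
uniform in the phase. This is why phases are first kept away from the integers. -/
lemma abs_squeeze_sub_squeeze_le (hB : 0 < B) (hB' : B < π / 2) (u v x : ℝ) :
    |squeeze B u x - squeeze B v x| ≤ tan B * |u - v| := by
  set β := max (-B) (min B (π * (1 / 2 - Int.fract x))) with hβ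
  have h1 := abs_tan_le hB' (abs_max_neg_min_le hB (π * (1 / 2 - Int.fract x)))
  have h2 := abs_arctan_sub_le (v * tan β) (u * tan β)
  rw [squeeze, squeeze, ← hβ, show ∀ a b c d : ℝ, a + (b - c / π) - (a + (b - d / π)) =
    (d - c) / π by intros; ring, abs_div, abs_of_pos pi_pos, div_le_iff₀ pi_pos]
  rw [← sub_mul, abs_mul, abs_sub_comm v u] at h2
  have h3 : |u - v| * |tan β| ≤ tan B * |u - v| := by
    rw [mul_comm]
    exact mul_le_mul_of_nonneg_right h1 (abs_nonneg _)
  have h4 : 0 ≤ tan B * |u - v| := mul_nonneg ((abs_nonneg _).trans h1) (abs_nonneg _)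
  nlinarith [pi_gt_three]

lemma max_neg_min_eq_self {β : ℝ} (h : |β| ≤ B) : max (-B) (min B β) = β := by
  have := abs_le.1 h
  rw [min_eq_right this.2, max_eq_right this.1]

lemma squeeze_one (hB' : B < π / 2) {x : ℝ} (hx : |π * (1 / 2 - Int.fract x)| ≤ B) :
    squeeze B 1 x = x := by
  have := abs_le.1 hx
  rw [squeeze, max_neg_min_eq_self hx, one_mul, arctan_tan (by linarith) (by linarith),
    mul_div_cancel_left₀ _ pi_pos.ne']
  have := Int.floor_add_fract x
  linarith

lemma squeeze_zero (x : ℝ) : squeeze B 0 x = ⌊x⌋ + 1 / 2 := by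
  simp [squeeze]

/-- The linear map `x + i y ↦ u x + i y` on a ray. -/
lemma exists_squeeze_polar (hB' : B < π / 2) (u : ℝ) {x : ℝ}
    (hx : |π * (1 / 2 - Int.fract x)| ≤ B) :
    ∃ r : ℝ, 0 ≤ r ∧ u * cos (π * x) = r * cos (π * squeeze B u x) ∧
      sin (π * x) = r * sin (π * squeeze B u x) := by
  have hβ' := abs_le.1 hx
  set β := π * (1 / 2 - Int.fract x) with hβ
  set α := arctan (u * tan β) with hα
  have h1 : π * x = ⌊x⌋ * π + (π / 2 - β) := by
    have := Int.floor_add_fract x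
    rw [hβ]
    nth_rw 1 [← this]
    ring
  have h2 : π * squeeze B u x = ⌊x⌋ * π + (π / 2 - α) := by
    rw [squeeze, ← hβ, max_neg_min_eq_self hx, ← hα]
    field_simp
  have hc : 0 < cos α := cos_arctan_pos _
  have hcb : 0 < cos β := cos_pos_of_mem_Ioo ⟨by linarith, by linarith⟩
  have ht : tan α = u * tan β := tan_arctan _
  rw [tan_eq_sin_div_cos, tan_eq_sin_div_cos] at ht
  have hs : sin α = u * (sin β / cos β) * cos α := by
    rw [← ht, div_mul_cancel₀ _ hc.ne']
  -- `β` and `α` are the angles from the imaginary axis before and after squeezing. The imaginary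
  -- part is preserved, which fixes the ratio of the moduli.
  refine ⟨cos β / cos α, by positivity, ?_, ?_⟩
  · rw [h1, h2, add_comm, add_comm (_ * π), cos_add_int_mul_pi, cos_add_int_mul_pi,
      cos_pi_div_two_sub, cos_pi_div_two_sub, hs]
    field_simp
  · rw [h1, h2, add_comm, add_comm (_ * π), sin_add_int_mul_pi, sin_add_int_mul_pi,
      sin_pi_div_two_sub, sin_pi_div_two_sub]
    field_simp

end Squeeze

/-! ### Criteria for stability in terms of the simple objects of a heart. -/

section Backward

variable {C : Type u} [Category.{v} C] [HasZeroObject C] [HasShift C ℤ] [Preadditive C]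
  [∀ n : ℤ, (shiftFunctor C n).Additive] [Pretriangulated C] [IsTriangulated C]

namespace Slicing

variable {P : Slicing C} {H : ObjectProperty C}

lemma up_congr_of_phases {U V : Set ℝ} (hU : IsUpperSet U) (hV : IsUpperSet V)
    (h : ∀ φ c, P.P φ c → ¬ IsZero c → (φ ∈ U ↔ φ ∈ V)) {c : C} : P.up U c ↔ P.up V c := by
  obtain ⟨l, hl⟩ := P.exists_isHN c
  rw [hl.up_iff hU, hl.up_iff hV]
  exact forall₂_congr fun p hp => h p.1 p.2 (hl.mem p hp) (hl.ne_zero p hp)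

lemma map_eq_self {f : ℝ → ℝ} (hf : Monotone f) (hf1 : ∀ x, f (x + 1) = f x + 1)
    (h : ∀ φ c, P.P φ c → ¬ IsZero c → f φ = φ) : P.map f hf hf1 = P := by
  refine ext_prop fun φ c => ?_
  obtain ⟨l, hl⟩ := P.exists_isHN c
  rw [prop_iff_of_isHN hl]
  refine (mapProp_iff hf hl).trans (forall₂_congr fun p hp => ?_)
  rw [h p.1 p.2 (hl.mem p hp) (hl.ne_zero p hp)]

lemma exists_phase_of_map {f : ℝ → ℝ} (hf : Monotone f) (hf1 : ∀ x, f (x + 1) = f x + 1) {φ : ℝ}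
    {c : C} (hc : (P.map f hf hf1).P φ c) (h0 : ¬ IsZero c) :
    ∃ ψ s, P.P ψ s ∧ ¬ IsZero s ∧ f ψ = φ := by
  obtain ⟨s, -, hs, hs0, -⟩ := P.exists_prop_phiMinus h0
  exact ⟨_, s, hs, hs0, by rw [← phiMinus_map hf hf1 h0, (phi_of_prop hc h0).1]⟩

/-- The simple objects of an algebraic heart are bounded away from the lower end of the heart. -/
lemma exists_up_of_algebraic (hH : P.IsHeart 0 H) (hal : IsAlgebraic H.FullSubcategory) :
    ∃ δ : ℝ, 0 < δ ∧ δ < 1 ∧ ∀ c, H c → P.up (Set.Ioi δ) c := by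
  obtain ⟨hlen, R, hR, hRs⟩ := hal
  have h1 : ∃ δ : ℝ, 0 < δ ∧ ∀ Y ∈ R, ¬ IsZero Y.obj → δ < P.phiMinus Y.obj := by
    clear hRs
    induction R, hR using Set.Finite.induction_on with
    | empty => exact ⟨1, one_pos, by simp⟩
    | @insert Y R _ _ ih =>
      obtain ⟨δ, hδ, h⟩ := ih
      by_cases h0 : IsZero Y.obj
      · refine ⟨δ, hδ, fun Z hZ hZ0 => ?_⟩
        rcases Set.mem_insert_iff.1 hZ with rfl | hZ
        exacts [absurd h0 hZ0, h Z hZ hZ0]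
      · have h2 : 0 < P.phiMinus Y.obj :=
          (up_iff_phiMinus (isUpperSet_Ioi _) h0).1 ((hH _).1 Y.property).1
        refine ⟨min δ (P.phiMinus Y.obj / 2), by positivity, fun Z hZ hZ0 => ?_⟩
        rcases Set.mem_insert_iff.1 hZ with rfl | hZ
        · exact (min_le_right _ _).trans_lt (by linarith)
        · exact (min_le_left _ _).trans_lt (h Z hZ hZ0)
  obtain ⟨δ, hδ, h⟩ := h1
  refine ⟨min δ (1 / 2), by positivity, (min_le_right _ _).trans_lt (by norm_num), fun c hc => ?_⟩
  obtain ⟨l, hl, hlc⟩ := hH.exists_composition hlen hc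
  refine hlc.prop _ (fun _ => up_zero) (fun _ _ _ => up_ext) fun s hs => ?_
  obtain ⟨hs1, hs2⟩ := hl s hs
  obtain ⟨Y, hY, ⟨e⟩⟩ := hRs _ hs2
  refine up_iso (H.ι.mapIso e.symm) (?_ : P.up _ Y.obj)
  by_cases h0 : IsZero Y.obj
  · exact up_zero h0
  · exact (up_iff_phiMinus (isUpperSet_Ioi _) h0).2 ((min_le_left _ _).trans_lt (h Y hY h0))

lemma exists_bound_simples (hal : IsAlgebraic H.FullSubcategory) (g : C → ℝ)
    (hg : ∀ s t, Nonempty (s ≅ t) → g s = g t) :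
    ∃ K : ℝ, 0 < K ∧ ∀ s, IsSimpleIn H s → g s ≤ K := by
  obtain ⟨-, R, hR, hRs⟩ := hal
  obtain ⟨K, hK⟩ := (hR.image fun Y => g Y.obj).bddAbove
  refine ⟨max K 1, by positivity, fun s ⟨hs, hs'⟩ => ?_⟩
  obtain ⟨Y, hY, ⟨e⟩⟩ := hRs _ hs'
  rw [hg s Y.obj ⟨H.ι.mapIso e⟩]
  exact (hK ⟨Y, hY, rfl⟩).trans (le_max_left _ _)

end Slicing

lemma seminorm_shift (nrm : Seminorm ℝ (ℝ ⊗[ℤ] K0 C)) (c : C) (n : ℤ) :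
    nrm (1 ⊗ₜ K0.of (c⟦n⟧)) = nrm (1 ⊗ₜ K0.of c) := by
  rw [K0.of_shift]
  rcases Int.even_or_odd n with hn | hn
  · rw [Int.negOnePow_even n hn, one_smul]
  · rw [Int.negOnePow_odd n hn, Units.neg_smul, one_smul, TensorProduct.tmul_neg, map_neg_eq_map]

lemma norm_Z_shift (σ : SlicingCharge C) (c : C) (n : ℤ) : ‖σ.Z (c⟦n⟧)‖ = ‖σ.Z c‖ := by
  rw [SlicingCharge.Z, SlicingCharge.Z, K0.of_shift]
  rcases Int.even_or_odd n with hn | hn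
  · rw [Int.negOnePow_even n hn, one_smul]
  · rw [Int.negOnePow_odd n hn, Units.neg_smul, one_smul, map_neg, norm_neg]

variable {H : ObjectProperty C}

/-- A lax pre-stability condition whose charge maps the simple objects of an algebraic heart to
the open upper half plane is a stability condition. -/
lemma isStability_of_heart (nrm : Seminorm ℝ (ℝ ⊗[ℤ] K0 C)) {σ : SlicingCharge C}
    (hσ : σ.IsLaxPreStability) (hH : σ.slicing.IsHeart 0 H) (hal : IsAlgebraic H.FullSubcategory)
    (hpos : ∀ s, Slicing.IsSimpleIn H s → 0 < (σ.Z s).im) : σ.IsStability nrm := by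
  obtain ⟨K, hK, hKs⟩ := Slicing.exists_bound_simples hal
    (fun s => nrm (1 ⊗ₜ K0.of s) / (σ.Z s).im) (fun s t ⟨e⟩ => by
      simp only [SlicingCharge.Z, K0.of_iso e])
  -- The constant `K` works on simple objects and passes to the whole heart, since `nrm` is
  -- subadditive and the imaginary part additive along a composition series.
  have him : ∀ c, H c → nrm (1 ⊗ₜ K0.of c) ≤ K * (σ.Z c).im ∧ (¬ IsZero c → 0 < (σ.Z c).im) := by
    intro c hc
    obtain ⟨l, hl, hlc⟩ := hH.exists_composition hal.1 hc
    clear hc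
    induction l generalizing c with
    | nil =>
      refine ⟨?_, fun h => absurd hlc.isZero h⟩
      rw [SlicingCharge.Z, K0.of_isZero hlc.isZero]
      simp
    | cons s l ih =>
      obtain ⟨b, hb, hlb⟩ := isFilt_cons_iff.1 hlc
      obtain ⟨h1, h2⟩ := ih b (fun t ht => hl t (List.mem_cons_of_mem _ ht)) hlb
      have hs := hl s List.mem_cons_self
      have h3 := hpos s hs
      have h4 := hKs s hs
      rw [div_le_iff₀ h3] at h4
      have h5 : σ.Z c = σ.Z b + σ.Z s := by
        rw [SlicingCharge.Z, hb.K0_of, map_add]; rfl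
      have h6 : 0 ≤ (σ.Z b).im := by
        by_cases h0 : IsZero b
        · rw [SlicingCharge.Z, K0.of_isZero h0]; simp
        · exact (h2 h0).le
      rw [h5, Complex.add_im]
      refine ⟨?_, fun _ => by linarith⟩
      rw [hb.K0_of, TensorProduct.tmul_add, mul_add]
      exact (map_add_le_add nrm _ _).trans (add_le_add h1 h4)
  refine ⟨fun φ c hc h0 => ?_, K, hK, fun φ c hc => ?_⟩
  · obtain ⟨m, hm, hZ⟩ := hσ φ c hc h0
    refine ⟨m, lt_of_le_of_ne hm ?_, hZ⟩
    rintro rfl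
    obtain ⟨k, hk, -, -⟩ := hH.exists_shift_mem hc
    have h1 := (him _ hk).2 fun h => h0 (isZero_of_shift h)
    have h2 : σ.Z (c⟦-k⟧) = 0 := (SlicingCharge.Z_shift_eq_zero _).2 (by rw [hZ]; simp)
    rw [h2] at h1
    exact lt_irrefl _ h1
  · obtain ⟨k, hk, -, -⟩ := hH.exists_shift_mem hc
    have h1 := (him _ hk).1
    rw [seminorm_shift] at h1
    rw [one_div, inv_mul_le_iff₀ hK, ← norm_Z_shift σ c (-k)]
    exact h1.trans (mul_le_mul_of_nonneg_left ((le_abs_self _).trans (Complex.abs_im_le_norm _))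
      hK.le)

/-- Compatibility of a charge with a relabelled slicing. -/
lemma isLaxPreStability_map {P : Slicing C} {f : ℝ → ℝ} (hf : Monotone f)
    (hf1 : ∀ x, f (x + 1) = f x + 1) {σ : SlicingCharge C} (hσ : σ.slicing = P.map f hf hf1)
    (h : ∀ φ c, P.P φ c → ¬ IsZero c →
      ∃ m : ℝ, 0 ≤ m ∧ σ.Z c = m * Complex.exp (Complex.I * Real.pi * f φ)) :
    σ.IsLaxPreStability := by
  intro φ c hc h0
  rw [hσ] at hc
  obtain ⟨l, hl⟩ := P.exists_isHN c
  have h1 := (Slicing.mapProp_iff hf hl).1 hc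
  refine hl.filt.prop (fun c => ∃ m : ℝ, 0 ≤ m ∧ σ.Z c = m * Complex.exp (Complex.I * Real.pi * φ))
    (fun x hx => ⟨0, le_rfl, ?_⟩) ?_ fun a ha => ?_
  · rw [SlicingCharge.Z, K0.of_isZero hx]
    simp
  · rintro a b c habc ⟨m, hm, ha⟩ ⟨m', hm', hc⟩
    refine ⟨m + m', add_nonneg hm hm', ?_⟩
    rw [SlicingCharge.Z, habc.K0_of, map_add]
    push_cast
    rw [add_mul, ← ha, ← hc]
    rfl
  · obtain ⟨p, hp, rfl⟩ := List.mem_map.1 ha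
    rw [← h1 p hp]
    exact h _ _ (hl.mem p hp) (hl.ne_zero p hp)

end Backward

/-! ### Squeezing a slicing until all phases are half-integral. -/

section Collapse

variable {C : Type u} [Category.{v} C] [HasZeroObject C] [HasShift C ℤ] [Preadditive C]
  [∀ n : ℤ, (shiftFunctor C n).Additive] [Pretriangulated C] [IsTriangulated C]

lemma exp_I_mul_pi_mul (x : ℝ) : Complex.exp (Complex.I * Real.pi * x) =
    (Real.cos (Real.pi * x) : ℂ) + (Real.sin (Real.pi * x) : ℂ) * Complex.I := by
  rw [show Complex.I * Real.pi * x = ((Real.pi * x : ℝ) : ℂ) * Complex.I by push_cast; ring,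
    Complex.exp_mul_I, Complex.ofReal_cos, Complex.ofReal_sin]

lemma re_im_ofReal_mul_exp (m x : ℝ) :
    ((m : ℂ) * Complex.exp (Complex.I * Real.pi * x)).re = m * Real.cos (Real.pi * x) ∧
    ((m : ℂ) * Complex.exp (Complex.I * Real.pi * x)).im = m * Real.sin (Real.pi * x) := by
  rw [Complex.re_ofReal_mul, Complex.im_ofReal_mul, exp_I_mul_pi_mul, Complex.add_re,
    Complex.add_im, Complex.re_ofReal_mul, Complex.im_ofReal_mul, Complex.ofReal_re,
    Complex.ofReal_im, Complex.I_re, Complex.I_im, mul_zero, mul_one, add_zero, zero_add]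
  exact ⟨rfl, rfl⟩

/-- The charge with the given real and imaginary parts. -/
noncomputable def mkCharge (a b : K0 C →+ ℝ) : Charge C :=
  AddMonoidHom.mk' (fun x => (a x : ℂ) + (b x : ℂ) * Complex.I) fun x y => by
    simp only [map_add]
    push_cast
    ring

lemma mkCharge_apply (a b : K0 C →+ ℝ) (x : K0 C) :
    mkCharge a b x = (a x : ℂ) + (b x : ℂ) * Complex.I := rfl

namespace Slicing

variable {P Q : Slicing C} {H : ObjectProperty C} {B : ℝ}

/-- All phases of the slicing are away from the integers, in terms of the parameter of
`LaxStab.squeeze`. -/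
def PhasesIn (P : Slicing C) (B : ℝ) : Prop :=
  ∀ φ c, P.P φ c → ¬ IsZero c → |Real.pi * (1 / 2 - Int.fract φ)| ≤ B

lemma PhasesIn.fract_pos (hP : P.PhasesIn B) (hB' : B < Real.pi / 2) {φ : ℝ} {c : C}
    (hc : P.P φ c) (h0 : ¬ IsZero c) : ⌊φ⌋ < φ := by
  have h1 := abs_le.1 (hP φ c hc h0)
  have h2 : Real.pi * (1 / 2 - Int.fract φ) < Real.pi * (1 / 2) := by linarith
  have h3 := lt_of_mul_lt_mul_left h2 Real.pi_pos.le
  have h4 := Int.floor_add_fract φ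
  linarith

lemma phasesIn_of_gap {δ : ℝ} (h : ∀ φ c, P.P φ c → ¬ IsZero c → ∀ k : ℤ, δ ≤ |φ - k|) :
    P.PhasesIn (Real.pi * (1 / 2 - δ)) := by
  intro φ c hc h0
  have h1 := h φ c hc h0 ⌊φ⌋
  have h2 := h φ c hc h0 (⌊φ⌋ + 1)
  have h3 := Int.floor_add_fract φ
  have h4 := Int.fract_nonneg φ
  have h5 := Int.fract_lt_one φ
  rw [show φ - ⌊φ⌋ = Int.fract φ by linarith, abs_of_nonneg h4] at h1
  push_cast at h2
  rw [show φ - (⌊φ⌋ + 1) = -(1 - Int.fract φ) by linarith, abs_neg, abs_of_pos (by linarith)] at h2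
  rw [abs_mul, abs_of_pos Real.pi_pos]
  refine mul_le_mul_of_nonneg_left (abs_le.2 ⟨?_, ?_⟩) Real.pi_pos.le <;> linarith

/-- The deformation of the phases along `x + i y ↦ u x + i y`. -/
noncomputable def squeeze (P : Slicing C) (hB : 0 < B) (hB' : B < Real.pi / 2)
    (u : unitInterval) : Slicing C :=
  P.map (LaxStab.squeeze B u) (monotone_squeeze hB hB' u.2) (squeeze_add_one _)

variable (hB : 0 < B) (hB' : B < Real.pi / 2)

/-- Squeezing preserves the integer part of every occurring phase, and no occurring phase is an
integer before or after. -/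
lemma isHeart_squeeze (hP : P.PhasesIn B) (hH : P.IsHeart 0 H) (u : unitInterval) :
    (P.squeeze hB hB' u).IsHeart 0 H := by
  refine IsHeart.congr_up (fun k c => ?_) hH
  have hm := monotone_squeeze hB hB' u.2
  rw [squeeze, up_map _ _ (isUpperSet_Ioi _)]
  refine up_congr_of_phases ((isUpperSet_Ioi _).preimage hm) (isUpperSet_Ioi _)
    fun φ c hc h0 => ?_
  have h1 := hP.fract_pos hB' hc h0
  have h2 := abs_le.1 (abs_squeeze_sub_le hB hB' u.2 φ)
  have h3 : B / Real.pi < 1 / 2 := by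
    rw [div_lt_iff₀ Real.pi_pos]; linarith
  have h4 := Int.lt_floor_add_one φ
  simp only [Set.mem_preimage, Set.mem_Ioi, zero_add]
  rcases le_or_gt k ⌊φ⌋ with h | h
  · have h5 : (k : ℝ) ≤ ⌊φ⌋ := by exact_mod_cast h
    exact ⟨fun _ => by linarith, fun _ => by linarith⟩
  · have h5 : (⌊φ⌋ : ℝ) + 1 ≤ k := by exact_mod_cast h
    exact ⟨fun _ => by linarith, fun _ => by linarith⟩

lemma isLocallyFinite_squeeze (hP : P.PhasesIn B) (hH : P.IsHeart 0 H)
    (hlen : ∀ X : H.FullSubcategory, IsArtinianObject X ∧ IsNoetherianObject X)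
    (u : unitInterval) : (P.squeeze hB hB' u).IsLocallyFinite := by
  have h3 : B / Real.pi < 1 / 2 := by
    rw [div_lt_iff₀ Real.pi_pos]; linarith
  refine isLocallyFinite_of_gap (isHeart_squeeze hB hB' hP hH u) hlen
    (δ := 1 / 2 - B / Real.pi) (by linarith) fun φ c hc h0 k => ?_
  obtain ⟨ψ, s, -, -, rfl⟩ := exists_phase_of_map _ _ hc h0
  have h2 := abs_le.1 (abs_squeeze_sub_le hB hB' u.2 ψ)
  rw [zero_add, le_abs']
  rcases le_or_gt k ⌊ψ⌋ with h | h
  · have h5 : (k : ℝ) ≤ ⌊ψ⌋ := by exact_mod_cast h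
    right; linarith
  · have h5 : (⌊ψ⌋ : ℝ) + 1 ≤ k := by exact_mod_cast h
    left; linarith

lemma squeeze_one_eq (hP : P.PhasesIn B) : P.squeeze hB hB' 1 = P :=
  map_eq_self _ _ fun φ c hc h0 => squeeze_one hB' (hP φ c hc h0)

lemma edist_squeeze_le (u v : unitInterval) {c : C} (hc : ¬ IsZero c) :
    edist ((P.squeeze hB hB' u).phiMinus c) ((P.squeeze hB hB' v).phiMinus c) ≤
      (Real.tan B).toNNReal * edist u v ∧
    edist ((P.squeeze hB hB' u).phiPlus c) ((P.squeeze hB hB' v).phiPlus c) ≤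
      (Real.tan B).toNNReal * edist u v := by
  have h : ∀ x, edist (LaxStab.squeeze B u x) (LaxStab.squeeze B v x) ≤
      (Real.tan B).toNNReal * edist u v := fun x => by
    rw [edist_dist, edist_dist, Real.dist_eq, Subtype.dist_eq, Real.dist_eq]
    change _ ≤ ENNReal.ofReal (Real.tan B) * _
    rw [← ENNReal.ofReal_mul (Real.tan_nonneg_of_nonneg_of_le_pi_div_two hB.le hB'.le)]
    exact ENNReal.ofReal_le_ofReal (abs_squeeze_sub_squeeze_le hB hB' _ _ _)
  rw [squeeze, squeeze, phiMinus_map _ _ hc, phiMinus_map _ _ hc, phiPlus_map _ _ hc,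
    phiPlus_map _ _ hc]
  exact ⟨h _, h _⟩

/-- All phases are in `1 / 2 + ℤ`. -/
def HalfIntegral (Q : Slicing C) : Prop :=
  ∀ φ c, Q.P φ c → ¬ IsZero c → ∃ k : ℤ, φ = k + 1 / 2

lemma halfIntegral_squeeze : (P.squeeze hB hB' 0).HalfIntegral := by
  intro φ c hc h0
  obtain ⟨ψ, s, -, -, rfl⟩ := exists_phase_of_map _ _ hc h0
  exact ⟨⌊ψ⌋, squeeze_zero ψ⟩

lemma HalfIntegral.noPhaseAt (hQ : Q.HalfIntegral) : Q.NoPhaseAt 0 := by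
  intro φ c hc h0 k h
  obtain ⟨j, hj⟩ := hQ φ c hc h0
  have h1 : (2 * j + 1 : ℝ) = 2 * k := by linarith
  have h2 : 2 * j + 1 = 2 * k := by exact_mod_cast h1
  omega

/-- The only half-integral phase in `(0, 1]` is `1 / 2`, so the heart is a single slice. -/
lemma HalfIntegral.prop_of_heart (hQ : Q.HalfIntegral) (hH : Q.IsHeart 0 H) {c : C} (hc : H c)
    (k : ℤ) : Q.P (1 / 2 + k) (c⟦k⟧) := by
  rw [prop_shift]
  obtain ⟨l, hl⟩ := Q.exists_isHN c
  rw [prop_iff_of_isHN hl]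
  intro p hp
  obtain ⟨j, hj⟩ := hQ _ _ (hl.mem p hp) (hl.ne_zero p hp)
  have h1 := (hl.up_iff (isUpperSet_Ioi _)).1 ((hH c).1 hc).1 p hp
  have h2 := (hl.dn_iff (isUpperSet_Ioi _)).1 ((hH c).1 hc).2 p hp
  rw [hj] at h1 h2 ⊢
  simp only [Set.mem_Ioi, not_lt] at h1 h2
  have h3 : (-1 : ℝ) < j := by linarith
  have h4 : (j : ℝ) < 1 := by linarith
  have h5 : (-1 : ℤ) < j := by exact_mod_cast h3
  have h6 : j < (1 : ℤ) := by exact_mod_cast h4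
  obtain rfl : j = 0 := by omega
  simp

/-- The stable objects of a half-integral slicing are the shifts of the simple objects. -/
lemma HalfIntegral.stable (hQ : Q.HalfIntegral) (hH : Q.IsHeart 0 H)
    (hart : ∀ X : H.FullSubcategory, IsArtinianObject X) {s : C} (hs : Q.IsStable s) :
    ∃ (t : C) (k : ℤ), IsSimpleIn H t ∧ Nonempty (t⟦k⟧ ≅ s) := by
  obtain ⟨φ, hφ, h0, hsimp⟩ := hs
  have h0' : ¬ IsZero s := fun h => h0 (by
    rw [IsZero.iff_id_eq_zero]
    exact ObjectProperty.hom_ext _ (h.eq_of_src _ _))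
  obtain ⟨j, hj⟩ := hQ φ s hφ h0'
  obtain ⟨k, hk, hk1, hk2⟩ := hH.exists_shift_mem hφ
  obtain rfl : k = j := by
    have h1 : (k : ℝ) < j + 1 := by linarith
    have h2 : (j : ℝ) < k + 1 := by linarith
    have h3 : k < j + 1 := by exact_mod_cast h1
    have h4 : j < k + 1 := by exact_mod_cast h2
    omega
  -- A simple subobject `t` of `s⟦-k⟧` and its quotient both shift into the slice of `s`. So `t⟦k⟧ ⟶
  -- s` is a kernel there, and strict simplicity makes it an isomorphism.
  obtain ⟨t, Y, ht, hY, htY⟩ := hH.exists_simple_sub hart hk fun h => h0' (isZero_of_shift h)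
  obtain ⟨f, g, w, hT⟩ := (htY.shift k).of_iso (Iso.refl _) (shiftNegShift s k) (Iso.refl _)
  have hφ' : φ = 1 / 2 + k := by rw [hj, add_comm]
  have ht' : Q.P φ (t⟦k⟧) := hφ' ▸ hQ.prop_of_heart hH ht.1 k
  have hY' : Q.P φ (Y⟦k⟧) := hφ' ▸ hQ.prop_of_heart hH hY k
  have hinj : ∀ x, Q.P φ x → ∀ m : x ⟶ t⟦k⟧, m ≫ f = 0 → m = 0 := fun x hx m hm => by
    obtain ⟨n, hn⟩ := exists_lift_of_distTriang (inv_rot_of_distTriang _ hT) m hm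
    have h1 : Q.P (φ + (-1 : ℤ)) (Y⟦k⟧⟦(-1 : ℤ)⟧) := (prop_shift _ _ _).2 hY'
    rw [hn, Q.hom_eq_zero φ _ x _ n (by push_cast; linarith) hx h1]
    exact zero_comp
  let f' : (⟨t⟦k⟧, ht'⟩ : (Q.P φ).FullSubcategory) ⟶ ⟨s, hφ⟩ := ObjectProperty.homMk f
  let g' : (⟨s, hφ⟩ : (Q.P φ).FullSubcategory) ⟶ ⟨Y⟦k⟧, hY'⟩ := ObjectProperty.homMk g
  have hm : Mono f' := by
    rw [Preadditive.mono_iff_cancel_zero]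
    intro x m hm
    exact ObjectProperty.hom_ext _ (hinj x.obj x.property m.hom (congrArg (fun f => f.hom) hm))
  have hlift : ∀ {x : (Q.P φ).FullSubcategory} (m : x ⟶ ⟨s, hφ⟩), m ≫ g' = 0 →
      ∃ n, n ≫ f' = m := fun m h => by
    obtain ⟨n, hn⟩ := exists_lift_of_distTriang hT m.hom (congrArg (fun f => f.hom) h)
    exact ⟨ObjectProperty.homMk n, ObjectProperty.hom_ext _ hn.symm⟩
  have hN : NormalMono f' :=
    { Z := ⟨Y⟦k⟧, hY'⟩
      g := g'
      w := ObjectProperty.hom_ext _ (comp_distTriang_mor_zero₁₂ _ hT)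
      isLimit := KernelFork.IsLimit.ofι' _ _ fun {A} m h =>
        ⟨(hlift m h).choose, (hlift m h).choose_spec⟩ }
  refine ⟨t, k, ht, ?_⟩
  rcases hsimp _ f' ⟨hN⟩ with h | h
  · refine absurd (isZero_of_shift (n := k) ?_) ht.not_isZero
    rw [IsZero.iff_id_eq_zero] at h ⊢
    exact congrArg (fun f => f.hom) h
  · exact ⟨((Q.P φ).ι.mapIso (asIso f'))⟩

end Slicing

end Collapse

/-! ### Degeneration to a prescribed massless subcategory. -/

section Main

variable {C : Type u} [Category.{v} C] [HasZeroObject C] [HasShift C ℤ] [Preadditive C]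
  [∀ n : ℤ, (shiftFunctor C n).Additive] [Pretriangulated C] [IsTriangulated C]

variable {H : ObjectProperty C} {B : ℝ} {nrm : Seminorm ℝ (ℝ ⊗[ℤ] K0 C)}
  {S : Set (SlicingCharge C)}

/-- After a rotation which does not change the heart, the phases are away from the integers. -/
lemma exists_rotate_phasesIn (hS : IsStabComponent nrm S) {τ : SlicingCharge C} (hτ : τ ∈ S)
    (hH : τ.slicing.IsHeart 0 H) (hal : IsAlgebraic H.FullSubcategory) :
    ∃ τ' ∈ S, ∃ B : ℝ, 0 < B ∧ B < Real.pi / 2 ∧ τ'.slicing.IsHeart 0 H ∧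
      τ'.slicing.PhasesIn B := by
  obtain ⟨δ, hδ, hδ', hup⟩ := Slicing.exists_up_of_algebraic hH hal
  have key : ∀ φ c, τ.slicing.P φ c → ¬ IsZero c → ∃ k : ℤ, k + δ < φ ∧ φ ≤ k + 1 := by
    intro φ c hc h0
    obtain ⟨k, hk, -, hk2⟩ := hH.exists_shift_mem hc
    have h1 := hup _ hk
    rw [Slicing.up_Ioi_shift, Slicing.up_iff_phiMinus (isUpperSet_Ioi _) h0,
      (Slicing.phi_of_prop hc h0).1, Set.mem_Ioi] at h1
    push_cast at h1
    exact ⟨k, by linarith, by linarith⟩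
  -- All phases lie in intervals `(k + δ, k + 1]`. Rotating by `δ / 2` puts them at distance at
  -- least `δ / 2` from the integers on both sides, and `B` encodes this distance.
  refine ⟨_, hS.rotate_mem hτ (δ / 2), Real.pi * (1 / 2 - δ / 2), ?_, ?_, ?_, ?_⟩
  · exact mul_pos Real.pi_pos (by linarith)
  · rw [div_eq_mul_one_div]
    exact mul_lt_mul_of_pos_left (by linarith) Real.pi_pos
  · refine Slicing.isHeart_rotate.2 (Slicing.IsHeart.congr_up (fun k c => ?_) hH)
    refine Slicing.up_congr_of_phases (isUpperSet_Ioi _) (isUpperSet_Ioi _) fun φ c hc h0 => ?_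
    obtain ⟨j, hj1, hj2⟩ := key φ c hc h0
    simp only [Set.mem_Ioi, zero_add]
    rcases le_or_gt k j with h | h
    · have h5 : (k : ℝ) ≤ j := by exact_mod_cast h
      exact ⟨fun _ => by linarith, fun _ => by linarith⟩
    · have h5 : (j : ℝ) + 1 ≤ k := by exact_mod_cast h
      exact ⟨fun _ => by linarith, fun _ => by linarith⟩
  · refine Slicing.phasesIn_of_gap fun φ c hc h0 k => ?_
    obtain ⟨j, hj1, hj2⟩ := key _ c (Slicing.prop_rotate.1 hc) h0
    rw [le_abs']
    rcases le_or_gt k j with h | h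
    · have h5 : (k : ℝ) ≤ j := by exact_mod_cast h
      right; linarith
    · have h5 : (j : ℝ) + 1 ≤ k := by exact_mod_cast h
      left; linarith

lemma im_pos_of_heart {τ : SlicingCharge C} (hτ : τ.IsPreStability)
    (hH : τ.slicing.IsHeart 0 H) (hB' : B < Real.pi / 2) (hP : τ.slicing.PhasesIn B) {c : C}
    (hc : H c) (h0 : ¬ IsZero c) : 0 < (τ.Z c).im := by
  obtain ⟨l, hl⟩ := τ.slicing.exists_isHN c
  have h1 := (hl.up_iff (isUpperSet_Ioi _)).1 ((hH c).1 hc).1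
  have h2 := (hl.dn_iff (isUpperSet_Ioi _)).1 ((hH c).1 hc).2
  have h3 := hl.filt.hom_apply (Complex.imAddGroupHom.comp τ.2)
  change (τ.Z c).im = _ at h3
  rw [h3]
  refine List.sum_pos _ (fun y hy => ?_) ?_
  · rw [List.map_map] at hy
    obtain ⟨p, hp, rfl⟩ := List.mem_map.1 hy
    obtain ⟨m, hm, hZ⟩ := hτ _ _ (hl.mem p hp) (hl.ne_zero p hp)
    change 0 < (τ.Z p.2).im
    have h4 := h1 p hp
    have h5 := h2 p hp
    have h6 := hP.fract_pos hB' (hl.mem p hp) (hl.ne_zero p hp)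
    simp only [Set.mem_Ioi, not_lt, zero_add] at h4 h5
    have h7 : p.1 < 1 := lt_of_le_of_ne h5 fun h => by
      rw [h] at h6
      simp at h6
    rw [hZ, (re_im_ofReal_mul_exp m p.1).2]
    have h8 : 0 < Real.sin (Real.pi * p.1) :=
      Real.sin_pos_of_pos_of_lt_pi (by positivity)
        (by nlinarith [Real.pi_pos])
    exact mul_pos hm h8
  · intro h
    rw [List.map_map, List.map_eq_nil_iff] at h
    rw [h] at hl
    exact h0 hl.filt.isZero

/-- After the collapse, any additive function that is nonnegative on the heart serves as the
imaginary part of a compatible charge: the parity of `k` gives the sign both of the class of a shift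
and of the ray of phase `k + 1 / 2`. -/
lemma exists_nonneg_im_of_additive (lam : K0 C →+ ℝ) {P : Slicing C} (hH : P.IsHeart 0 H)
    (hlam : ∀ c, H c → 0 ≤ lam (K0.of c)) (hB' : B < Real.pi / 2) (hP : P.PhasesIn B) (φ : ℝ) (c : C)
    (hc : P.P φ c) (h0 : ¬ IsZero c) : ∃ m : ℝ, 0 ≤ m ∧
      mkCharge 0 lam (K0.of c) = m * Complex.exp (Complex.I * Real.pi * squeeze B 0 φ) := by
  obtain ⟨k, hk, hk1, hk2⟩ := hH.exists_shift_mem hc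
  refine ⟨_, hlam _ hk, ?_⟩
  have h1 : ⌊φ⌋ = k := by
    have h6 := hP.fract_pos hB' hc h0
    refine Int.floor_eq_iff.2 ⟨by linarith, lt_of_le_of_ne (by linarith) fun h => ?_⟩
    rw [h] at h6
    simp at h6
  rw [squeeze_zero, h1, exp_I_mul_pi_mul, K0.of_shift, mkCharge_apply,
    show Real.pi * ((k : ℝ) + 1 / 2) = Real.pi / 2 + k * Real.pi by ring,
    Real.cos_add_int_mul_pi, Real.sin_add_int_mul_pi, Real.cos_pi_div_two, Real.sin_pi_div_two,
    Int.negOnePow_neg]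
  rcases Int.even_or_odd k with h | h
  · simp [Int.negOnePow_even k h, h.neg_one_zpow]
  · simp [Int.negOnePow_odd k h, h.neg_one_zpow, Units.neg_smul]

/-- The pair with charge scaled in the real direction. -/
noncomputable def squeezePair (τ : SlicingCharge C) (hB : 0 < B) (hB' : B < Real.pi / 2)
    (hlf : ∀ u, (τ.slicing.squeeze hB hB' u).IsLocallyFinite) (u : unitInterval) :
    SlicingCharge C :=
  (⟨τ.slicing.squeeze hB hB' u, hlf u⟩,
    mkCharge ((AddMonoidHom.mulLeft (u : ℝ)).comp (Complex.reAddGroupHom.comp τ.2))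
      (Complex.imAddGroupHom.comp τ.2))

section

variable {τ : SlicingCharge C} {hB : 0 < B} {hB' : B < Real.pi / 2}
  {hlf : ∀ u, (τ.slicing.squeeze hB hB' u).IsLocallyFinite}

lemma continuous_squeezePair : Continuous (squeezePair τ hB hB' hlf) := by
  refine Continuous.prodMk (LFSlicing.continuous_of_lipschitz _ fun s t c hc =>
    Slicing.edist_squeeze_le hB hB' s t hc) (continuous_charge fun x => ?_)
  change Continuous fun t : unitInterval =>
    (((t : ℝ) * (τ.2 x).re : ℝ) : ℂ) + ((τ.2 x).im : ℂ) * Complex.I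
  fun_prop

/-- Imaginary parts do not change along the path, so the simple objects stay in the open upper half
plane, even at `u = 0`. -/
lemma isStability_squeezePair (hτ : τ.IsPreStability) (hH : τ.slicing.IsHeart 0 H)
    (hal : IsAlgebraic H.FullSubcategory) (hP : τ.slicing.PhasesIn B) (u : unitInterval) :
    (squeezePair τ hB hB' hlf u).IsStability nrm := by
  refine isStability_of_heart nrm (isLaxPreStability_map (monotone_squeeze hB hB' u.2)
    (squeeze_add_one _) (σ := squeezePair τ hB hB' hlf u) rfl
    fun φ c hc h0 => ?_)
    (Slicing.isHeart_squeeze hB hB' hP hH u) hal fun s hs => ?_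
  · obtain ⟨m, hm, hZ⟩ := hτ φ c hc h0
    obtain ⟨r, hr, h1, h2⟩ := exists_squeeze_polar hB' u (hP φ c hc h0)
    refine ⟨m * r, mul_nonneg hm.le hr, ?_⟩
    have h3 : (squeezePair τ hB hB' hlf u).Z c =
      (((u : ℝ) * (τ.Z c).re : ℝ) : ℂ) + ((τ.Z c).im : ℂ) * Complex.I := rfl
    have h4 : (τ.Z c).re = m * Real.cos (Real.pi * φ) := by
      rw [hZ, (re_im_ofReal_mul_exp m φ).1]
    have h5 : (τ.Z c).im = m * Real.sin (Real.pi * φ) := by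
      rw [hZ, (re_im_ofReal_mul_exp m φ).2]
    rw [h3, exp_I_mul_pi_mul, h4, h5, mul_left_comm, h1, h2]
    push_cast
    ring
  · have h1 := im_pos_of_heart hτ hH hB' hP hs.1 hs.not_isZero
    have h2 : ((squeezePair τ hB hB' hlf u).Z s).im = (τ.Z s).im := by
      change ((((u : ℝ) * (τ.Z s).re : ℝ) : ℂ) + ((τ.Z s).im : ℂ) * Complex.I).im = _
      simp
    rwa [h2]

lemma squeezePair_one (hP : τ.slicing.PhasesIn B) : squeezePair τ hB hB' hlf 1 = τ := by
  refine Prod.ext (Subtype.ext (Slicing.squeeze_one_eq hB hB' hP)) (AddMonoidHom.ext fun x => ?_)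
  change (((1 : ℝ) * (τ.2 x).re : ℝ) : ℂ) + ((τ.2 x).im : ℂ) * Complex.I = _
  rw [one_mul, Complex.re_add_im]

end

lemma additive_nonneg_of_simples {P : Slicing C} (hH : P.IsHeart 0 H)
    (hal : IsAlgebraic H.FullSubcategory) (lam : K0 C →+ ℝ)
    (h : ∀ s, Slicing.IsSimpleIn H s → 0 ≤ lam (K0.of s)) {c : C} (hc : H c) :
    0 ≤ lam (K0.of c) := by
  obtain ⟨l, hl, hlc⟩ := hH.exists_composition hal.1 hc
  rw [hlc.hom_apply]
  refine List.sum_nonneg fun y hy => ?_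
  obtain ⟨s, hs, rfl⟩ := List.mem_map.1 hy
  exact h s (hl s hs)

/-- The degeneration to a lax stability condition whose massless simple objects are prescribed. -/
lemma exists_lax_of_simples (hS : IsStabComponent nrm S) {τ : SlicingCharge C} (hτ : τ ∈ S)
    (hH : τ.slicing.IsHeart 0 H) (hal : IsAlgebraic H.FullSubcategory) (hB : 0 < B)
    (hB' : B < Real.pi / 2) (hP : τ.slicing.PhasesIn B) (G : ObjectProperty C)
    (hG : ∀ x, G x → Slicing.IsSimpleIn H x) :
    ∃ σ ∈ LaxStabOf nrm S, σ.massless = triangulatedClosure G := by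
  classical
  have hpre := (hS.isStability hτ).1
  have hlf := Slicing.isLocallyFinite_squeeze hB hB' hP hH hal.1
  have hτ₁ : squeezePair τ hB hB' hlf 0 ∈ S :=
    hS.mem_of_continuous continuous_squeezePair
      (isStability_squeezePair hpre hH hal hP) (t₀ := 1) (by rwa [squeezePair_one hP]) 0
  -- The target height has to be constant on isomorphism classes, so it vanishes on all objects
  -- isomorphic to one in `G`.
  obtain ⟨ℓ, hℓ⟩ := hH.exists_hom_K0 hal.1 (fun s => if ∃ y, G y ∧ Nonempty (s ≅ y) then 0 else 1)
    (fun s t _ _ ⟨e⟩ => by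
      have : (∃ y, G y ∧ Nonempty (s ≅ y)) ↔ ∃ y, G y ∧ Nonempty (t ≅ y) :=
        ⟨fun ⟨y, hy, ⟨e'⟩⟩ => ⟨y, hy, ⟨e.symm ≪≫ e'⟩⟩, fun ⟨y, hy, ⟨e'⟩⟩ => ⟨y, hy, ⟨e ≪≫ e'⟩⟩⟩
      simp only [this])
  have hℓ0 : ∀ s, Slicing.IsSimpleIn H s → 0 ≤ ℓ (K0.of s) := fun s hs => by
    rw [hℓ s hs]
    split_ifs <;> norm_num
  let b : K0 C →+ ℝ := Complex.imAddGroupHom.comp τ.2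
  have hb : ∀ s, Slicing.IsSimpleIn H s → 0 < b (K0.of s) := fun s hs =>
    im_pos_of_heart hpre hH hB' hP hs.1 hs.not_isZero
  let lam : ℝ → K0 C →+ ℝ := fun t =>
    (AddMonoidHom.mulLeft (1 - t)).comp b + (AddMonoidHom.mulLeft t).comp ℓ
  have hlam : ∀ t x, lam t x = (1 - t) * b x + t * ℓ x := fun _ _ => rfl
  let Q : LFSlicing C := ⟨τ.slicing.squeeze hB hB' 0, hlf 0⟩
  let γ : ℝ → SlicingCharge C := fun t => (Q, mkCharge 0 (lam t))
  have hQ : Q.1.IsHeart 0 H := Slicing.isHeart_squeeze hB hB' hP hH 0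
  have hhalf : Q.1.HalfIntegral := Slicing.halfIntegral_squeeze hB hB'
  have hγ : Continuous γ := by
    refine Continuous.prodMk continuous_const (continuous_charge fun x => ?_)
    simp only [mkCharge_apply, hlam]
    fun_prop
  have hlax : ∀ t ∈ Set.Icc (0 : ℝ) 1, (γ t).IsLaxPreStability := by
    intro t ht
    refine isLaxPreStability_map (monotone_squeeze hB hB' (0 : unitInterval).2)
      (squeeze_add_one _) (σ := γ t) rfl (exists_nonneg_im_of_additive (lam t) hH
      (fun c hc => additive_nonneg_of_simples hH hal _ (fun s hs => ?_) hc) hB' hP)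
    rw [hlam]
    exact add_nonneg (mul_nonneg (by linarith [ht.2]) (hb s hs).le)
      (mul_nonneg ht.1 (hℓ0 s hs))
  have hstab : ∀ t ∈ Set.Ico (0 : ℝ) 1, (γ t).IsStability nrm := by
    intro t ht
    refine isStability_of_heart nrm (hlax t ⟨ht.1, ht.2.le⟩) hQ hal fun s hs => ?_
    have h1 : ((γ t).Z s).im = lam t (K0.of s) := by
      change (((0 : ℝ) : ℂ) + (lam t (K0.of s) : ℂ) * Complex.I).im = _
      simp
    rw [h1, hlam]
    exact add_pos_of_pos_of_nonneg (mul_pos (by linarith [ht.2]) (hb s hs))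
      (mul_nonneg ht.1 (hℓ0 s hs))
  have hγ0 : γ 0 = squeezePair τ hB hB' hlf 0 := by
    refine Prod.ext rfl (AddMonoidHom.ext fun x => ?_)
    change ((0 : ℝ) : ℂ) + (((1 - 0) * b x + 0 * ℓ x : ℝ) : ℂ) * Complex.I =
      (((0 : ℝ) * (τ.2 x).re : ℝ) : ℂ) + (b x : ℂ) * Complex.I
    simp
  have hmem : ∀ t ∈ Set.Ico (0 : ℝ) 1, γ t ∈ S := by
    have : PreconnectedSpace (Set.Ico (0 : ℝ) 1) := Subtype.preconnectedSpace isPreconnected_Ico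
    intro t ht
    exact hS.mem_of_continuous (T := Set.Ico (0 : ℝ) 1) (γ := fun t => γ t)
      (hγ.comp continuous_subtype_val) (fun t => hstab t t.2)
      (t₀ := ⟨0, by simp⟩) (by rw [hγ0]; exact hτ₁) ⟨t, ht⟩
  -- For `t < 1` the positive summand `(1 - t) b` keeps all simple objects massive; only the end
  -- point can leave `S`.
  have hcl : γ 1 ∈ closure S := by
    refine map_mem_closure hγ (s := Set.Ico (0 : ℝ) 1) ?_ hmem
    rw [closure_Ico (by norm_num)]
    simp
  have hZ : ∀ c, (γ 1).Z c = (ℓ (K0.of c) : ℂ) * Complex.I := fun c => by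
    change ((0 : ℝ) : ℂ) + (((1 - 1) * b (K0.of c) + 1 * ℓ (K0.of c) : ℝ) : ℂ) * Complex.I = _
    simp
  have hlax1 := hlax 1 (by simp)
  have hmassless := massless_eq_triangulatedClosure hlax1 hQ hal.1 hhalf.noPhaseAt
  refine ⟨γ 1, ⟨⟨hlax1, ?_⟩, hcl⟩, ?_⟩
  -- A massive stable object is a shift of a simple object with height `1`, so its charge has norm
  -- one and a bound for `nrm` on the simple objects suffices.
  · obtain ⟨K, hK, hKs⟩ := Slicing.exists_bound_simples hal (fun s => nrm (1 ⊗ₜ K0.of s))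
      (fun s t ⟨e⟩ => by simp only [K0.of_iso e])
    refine ⟨K, hK, fun s hs hm => ?_⟩
    obtain ⟨t, k, ht, ⟨e⟩⟩ := hhalf.stable hQ (fun X => (hal.1 X).1) hs
    have h1 : (γ 1).Z t ≠ 0 := by
      intro h0
      have h2 : (γ 1).massless s := by
        rw [hmassless]
        intro R hR hR' hGR
        exact R.prop_of_iso e (R.le_shift k _ (hGR _ ⟨ht, h0⟩))
      exact hm.ne' h2
    have h2 : ‖(γ 1).Z s‖ = 1 := by
      have h3 : (γ 1).Z s = (γ 1).Z (t⟦k⟧) := by rw [SlicingCharge.Z, ← K0.of_iso e]; rfl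
      rw [h3, norm_Z_shift]
      rw [hZ, hℓ t ht] at h1 ⊢
      split_ifs at h1 ⊢
      · simp at h1
      · simp
    rw [h2, one_div, inv_mul_le_iff₀ hK, mul_one, ← K0.of_iso e, seminorm_shift]
    exact hKs t ht
  · rw [hmassless]
    refine triangulatedClosure_congr ?_ ?_
    · rintro x ⟨hx, hx0⟩
      rw [hZ, hℓ x hx] at hx0
      by_contra h
      rw [if_neg h] at hx0
      simp at hx0
    · intro x hx
      refine ⟨hG x hx, ?_⟩
      rw [hZ, hℓ x (hG x hx), if_pos ⟨x, hx, ⟨Iso.refl x⟩⟩]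
      simp

end Main

end LaxStab

open LaxStab
theorem mainTheorem9
    {C : Type u} [Category.{v} C] [HasZeroObject C] [HasShift C ℤ] [Preadditive C]
    [∀ n : ℤ, (shiftFunctor C n).Additive] [Pretriangulated C] [IsTriangulated C]
    [Module.Free ℤ (K0 C)] [Module.Finite ℤ (K0 C)]
    (nrm : Seminorm ℝ (ℝ ⊗[ℤ] K0 C)) (hnrm : ∀ x, nrm x = 0 → x = 0)
    (S : Set (SlicingCharge C)) (hS : IsStabComponent nrm S) (hfin : IsFiniteType S)
    (N : ObjectProperty C) :
    (∃ σ ∈ LaxStabOf nrm S, σ.massless = N) ↔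
      ∃ τ ∈ S, ∃ I : Set τ.slicing.Heart, I.Finite ∧ (∀ s ∈ I, Simple s) ∧
        N = triangulatedClosure (fun X => ∃ s ∈ I, s.obj = X) := by
  constructor
  · rintro ⟨σ, ⟨hσ, hcl⟩, rfl⟩
    exact exists_simples_of_massless hS hfin hσ.1 hcl
  · rintro ⟨τ, hτ, I, -, hI, rfl⟩
    have hH : τ.slicing.IsHeart 0 (τ.slicing.interval (Set.Ioc 0 1)) := by
      simpa using τ.slicing.isHeart_interval 0
    have hal := (hfin τ hτ).1
    obtain ⟨τ', hτ', B, hB, hB', hH', hP⟩ := exists_rotate_phasesIn hS hτ hH hal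
    refine exists_lax_of_simples hS hτ' hH' hal hB hB' hP _ ?_
    rintro x ⟨s, hs, rfl⟩
    exact ⟨s.property, hI s hs⟩
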